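/- Let $k=\mathbb R$ or $\mathbb C$ and let $G$ be a (finite-dimensional) Lie group over $k$ with Lie algebra $\mathfrak g$. Let $r\in\operatorname{End}\mathfrak g$ satisfy the modified classical Yang–Baxter identity $$[rX,rY]-r([rX,Y]+[X,rY])=-[X,Y],$$ put $r_\pm=\tfrac12(r\pm\mathrm{id})$, and let $\mathfrak g_r$ be the space $\mathfrak g$ with the Lie bracket $[X,Y]_r=\tfrac12([rX,Y]+[X,rY])$. Let $G_r\subset G\times G$, $h\mapsto(h_+,h_-)$, be a Lie subgroup (a Lie group injectively immersed by a homomorphism) with Lie algebra $\{(r_+X,r_-X):X\in\mathfrak g\}\cong\mathfrak g_r$. Let $F\in\mathfrak g_r^*$, and let $\mathcal O_F\subset\mathfrak g_r^*$ be its $G_r$-coadjoint orbit, with the manifold structure of a homogeneous space of $G_r$ and the Kirillov form $\omega_{\mathcal O}$, whose value at $f$ on the tangent vectors generated by $X,Y\in\mathfrak g_r$ is $\langle f,[X,Y]_r\rangle$. Identify $T^*G$ with $G\times\mathfrak g^*$ by left translations. The action $(h,h'):x\mapsto hxh'^{-1}$ of $G\times G$ on $G$ lifts to $T^*G$ as $(g,\xi)\mapsto(hgh'^{-1},\mathrm{Ad}^*_{h'}\xi)$,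 where $\mathrm{Ad}^*_h\xi=\xi\circ\mathrm{Ad}_{h^{-1}}$, with moment map $(g,\xi)\mapsto(\mathrm{Ad}^*_g\xi,-\xi)$ for the canonical form $\omega_{T^*G}=-d\theta$ ($\theta$ the Liouville form). Let $\mu$ be the moment map of $G_r$ on $T^*G$ (the restriction of this one to $\mathfrak g_r$), let $G_r$ act diagonally on $T^*G\times\mathcal O_F$, and equip $T^*G\times\mathcal O_F$ with the difference $\omega_{\mathcal O}-\omega_{T^*G}$ of the symplectic forms and with $J(g,\xi,f)=f-\mu(g,\xi)$. Let $G^\circ=\{h_+h_-^{-1}:h\in G_r\}$ be the set of factorizable elements of $G$, and assume that every $h\in G_r$ with $h_+=h_-$ acts trivially on $\mathcal O_F$ (for example, that the factorization $g=h_+h_-^{-1}$ is unique). If every element of $G$ is factorizable, then $T^*G^\circ=T^*G$ below. (i) The action of $G_r$ on $T^*G\times\mathcal O_F$ is Hamiltonian with equivariant moment map $J$. The subset $T^*G^\circ\times\mathcal O_F$ is open and $G_r$-invariant, $0$ is a regular value of $J$ on $J^{-1}(0)\cap(T^*G^\circ\times\mathcal O_F)$, and the reduced space $$T^*G^\circ\times\mathcal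 O_F/\!/G_r=\bigl(J^{-1}(0)\cap(T^*G^\circ\times\mathcal O_F)\bigr)/G_r$$ is a manifold, the quotient of the embedded submanifold $J^{-1}(0)\cap(T^*G^\circ\times\mathcal O_F)$, and carries a nondegenerate reduced form, whose pull-back to that submanifold is the restriction of the form of $T^*G\times\mathcal O_F$. The map $\kappa:f\mapsto[(1,f,f)]$ is a symplectomorphism of $\mathcal O_F$ onto this reduced space. (ii) Suppose in addition that $G$ is connected. Let $\mathcal H\in\mathcal S(\mathfrak g)^{\mathfrak g}$ be a Casimir element, regarded as a polynomial on $\mathfrak g^*$, and extend it to $T^*G$ by $(g,\xi)\mapsto\mathcal H(\xi)$. This function is $G\times G$-invariant. It admits reduction: it descends to a smooth function $\mathcal H_{red}$ on the reduced space, and $\mathcal H_{red}\circ\kappa=i_r(\mathcal H)|_{\mathcal O_F}$. Here $i_r:\mathcal S(\mathfrak g)\to\mathcal S(\mathfrak g_r)$ is the inverse of the isomorphism $x\mapsto x\cdot1$ given by the action $x\cdot y=\sum r_+(x_i^{(1)})\,y\,S(r_-(x_i^{(2)}))$, with $\Delta x=\sum x_i^{(1)}\otimes x_i^{(2)}$ the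 coproduct and $S$ the antipode. The Hamiltonian vector field of $\mathcal H$ on $T^*G\times\mathcal O_F$ is tangent to $J^{-1}(0)\cap(T^*G^\circ\times\mathcal O_F)$ and projects to that of $\mathcal H_{red}$, which corresponds under $\kappa$ to the Hamiltonian vector field of $i_r(\mathcal H)|_{\mathcal O_F}$; integral curves descend accordingly. (The Hamiltonian flow of $\varphi$ is $\dot\psi=\{\varphi,\psi\}$.) The quotient flow on $\mathcal O_F$ is described by the Lax equation: along its integral curves $f(t)$, for either sign, $$\frac{d}{dt}\langle f,Y\rangle=\langle f,[M_\pm,Y]\rangle\quad(Y\in\mathfrak g),\qquad M_\pm=r_\pm(d\mathcal H(f)),$$ and if $B$ is a nondegenerate invariant bilinear form on $\mathfrak g$ and $L=L(f)\in\mathfrak g$ is defined by $B(L,\cdot)=f$, then $\dot L=[L,M_\pm]$. -/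

import Mathlib

open scoped Manifold ContDiff TensorProduct

noncomputable section

/-! ### Lie groups: adjoint and coadjoint action

Throughout, `𝕜` is `ℝ` or `ℂ`, a Lie group `G` is modelled on a normed space `E`, its Lie algebra
`𝔤 = T₁G` (`GroupLieAlgebra 𝓘(𝕜, E) G`, with Mathlib's bracket of left-invariant vector fields)
has `E` as underlying space, and the dual `𝔤*` is `E →L[𝕜] 𝕜`. -/

section LieGroups

variable (𝕜 : Type*) [RCLike 𝕜] {E : Type*} [NormedAddCommGroup E] [NormedSpace 𝕜 E]
  (G : Type*) [TopologicalSpace G] [ChartedSpace E G] [Group G]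

/-- The Lie bracket of `𝔤 = T₁G`. -/
def lieBr (X Y : E) : E :=
  @Bracket.bracket (GroupLieAlgebra 𝓘(𝕜, E) G) (GroupLieAlgebra 𝓘(𝕜, E) G) _ X Y

variable {G} (E)

/-- The adjoint action `Ad g : 𝔤 → 𝔤`, the differential at `1` of `x ↦ g x g⁻¹`. -/
def Ad (g : G) : E →L[𝕜] E :=
  (mfderiv 𝓘(𝕜, E) 𝓘(𝕜, E) (fun x : G => g * x * g⁻¹) 1 :)

/-- The left trivialisation `T_g G → 𝔤`, the differential of `x ↦ g⁻¹ x` at `g`. -/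
def leftTriv (g : G) : E →L[𝕜] E :=
  (mfderiv 𝓘(𝕜, E) 𝓘(𝕜, E) (fun x : G => g⁻¹ * x) g :)

variable {𝕜 E}

/-- The coadjoint action `g ↦ (Ad g⁻¹)ᵀ` on `𝔤*`. -/
def coAd (g : G) (ξ : E →L[𝕜] 𝕜) : E →L[𝕜] 𝕜 := ξ.comp (Ad 𝕜 E g⁻¹)

/-- The lift to `T*G ≃ G × 𝔤*` (left trivialisation) of the action
`(h, h') : x ↦ h x h'⁻¹` of `G × G` on `G`. -/
def cotAct (h h' : G) (p : G × (E →L[𝕜] 𝕜)) : G × (E →L[𝕜] 𝕜) :=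
  (h * p.1 * h'⁻¹, coAd h' p.2)

/-- The moment map `T*G → 𝔤* ⊕ 𝔤*` of the action of `G × G`. -/
def cotMoment (p : G × (E →L[𝕜] 𝕜)) : (E →L[𝕜] 𝕜) × (E →L[𝕜] 𝕜) :=
  (coAd p.1 p.2, -p.2)

/-- The canonical symplectic form of `T*G ≃ G × 𝔤*` (left trivialisation): `ω = -dθ`
(`= ∑ dqᵢ ∧ dpᵢ`), where `θ_(g,ξ) (v, α) = ⟨ξ, X⟩`, `X = (dL_g)⁻¹ v`, is the Liouville form.
For left-invariant extensions of `(v, α)` and `(w, β)`, with `Y = (dL_g)⁻¹ w`,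
`dθ ((v, α), (w, β)) = α Y - β X - ⟨ξ, [X, Y]⟩`. -/
def cotForm (p : G × (E →L[𝕜] 𝕜)) (v w : E × (E →L[𝕜] 𝕜)) : 𝕜 :=
  w.2 (leftTriv 𝕜 E p.1 v.1) - v.2 (leftTriv 𝕜 E p.1 w.1)
    + p.2 (lieBr 𝕜 G (leftTriv 𝕜 E p.1 v.1) (leftTriv 𝕜 E p.1 w.1))

theorem Ad_one : Ad 𝕜 E (1 : G) = ContinuousLinearMap.id 𝕜 E := by
  unfold Ad
  have : (fun x : G => (1 : G) * x * (1 : G)⁻¹) = id := by ext x; simp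
  rw [this]
  exact mfderiv_id

section

variable [LieGroup 𝓘(𝕜, E) ∞ G]

theorem contMDiff_conj (g : G) :
    ContMDiff 𝓘(𝕜, E) 𝓘(𝕜, E) ∞ (fun x : G => g * x * g⁻¹) :=
  (contMDiff_mul_right (I := 𝓘(𝕜, E)) (n := ∞) (a := g⁻¹)).comp
    (contMDiff_mul_left (I := 𝓘(𝕜, E)) (n := ∞) (a := g))

theorem Ad_mul (g h : G) : Ad 𝕜 E (g * h) = (Ad 𝕜 E g).comp (Ad 𝕜 E h) := by
  unfold Ad
  have e : (fun x : G => (g * h) * x * (g * h)⁻¹)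
      = (fun x : G => g * x * g⁻¹) ∘ (fun x : G => h * x * h⁻¹) := by
    ext x; simp [mul_assoc]
  have e2 := mfderiv_comp (I' := 𝓘(𝕜, E)) (1 : G)
    (((contMDiff_conj (𝕜 := 𝕜) g).mdifferentiable (by simp)) ((fun x : G => h * x * h⁻¹) 1))
    (((contMDiff_conj (𝕜 := 𝕜) h).mdifferentiable (by simp)) (1 : G))
  have h2 : h * 1 * h⁻¹ = (1 : G) := by simp
  rw [h2] at e2
  rw [e]
  exact e2

end

end LieGroups

/-! ### r-matrices -/

section RMatrix

variable (𝕜 : Type*) [RCLike 𝕜] {E : Type*} [NormedAddCommGroup E] [NormedSpace 𝕜 E]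
  (G : Type*) [TopologicalSpace G] [ChartedSpace E G] [Group G]

/-- The modified classical Yang-Baxter identity. -/
def ModifiedCYBE (r : E →L[𝕜] E) : Prop :=
  ∀ X Y : E, lieBr 𝕜 G (r X) (r Y) - r (lieBr 𝕜 G (r X) Y + lieBr 𝕜 G X (r Y)) = -lieBr 𝕜 G X Y

/-- The r-bracket, i.e. the bracket of the Lie algebra `𝔤_r`. -/
def rBr (r : E →L[𝕜] E) (X Y : E) : E :=
  (1 / 2 : 𝕜) • (lieBr 𝕜 G (r X) Y + lieBr 𝕜 G X (r Y))

variable {𝕜}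

/-- `r₊ = (r + id) / 2`. -/
def rPlus (r : E →L[𝕜] E) : E →L[𝕜] E := (1 / 2 : 𝕜) • (r + ContinuousLinearMap.id 𝕜 E)

/-- `r₋ = (r - id) / 2`. -/
def rMinus (r : E →L[𝕜] E) : E →L[𝕜] E := (1 / 2 : 𝕜) • (r - ContinuousLinearMap.id 𝕜 E)

theorem rPlus_sub_rMinus (r : E →L[𝕜] E) (X : E) : rPlus r X - rMinus r X = X := by
  simp only [rPlus, rMinus, smul_apply, add_apply, sub_apply, ContinuousLinearMap.id_apply, ← smul_sub]
  rw [add_sub_sub_cancel, ← two_smul 𝕜 X, smul_smul]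
  norm_num

/-- The (immersed) Lie subgroup `G_r ⊂ G × G` with Lie algebra
`{(r₊ X, r₋ X)} ⊂ 𝔤 ⊕ 𝔤`: a Lie group `Gr` with an injective smooth homomorphism
`h ↦ (h₊, h₋)` to `G × G` whose differential at `1` is, under the linear isomorphism `lie`,
the map `X ↦ (r₊ X, r₋ X)`. The isomorphism `lie` identifies `𝔤_r` (the space `𝔤`) with
the Lie algebra of `Gr`. -/
structure RSubgroup (r : E →L[𝕜] E) (E' : Type*) [NormedAddCommGroup E'] [NormedSpace 𝕜 E']
    (Gr : Type*) [TopologicalSpace Gr] [ChartedSpace E' Gr] [Group Gr] where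
  plus : Gr →* G
  minus : Gr →* G
  contMDiff_plus : ContMDiff 𝓘(𝕜, E') 𝓘(𝕜, E) ∞ plus
  contMDiff_minus : ContMDiff 𝓘(𝕜, E') 𝓘(𝕜, E) ∞ minus
  injective : Function.Injective fun h : Gr => (plus h, minus h)
  lie : E ≃L[𝕜] E'
  mfderiv_plus : ∀ X : E, (mfderiv 𝓘(𝕜, E') 𝓘(𝕜, E) plus 1 (lie X : E') : E) = rPlus r X
  mfderiv_minus : ∀ X : E, (mfderiv 𝓘(𝕜, E') 𝓘(𝕜, E) minus 1 (lie X : E') : E) = rMinus r X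

end RMatrix

/-- The model with corners of the manifold `T*G × 𝒪_F ≃ (G × 𝔤*) × 𝒪_F`. -/
abbrev phaseModel (𝕜 : Type*) [RCLike 𝕜] (E : Type*) [NormedAddCommGroup E] [NormedSpace 𝕜 E]
    (d : ℕ) :=
  (𝓘(𝕜, E).prod 𝓘(𝕜, E →L[𝕜] 𝕜)).prod 𝓘(𝕜, EuclideanSpace 𝕜 (Fin d))

namespace RSubgroup

variable {𝕜 : Type*} [RCLike 𝕜] {E : Type*} [NormedAddCommGroup E] [NormedSpace 𝕜 E]
  {G : Type*} [TopologicalSpace G] [ChartedSpace E G] [Group G] {r : E →L[𝕜] E}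
  {E' : Type*} [NormedAddCommGroup E'] [NormedSpace 𝕜 E']
  {Gr : Type*} [TopologicalSpace Gr] [ChartedSpace E' Gr] [Group Gr]
  (S : RSubgroup G r E' Gr)

/-- The set `{h₊ h₋⁻¹ : h ∈ G_r}` of factorizable elements of `G`: the `G_r`-orbit of `1 ∈ G`. -/
def cell : Set G := Set.range fun h : Gr => S.plus h * (S.minus h)⁻¹

/-- The coadjoint action of `G_r` on `𝔤_r*`. -/
def coAdr (h : Gr) (f : E →L[𝕜] 𝕜) : E →L[𝕜] 𝕜 :=
  f.comp ((S.lie.symm : E' →L[𝕜] E).comp ((Ad 𝕜 E' h⁻¹).comp (S.lie : E →L[𝕜] E')))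

/-- The coadjoint orbit `𝒪_F ⊂ 𝔤_r*` of `G_r`. -/
def Orbit (F : E →L[𝕜] 𝕜) : Type _ := {f : E →L[𝕜] 𝕜 // ∃ h : Gr, S.coAdr h F = f}

variable (F : E →L[𝕜] 𝕜)

/-- The orbit map `G_r → 𝒪_F`. -/
def orbitMap (h : Gr) : S.Orbit F := ⟨S.coAdr h F, h, rfl⟩

/-- The orbit has the topology of the homogeneous space of `G_r`. -/
instance : TopologicalSpace (S.Orbit F) := TopologicalSpace.coinduced (S.orbitMap F) inferInstance

section

theorem coAdr_one (f : E →L[𝕜] 𝕜) : S.coAdr 1 f = f := by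
  ext X; simp [coAdr, Ad_one]

variable [LieGroup 𝓘(𝕜, E') ∞ Gr]

theorem coAdr_mul (h k : Gr) (f : E →L[𝕜] 𝕜) :
    S.coAdr (h * k) f = S.coAdr h (S.coAdr k f) := by
  ext X; simp [coAdr, Ad_mul]

instance : MulAction Gr (S.Orbit F) where
  smul k f := ⟨S.coAdr k f.1, by
    obtain ⟨h, hh⟩ := f.2
    exact ⟨k * h, by rw [coAdr_mul, hh]⟩⟩
  one_smul f := Subtype.ext (S.coAdr_one f.1)
  mul_smul h k f := Subtype.ext (S.coAdr_mul h k f.1)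

/-- The diagonal action of `G_r` on `T*G × 𝒪_F ≃ (G × 𝔤*) × 𝒪_F`; on `T*G` the group
`G_r ⊂ G × G` acts by (lifted) left and right translations. -/
instance [LieGroup 𝓘(𝕜, E) ∞ G] : MulAction Gr ((G × (E →L[𝕜] 𝕜)) × S.Orbit F) where
  smul k m := (cotAct (S.plus k) (S.minus k) m.1, k • m.2)
  one_smul m := by
    refine Prod.ext (Prod.ext ?_ ?_) (one_smul Gr m.2)
    · change S.plus 1 * m.1.1 * (S.minus 1)⁻¹ = m.1.1
      simp
    · change coAd (S.minus 1) m.1.2 = m.1.2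
      ext X; simp [coAd, Ad_one]
  mul_smul h k m := by
    refine Prod.ext (Prod.ext ?_ ?_) (mul_smul h k m.2)
    · change S.plus (h * k) * m.1.1 * (S.minus (h * k))⁻¹
        = S.plus h * (S.plus k * m.1.1 * (S.minus k)⁻¹) * (S.minus h)⁻¹
      simp [mul_assoc]
    · change coAd (S.minus (h * k)) m.1.2 = coAd (S.minus h) (coAd (S.minus k) m.1.2)
      ext X; simp [coAd, Ad_mul]

end

/-- The restriction `𝔤* ⊕ 𝔤* → 𝔤_r*` of functionals along `X ↦ (r₊ X, r₋ X)`. -/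
def restr (_S : RSubgroup G r E' Gr) (η : (E →L[𝕜] 𝕜) × (E →L[𝕜] 𝕜)) : E →L[𝕜] 𝕜 :=
  η.1.comp (rPlus r) + η.2.comp (rMinus r)

/-- The moment map of `G_r` on `T*G × 𝒪_F`: the difference of the moment map of `𝒪_F`
(the inclusion in `𝔤_r*`) and that of `T*G`. -/
def moment (m : (G × (E →L[𝕜] 𝕜)) × S.Orbit F) : E →L[𝕜] 𝕜 :=
  m.2.1 - S.restr (cotMoment m.1)

/-- The open part `T*G° × 𝒪_F` of the phase space, `G°` being the set of factorizable elements. -/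
def bigCell : Set ((G × (E →L[𝕜] 𝕜)) × S.Orbit F) := {m | m.1.1 ∈ S.cell}

section

variable {d : ℕ} [ChartedSpace (EuclideanSpace 𝕜 (Fin d)) (S.Orbit F)]

/-- The manifold structure of the orbit is that of the homogeneous space: the orbit map
`G_r → 𝒪_F` is a smooth surjective submersion (this determines the structure). -/
structure IsOrbitManifold : Prop where
  isManifold : IsManifold 𝓘(𝕜, EuclideanSpace 𝕜 (Fin d)) ∞ (S.Orbit F)
  t2 : T2Space (S.Orbit F)
  contMDiff : ContMDiff 𝓘(𝕜, E') 𝓘(𝕜, EuclideanSpace 𝕜 (Fin d)) ∞ (S.orbitMap F)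
  submersion : ∀ h : Gr, Function.Surjective
    (mfderiv 𝓘(𝕜, E') 𝓘(𝕜, EuclideanSpace 𝕜 (Fin d)) (S.orbitMap F) h)

variable [LieGroup 𝓘(𝕜, E') ∞ Gr]

/-- The tangent vector at `f` of the curve `t ↦ exp(tX) • f` in the orbit, for `X ∈ 𝔤_r`. -/
def fundVec (X : E) (f : S.Orbit F) :
    TangentSpace 𝓘(𝕜, EuclideanSpace 𝕜 (Fin d)) f :=
  (mfderiv 𝓘(𝕜, E') 𝓘(𝕜, EuclideanSpace 𝕜 (Fin d)) (fun k : Gr => k • f) 1 (S.lie X : E') :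
    EuclideanSpace 𝕜 (Fin d))

/-- `σ` is the Kirillov form of the coadjoint orbit: at `f`, for `X, Y ∈ 𝔤_r`, it takes the
value `⟨f, [X, Y]_r⟩` on the tangent vectors of the orbit generated by `X` and `Y`; and it is
nondegenerate. -/
structure IsKirillovForm
    (σ : ∀ f : S.Orbit F, LinearMap.BilinForm 𝕜
      (TangentSpace 𝓘(𝕜, EuclideanSpace 𝕜 (Fin d)) f)) : Prop where
  apply : ∀ (f : S.Orbit F) (X Y : E),
    σ f (S.fundVec F X f) (S.fundVec F Y f) = f.1 (rBr 𝕜 G r X Y)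
  nondegenerate : ∀ (f : S.Orbit F) (v : TangentSpace 𝓘(𝕜, EuclideanSpace 𝕜 (Fin d)) f),
    (∀ w, σ f v w = 0) → v = 0

end

variable {F} in
/-- The symplectic form of `T*G × 𝒪_F`: the difference `ω_𝒪 - ω_(T*G)`. -/
def phaseForm {d : ℕ} [ChartedSpace (EuclideanSpace 𝕜 (Fin d)) (S.Orbit F)]
    (σ : ∀ f : S.Orbit F, LinearMap.BilinForm 𝕜
      (TangentSpace 𝓘(𝕜, EuclideanSpace 𝕜 (Fin d)) f))
    (m : (G × (E →L[𝕜] 𝕜)) × S.Orbit F)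
    (v w : TangentSpace (phaseModel 𝕜 E d) m) : 𝕜 :=
  σ m.2 (v : (E × (E →L[𝕜] 𝕜)) × EuclideanSpace 𝕜 (Fin d)).2
      (w : (E × (E →L[𝕜] 𝕜)) × EuclideanSpace 𝕜 (Fin d)).2
    - cotForm m.1 (v : (E × (E →L[𝕜] 𝕜)) × EuclideanSpace 𝕜 (Fin d)).1
      (w : (E × (E →L[𝕜] 𝕜)) × EuclideanSpace 𝕜 (Fin d)).1

end RSubgroup

/-! ### Hamiltonian actions, reduction, Hamiltonian vector fields -/

section Reduction

variable {𝕜 : Type*} [RCLike 𝕜]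
  {EM : Type*} [NormedAddCommGroup EM] [NormedSpace 𝕜 EM] {HM : Type*} [TopologicalSpace HM]
  (I : ModelWithCorners 𝕜 EM HM) {M : Type*} [TopologicalSpace M] [ChartedSpace HM M]

/-- `X` is the Hamiltonian vector field of `H` for the form `σ`: `dH = σ(·, X)`. With the Poisson
bracket determined by `{φ, ψ} = σ(X_φ, X_ψ)`, the flow of `X_H` is `φ' = {H, φ}`. -/
def IsHamiltonianField (σ : ∀ m : M, TangentSpace I m → TangentSpace I m → 𝕜) (H : M → 𝕜)
    (X : ∀ m : M, TangentSpace I m) : Prop :=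
  ∀ (m : M) (w : TangentSpace I m), (mfderiv I 𝓘(𝕜, 𝕜) H m w : 𝕜) = σ m w (X m)

/-- The curve `γ` is at time `t` differentiable with velocity `X (γ t)`; an integral curve of `X`
is a curve for which this holds at all times. -/
def HasVelocityAt (X : ∀ m : M, TangentSpace I m) (γ : 𝕜 → M) (t : 𝕜) : Prop :=
  HasMFDerivAt 𝓘(𝕜, 𝕜) I γ t ((1 : 𝕜 →L[𝕜] 𝕜).smulRight (X (γ t)))

variable {E' : Type*} [NormedAddCommGroup E'] [NormedSpace 𝕜 E']
  {K : Type*} [TopologicalSpace K] [ChartedSpace E' K] [Group K] [MulAction K M]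
  {V : Type*} [NormedAddCommGroup V] [NormedSpace 𝕜 V]

/-- The action of the Lie group `K` on `(M, Ω)` is Hamiltonian with equivariant moment map `J`.
Here the Lie algebra of `K` is identified with `V` by `lie` and `coad` is the coadjoint action
of `K` on `V*`. -/
structure IsHamiltonianAction (Ω : ∀ m : M, TangentSpace I m → TangentSpace I m → 𝕜)
    (lie : V ≃L[𝕜] E') (coad : K → (V →L[𝕜] 𝕜) → (V →L[𝕜] 𝕜)) (J : M → (V →L[𝕜] 𝕜)) : Prop where
  contMDiff_smul : ContMDiff (𝓘(𝕜, E').prod I) I ∞ fun p : K × M => p.1 • p.2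
  preserves : ∀ (k : K) (m : M) (v w : TangentSpace I m),
    Ω (k • m) (mfderiv I I (fun x : M => k • x) m v) (mfderiv I I (fun x : M => k • x) m w)
      = Ω m v w
  contMDiff_moment : ContMDiff I 𝓘(𝕜, V →L[𝕜] 𝕜) ∞ J
  equivariant : ∀ (k : K) (m : M), J (k • m) = coad k (J m)
  moment : ∀ (m : M) (X : V) (w : TangentSpace I m),
    (mfderiv I 𝓘(𝕜, 𝕜) (fun x : M => J x X) m w : 𝕜)
      = Ω m (mfderiv 𝓘(𝕜, E') I (fun k : K => k • m) 1 (lie X : E') : EM) w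

/-- The zero level of `J` in the part `U` of `M`. -/
abbrev ZeroLevel {W : Type*} [Zero W] (U : Set M) (J : M → W) : Type _ :=
  {m : M // m ∈ U ∧ J m = 0}

variable (K) in
/-- Two points of the zero level are equivalent if they lie in one orbit of `K`. -/
def levelSetoid {W : Type*} [Zero W] (U : Set M) (J : M → W) : Setoid (ZeroLevel U J) :=
  (MulAction.orbitRel K M).comap Subtype.val

variable (K) in
/-- The reduced space `U // K = (U ∩ J⁻¹(0)) / K`, with the quotient topology. -/
abbrev ReducedSpace {W : Type*} [Zero W] (U : Set M) (J : M → W) : Type _ :=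
  Quotient (levelSetoid K U J)

variable (K) in
/-- The projection of the zero level on the reduced space. -/
def toReduced {W : Type*} [Zero W] (U : Set M) (J : M → W) (z : ZeroLevel U J) :
    ReducedSpace K U J := Quotient.mk (levelSetoid K U J) z

/-- Symplectic reduction at zero of the `K`-invariant open part `U` of `(M, Ω)`: zero is a regular
value of `J`, so that the zero level is an embedded submanifold; the reduced space is a manifold,
the quotient of the zero level (the projection is a smooth surjective submersion, which determines
the manifold structure); and `σ`, the reduced form, is the nondegenerate form whose pull-back to
the zero level is the restriction of `Ω`. -/
structure IsSymplecticReduction (Ω : ∀ m : M, TangentSpace I m → TangentSpace I m → 𝕜)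
    (U : Set M) (J : M → V) {a b : ℕ}
    [ChartedSpace (EuclideanSpace 𝕜 (Fin a)) (ZeroLevel U J)]
    [ChartedSpace (EuclideanSpace 𝕜 (Fin b)) (ReducedSpace K U J)]
    (σ : ∀ q : ReducedSpace K U J,
      LinearMap.BilinForm 𝕜 (TangentSpace 𝓘(𝕜, EuclideanSpace 𝕜 (Fin b)) q)) : Prop where
  isOpen : IsOpen U
  invariant : ∀ (k : K) (m : M), m ∈ U → k • m ∈ U
  regular : ∀ z : ZeroLevel U J, Function.Surjective (mfderiv I 𝓘(𝕜, V) J z.1)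
  isManifold_level : IsManifold 𝓘(𝕜, EuclideanSpace 𝕜 (Fin a)) ∞ (ZeroLevel U J)
  contMDiff_incl : ContMDiff 𝓘(𝕜, EuclideanSpace 𝕜 (Fin a)) I ∞
    (Subtype.val : ZeroLevel U J → M)
  immersion : ∀ z : ZeroLevel U J, Function.Injective
    (mfderiv 𝓘(𝕜, EuclideanSpace 𝕜 (Fin a)) I (Subtype.val : ZeroLevel U J → M) z)
  isManifold_reduced : IsManifold 𝓘(𝕜, EuclideanSpace 𝕜 (Fin b)) ∞ (ReducedSpace K U J)
  t2_reduced : T2Space (ReducedSpace K U J)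
  contMDiff_proj : ContMDiff 𝓘(𝕜, EuclideanSpace 𝕜 (Fin a)) 𝓘(𝕜, EuclideanSpace 𝕜 (Fin b)) ∞
    (toReduced K U J)
  submersion : ∀ z : ZeroLevel U J, Function.Surjective
    (mfderiv 𝓘(𝕜, EuclideanSpace 𝕜 (Fin a)) 𝓘(𝕜, EuclideanSpace 𝕜 (Fin b)) (toReduced K U J) z)
  pullback : ∀ (z : ZeroLevel U J) (v w : TangentSpace 𝓘(𝕜, EuclideanSpace 𝕜 (Fin a)) z),
    σ (toReduced K U J z)
      (mfderiv 𝓘(𝕜, EuclideanSpace 𝕜 (Fin a)) 𝓘(𝕜, EuclideanSpace 𝕜 (Fin b))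
        (toReduced K U J) z v)
      (mfderiv 𝓘(𝕜, EuclideanSpace 𝕜 (Fin a)) 𝓘(𝕜, EuclideanSpace 𝕜 (Fin b))
        (toReduced K U J) z w)
    = Ω z.1
      (mfderiv 𝓘(𝕜, EuclideanSpace 𝕜 (Fin a)) I (Subtype.val : ZeroLevel U J → M) z v)
      (mfderiv 𝓘(𝕜, EuclideanSpace 𝕜 (Fin a)) I (Subtype.val : ZeroLevel U J → M) z w)
  nondegenerate : ∀ (q : ReducedSpace K U J)
    (v : TangentSpace 𝓘(𝕜, EuclideanSpace 𝕜 (Fin b)) q), (∀ w, σ q v w = 0) → v = 0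

end Reduction

/-- The point `(1, f, f)` of the zero level of the moment map in `T*G × 𝒪_F`. -/
def RSubgroup.slice {𝕜 : Type*} [RCLike 𝕜] {E : Type*} [NormedAddCommGroup E] [NormedSpace 𝕜 E]
    {G : Type*} [TopologicalSpace G] [ChartedSpace E G] [Group G] [LieGroup 𝓘(𝕜, E) ∞ G]
    {r : E →L[𝕜] E} {E' : Type*} [NormedAddCommGroup E'] [NormedSpace 𝕜 E']
    {Gr : Type*} [TopologicalSpace Gr] [ChartedSpace E' Gr] [Group Gr]
    (S : RSubgroup G r E' Gr) (F : E →L[𝕜] 𝕜) (f : S.Orbit F) :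
    ZeroLevel (S.bigCell F) (S.moment F) :=
  ⟨((1, f.1), f), ⟨1, by simp⟩, by
    ext X
    have h : f.1 (rPlus r X) - f.1 (rMinus r X) = f.1 X := by
      rw [← map_sub, rPlus_sub_rMinus]
    simp only [RSubgroup.moment, RSubgroup.restr, cotMoment, coAd, inv_one, Ad_one,
      sub_apply, add_apply,
      ContinuousLinearMap.comp_apply, ContinuousLinearMap.id_apply,
      neg_apply, zero_apply]
    rw [← sub_eq_add_neg, h, sub_self]⟩

/-! ### The symmetric algebra, Casimir elements, and the map `i_r` -/

section Symmetric

variable (𝕜 : Type*) [RCLike 𝕜] {E : Type*} [NormedAddCommGroup E] [NormedSpace 𝕜 E]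

/-- `H ∈ S(𝔤)` is a Casimir element, i.e. it is killed by the derivation of `S(𝔤)` extending
`ad X`, for all `X ∈ 𝔤` (that derivation exists and is unique). -/
def IsCasimir (G : Type*) [TopologicalSpace G] [ChartedSpace E G] [Group G]
    (H : SymmetricAlgebra 𝕜 E) : Prop :=
  ∀ X : E, ∃ D : Derivation 𝕜 (SymmetricAlgebra 𝕜 E) (SymmetricAlgebra 𝕜 E),
    (∀ Y : E, D (SymmetricAlgebra.ι 𝕜 E Y) = SymmetricAlgebra.ι 𝕜 E (lieBr 𝕜 G X Y)) ∧ D H = 0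

variable {𝕜}

/-- The polynomial function on `𝔤*` given by an element of `S(𝔤)`. -/
def polyFun (H : SymmetricAlgebra 𝕜 E) (ξ : E →L[𝕜] 𝕜) : 𝕜 :=
  SymmetricAlgebra.lift (ξ : E →ₗ[𝕜] 𝕜) H

variable (𝕜 E) in
/-- The coproduct of `S(𝔤)`, determined by `X ↦ X ⊗ 1 + 1 ⊗ X`. -/
def symComul : SymmetricAlgebra 𝕜 E →ₐ[𝕜] SymmetricAlgebra 𝕜 E ⊗[𝕜] SymmetricAlgebra 𝕜 E :=
  SymmetricAlgebra.lift
    ((Algebra.TensorProduct.includeLeft (R := 𝕜) (S := 𝕜) (A := SymmetricAlgebra 𝕜 E)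
        (B := SymmetricAlgebra 𝕜 E)).toLinearMap ∘ₗ SymmetricAlgebra.ι 𝕜 E
      + (Algebra.TensorProduct.includeRight (R := 𝕜) (A := SymmetricAlgebra 𝕜 E)
        (B := SymmetricAlgebra 𝕜 E)).toLinearMap ∘ₗ SymmetricAlgebra.ι 𝕜 E)

variable (𝕜 E) in
/-- The antipode of `S(𝔤)`, determined by `X ↦ -X`. -/
def symAntipode : SymmetricAlgebra 𝕜 E →ₐ[𝕜] SymmetricAlgebra 𝕜 E :=
  SymmetricAlgebra.lift (-SymmetricAlgebra.ι 𝕜 E)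

/-- The extension of a linear map of `𝔤` to `S(𝔤)`. -/
def symMap (φ : E →L[𝕜] E) : SymmetricAlgebra 𝕜 E →ₐ[𝕜] SymmetricAlgebra 𝕜 E :=
  SymmetricAlgebra.lift (SymmetricAlgebra.ι 𝕜 E ∘ₗ (φ : E →ₗ[𝕜] E))

/-- The action `x · y = ∑ r₊(xᵢ¹) y (r₋(xᵢ²))'` of `S(𝔤_r)` on `S(𝔤)`, where
`Δ x = ∑ xᵢ¹ ⊗ xᵢ²` and `'` is the antipode. (`S(𝔤_r) = S(𝔤)` as algebras.) -/
def symAct (r : E →L[𝕜] E) (y : SymmetricAlgebra 𝕜 E) :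
    SymmetricAlgebra 𝕜 E →ₗ[𝕜] SymmetricAlgebra 𝕜 E :=
  LinearMap.mul' 𝕜 (SymmetricAlgebra 𝕜 E) ∘ₗ
    TensorProduct.map
      (LinearMap.mulRight 𝕜 y ∘ₗ (symMap (rPlus r)).toLinearMap)
      ((symAntipode 𝕜 E).toLinearMap ∘ₗ (symMap (rMinus r)).toLinearMap) ∘ₗ
    (symComul 𝕜 E).toLinearMap

theorem symAct_one (r : E →L[𝕜] E) : symAct r (1 : SymmetricAlgebra 𝕜 E) = LinearMap.id := by
  have h : ((Algebra.TensorProduct.lmul' 𝕜 (S := SymmetricAlgebra 𝕜 E)).comp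
      (Algebra.TensorProduct.map (symMap (rPlus r))
        ((symAntipode 𝕜 E).comp (symMap (rMinus r))))).comp (symComul 𝕜 E)
      = AlgHom.id 𝕜 (SymmetricAlgebra 𝕜 E) := by
    apply SymmetricAlgebra.algHom_ext
    ext X
    simp [symComul, symMap, symAntipode, ← sub_eq_add_neg, ← map_sub, rPlus_sub_rMinus]
  have h2 := congrArg AlgHom.toLinearMap h
  rw [symAct, LinearMap.mulRight_one, LinearMap.id_comp]
  exact h2

/-- The isomorphism `i_r : S(𝔤) → S(𝔤_r)` inverse to `x ↦ x · 1`. -/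
def iR (r : E →L[𝕜] E) : SymmetricAlgebra 𝕜 E ≃ₗ[𝕜] SymmetricAlgebra 𝕜 E :=
  (LinearEquiv.ofBijective (symAct r 1) (by
    rw [symAct_one]; exact Function.bijective_id)).symm

end Symmetric

end

set_option linter.unusedSectionVars false

/-! Everything rests on `r₊ - r₋ = id`. On the zero level of `J` one has `f = ξ ∘ T_g`, with `T_g =
Ad g⁻¹ r₊ - r₋`. If `g = h₊ h₋⁻¹`, then `T_g = Ad (h₋) ∘ Adr h⁻¹` (`cellOp_cellMap`), which is
invertible. Over the factorizable elements the level is therefore a graph over pairs `(g, f)`, and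
zero is a regular value there. The map `h ↦ h₊ h₋⁻¹` has differential `r₊ - r₋ = id` at `1` up to
`lie`, and is equivariant. It is therefore a submersion with open image and has smooth local
sections.

`G_r` acts transitively on the factorizable elements, and the stabilizer of `1` consists of the `h`
with `h₊ = h₋`, which act trivially on the orbit. Each `G_r`-orbit in the level thus contains
exactly one point `(1, f, f)` (`exists_smul_slice`, `smul_eq_of_cellMap_eq`), and the quotient map
becomes `(g, f) ↦ h⁻¹ • f` (`baseProj`). The smooth structure of the quotient is that of the orbit,
carried over (`exists_reduced_diffeomorph`).

For the forms, a tangent vector of the level is the sum of a vector along the `G_r`-orbit and one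
along a translate of the slice (`exists_decomposition`). The first kind lies in the kernel of the
restricted form by the moment map identity. On the second kind invariance leads back to `g = 1`,
where the cotangent form vanishes because `g` does not move, and only the Kirillov form remains
(`phaseFormAt_eq`).

A Casimir element satisfies `ξ [dH ξ, X] = 0`, which gives coadjoint invariance on a connected
group. Its Hamiltonian field moves only `g`, with left-trivialised velocity `dH ξ`, and is tangent
to the level by the same identity. Its projection is found by pairing with all projected vectors and
using nondegeneracy (`diffAt_baseProj_tangent`). The map `i_r` is the identity on the underlying
algebra, since `x · 1 = x`. On the orbit the field is minus the one generated by `dH f`, so it acts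
as `Y ↦ f [dH f, Y]_r`. The term `f [dH f, rY]` vanishes, and `± f [dH f, Y] / 2` can be added
freely, which gives both signs of the Lax equation (`coeL_orbitVec`).

Two foundations are needed as well. The bracket of left-invariant fields is identified with the
differential of `Ad` by calculus in the chart at `1` (`lieBr_eq_diffAt_Ad`). The coadjoint orbit is
given its homogeneous manifold structure by a constant rank argument (`exists_slice_nhd`,
`exists_isOrbitManifold`), and injectivity of the differential of its inclusion makes the Kirillov
form nondegenerate. -/

section Development

open Set Filter Topology

noncomputable section

/-! ### Differential calculus on manifolds with derivatives between model spaces. -/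

section Calculus

variable {𝕜 : Type*} [RCLike 𝕜]

section HasDiffAt

variable {E₁ : Type*} [NormedAddCommGroup E₁] [NormedSpace 𝕜 E₁] {H₁ : Type*} [TopologicalSpace H₁]
  {I₁ : ModelWithCorners 𝕜 E₁ H₁} {M₁ : Type*} [TopologicalSpace M₁] [ChartedSpace H₁ M₁]
  {E₂ : Type*} [NormedAddCommGroup E₂] [NormedSpace 𝕜 E₂] {H₂ : Type*} [TopologicalSpace H₂]
  {I₂ : ModelWithCorners 𝕜 E₂ H₂} {M₂ : Type*} [TopologicalSpace M₂] [ChartedSpace H₂ M₂]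
  {E₃ : Type*} [NormedAddCommGroup E₃] [NormedSpace 𝕜 E₃] {H₃ : Type*} [TopologicalSpace H₃]
  {I₃ : ModelWithCorners 𝕜 E₃ H₃} {M₃ : Type*} [TopologicalSpace M₃] [ChartedSpace H₃ M₃]
  {E₄ : Type*} [NormedAddCommGroup E₄] [NormedSpace 𝕜 E₄] {H₄ : Type*} [TopologicalSpace H₄]
  {I₄ : ModelWithCorners 𝕜 E₄ H₄} {M₄ : Type*} [TopologicalSpace M₄] [ChartedSpace H₄ M₄]

variable (I₁ I₂) in
/-- `HasMFDerivAt`, with the derivative regarded as a map between the model spaces. -/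
def HasDiffAt (f : M₁ → M₂) (x : M₁) (A : E₁ →L[𝕜] E₂) : Prop := HasMFDerivAt I₁ I₂ f x A

variable (I₁ I₂) in
/-- `mfderiv`, regarded as a map between the model spaces. -/
def diffAt (f : M₁ → M₂) (x : M₁) : E₁ →L[𝕜] E₂ := mfderiv I₁ I₂ f x

theorem HasDiffAt.mdifferentiableAt {f : M₁ → M₂} {x : M₁} {A : E₁ →L[𝕜] E₂}
    (h : HasDiffAt I₁ I₂ f x A) : MDifferentiableAt I₁ I₂ f x :=
  HasMFDerivAt.mdifferentiableAt h

theorem HasDiffAt.diffAt_eq {f : M₁ → M₂} {x : M₁} {A : E₁ →L[𝕜] E₂}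
    (h : HasDiffAt I₁ I₂ f x A) : diffAt I₁ I₂ f x = A :=
  HasMFDerivAt.mfderiv h

theorem HasDiffAt.mfderiv_apply {f : M₁ → M₂} {x : M₁} {A : E₁ →L[𝕜] E₂}
    (h : HasDiffAt I₁ I₂ f x A) (v : E₁) :
    (mfderiv I₁ I₂ f x v : E₂) = A v :=
  congrArg (fun B : E₁ →L[𝕜] E₂ => B v) h.diffAt_eq

theorem hasDiffAt_diffAt {f : M₁ → M₂} {x : M₁} (h : MDifferentiableAt I₁ I₂ f x) :
    HasDiffAt I₁ I₂ f x (diffAt I₁ I₂ f x) :=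
  h.hasMFDerivAt

theorem ContMDiffAt.hasDiffAt {f : M₁ → M₂} {x : M₁} (h : ContMDiffAt I₁ I₂ ∞ f x) :
    HasDiffAt I₁ I₂ f x (diffAt I₁ I₂ f x) :=
  hasDiffAt_diffAt (h.mdifferentiableAt (by simp))

theorem ContMDiff.hasDiffAt {f : M₁ → M₂} (h : ContMDiff I₁ I₂ ∞ f) (x : M₁) :
    HasDiffAt I₁ I₂ f x (diffAt I₁ I₂ f x) :=
  h.contMDiffAt.hasDiffAt

theorem HasDiffAt.unique {f : M₁ → M₂} {x : M₁} {A B : E₁ →L[𝕜] E₂}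
    (h : HasDiffAt I₁ I₂ f x A) (h' : HasDiffAt I₁ I₂ f x B) : A = B := by
  rw [← h.diffAt_eq, h'.diffAt_eq]

theorem HasDiffAt.comp {f : M₁ → M₂} {g : M₂ → M₃} {x : M₁} {y : M₂} {A : E₁ →L[𝕜] E₂}
    {B : E₂ →L[𝕜] E₃} (hg : HasDiffAt I₂ I₃ g y B) (hf : HasDiffAt I₁ I₂ f x A) (hy : f x = y) :
    HasDiffAt I₁ I₃ (fun z => g (f z)) x (B.comp A) := by
  subst hy
  exact HasMFDerivAt.comp x hg hf

theorem HasDiffAt.congr {f g : M₁ → M₂} {x : M₁} {A : E₁ →L[𝕜] E₂}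
    (h : HasDiffAt I₁ I₂ f x A) (hfg : g =ᶠ[𝓝 x] f) : HasDiffAt I₁ I₂ g x A :=
  HasMFDerivAt.congr_of_eventuallyEq h hfg

theorem HasDiffAt.congr_deriv {f : M₁ → M₂} {x : M₁} {A B : E₁ →L[𝕜] E₂}
    (h : HasDiffAt I₁ I₂ f x A) (hAB : ∀ v, A v = B v) : HasDiffAt I₁ I₂ f x B :=
  ContinuousLinearMap.ext hAB ▸ h

theorem hasDiffAt_id (x : M₁) : HasDiffAt I₁ I₁ (fun y : M₁ => y) x (.id 𝕜 E₁) :=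
  hasMFDerivAt_id x

theorem hasDiffAt_const (x : M₁) (c : M₂) : HasDiffAt I₁ I₂ (fun _ : M₁ => c) x 0 :=
  hasMFDerivAt_const c x

theorem HasDiffAt.prodMk {f : M₁ → M₂} {g : M₁ → M₃} {x : M₁} {A : E₁ →L[𝕜] E₂}
    {B : E₁ →L[𝕜] E₃} (hf : HasDiffAt I₁ I₂ f x A) (hg : HasDiffAt I₁ I₃ g x B) :
    HasDiffAt I₁ (I₂.prod I₃) (fun z => (f z, g z)) x (A.prod B) :=
  HasMFDerivAt.prodMk hf hg

theorem hasDiffAt_fst (x : M₁ × M₂) :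
    HasDiffAt (I₁.prod I₂) I₁ (fun z : M₁ × M₂ => z.1) x (.fst 𝕜 E₁ E₂) :=
  hasMFDerivAt_fst x

theorem hasDiffAt_snd (x : M₁ × M₂) :
    HasDiffAt (I₁.prod I₂) I₂ (fun z : M₁ × M₂ => z.2) x (.snd 𝕜 E₁ E₂) :=
  hasMFDerivAt_snd x

theorem HasFDerivAt.hasDiffAt {f : E₁ → E₂} {x : E₁} {A : E₁ →L[𝕜] E₂} (h : HasFDerivAt f A x) :
    HasDiffAt 𝓘(𝕜, E₁) 𝓘(𝕜, E₂) f x A :=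
  h.hasMFDerivAt

theorem HasDiffAt.hasFDerivAt {f : E₁ → E₂} {x : E₁} {A : E₁ →L[𝕜] E₂}
    (h : HasDiffAt 𝓘(𝕜, E₁) 𝓘(𝕜, E₂) f x A) : HasFDerivAt f A x :=
  HasMFDerivAt.hasFDerivAt h

theorem ContinuousLinearMap.hasDiffAt (A : E₁ →L[𝕜] E₂) (x : E₁) :
    HasDiffAt 𝓘(𝕜, E₁) 𝓘(𝕜, E₂) A x A :=
  A.hasFDerivAt.hasDiffAt

/-- The derivative of a map on a product is the sum of its partial derivatives. -/
theorem HasDiffAt.of_prod {f : M₁ × M₂ → M₃} {x : M₁} {y : M₂}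
    (hf : MDifferentiableAt (I₁.prod I₂) I₃ f (x, y)) {A : E₁ →L[𝕜] E₃} {B : E₂ →L[𝕜] E₃}
    (hA : HasDiffAt I₁ I₃ (fun z => f (z, y)) x A) (hB : HasDiffAt I₂ I₃ (fun z => f (x, z)) y B) :
    HasDiffAt (I₁.prod I₂) I₃ f (x, y) (A.coprod B) := by
  have h := hasDiffAt_diffAt hf
  have h1 := hA.unique (h.comp ((hasDiffAt_id (I₁ := I₁) x).prodMk (hasDiffAt_const x y)) rfl)
  have h2 := hB.unique (h.comp ((hasDiffAt_const (I₁ := I₂) (I₂ := I₁) y x).prodMk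
    (hasDiffAt_id y)) rfl)
  convert h using 1
  ext v
  · simp [h1]
  · simp [h2]

end HasDiffAt

/-! ### Submersions and local sections. -/

section LocalSection

variable {E₁ : Type*} [NormedAddCommGroup E₁] [NormedSpace 𝕜 E₁]
  {M₁ : Type*} [TopologicalSpace M₁] [ChartedSpace E₁ M₁] [IsManifold 𝓘(𝕜, E₁) ∞ M₁]
  {E₂ : Type*} [NormedAddCommGroup E₂] [NormedSpace 𝕜 E₂] [FiniteDimensional 𝕜 E₂]
  {M₂ : Type*} [TopologicalSpace M₂] [ChartedSpace E₂ M₂]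

/-- Restricted to the affine subspace `x + B u`, with `B` a right inverse of the differential, `f`
has identity differential at `u = 0`. The inverse function theorem there produces the section. -/
theorem ContDiffAt.exists_local_section {f : E₁ → E₂} {x : E₁} (hf : ContDiffAt 𝕜 ∞ f x)
    (h : Function.Surjective (fderiv 𝕜 f x)) :
    ∃ s : E₂ → E₁, s (f x) = x ∧ ContDiffAt 𝕜 ∞ s (f x) ∧ ∀ᶠ y in 𝓝 (f x), f (s y) = y := by
  have : CompleteSpace E₂ := FiniteDimensional.complete 𝕜 E₂
  obtain ⟨B, hB⟩ := (fderiv 𝕜 f x : E₁ →ₗ[𝕜] E₂).exists_rightInverse_of_surjective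
    (LinearMap.range_eq_top.2 h)
  let B' : E₂ →L[𝕜] E₁ := LinearMap.toContinuousLinearMap B
  have hB' : ∀ v, fderiv 𝕜 f x (B' v) = v := fun v => LinearMap.congr_fun hB v
  let g : E₂ → E₂ := fun u => f (x + B' u)
  have hx : x + B' 0 = x := by simp
  have hi : ContDiff 𝕜 ∞ (fun u : E₂ => x + B' u) := contDiff_const.add B'.contDiff
  have hg : ContDiffAt 𝕜 ∞ g 0 :=
    ContDiffAt.comp (0 : E₂) (g := f) (by rw [hx]; exact hf) hi.contDiffAt
  have hg' : HasFDerivAt g ((ContinuousLinearEquiv.refl 𝕜 E₂ : E₂ ≃L[𝕜] E₂) : E₂ →L[𝕜] E₂) 0 := by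
    have h1 : HasFDerivAt (fun u : E₂ => x + B' u) B' 0 := B'.hasFDerivAt.const_add x
    have h2 : HasFDerivAt f (fderiv 𝕜 f x) (x + B' 0) := by
      rw [hx]; exact (hf.differentiableAt (by simp)).hasFDerivAt
    have h3 : HasFDerivAt g ((fderiv 𝕜 f x).comp B') 0 := h2.comp (0 : E₂) h1
    rwa [show (fderiv 𝕜 f x).comp B' = (ContinuousLinearEquiv.refl 𝕜 E₂ : E₂ →L[𝕜] E₂) from
      ContinuousLinearMap.ext hB'] at h3
  have g0 : g 0 = f x := by simp [g]
  refine ⟨fun y => x + B' (hg.localInverse hg' (by simp) y), ?_, ?_, ?_⟩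
  · have := hg.localInverse_apply_image hg' (by simp)
    rw [g0] at this
    simp [this]
  · rw [← g0]
    exact hi.contDiffAt.comp _ (hg.to_localInverse hg' (by simp))
  · rw [← g0]
    exact (hg.hasStrictFDerivAt' hg' (by simp)).eventually_right_inverse

/-- A submersion has smooth local sections. -/
theorem ContMDiffAt.exists_local_section {f : M₁ → M₂} {x : M₁}
    (hf : ContMDiffAt 𝓘(𝕜, E₁) 𝓘(𝕜, E₂) ∞ f x)
    (h : Function.Surjective (diffAt 𝓘(𝕜, E₁) 𝓘(𝕜, E₂) f x)) :
    ∃ s : M₂ → M₁, s (f x) = x ∧ ContMDiffAt 𝓘(𝕜, E₂) 𝓘(𝕜, E₁) ∞ s (f x) ∧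
      ∀ᶠ y in 𝓝 (f x), f (s y) = y := by
  have hf' := (contMDiffAt_iff.1 hf).2
  simp only [modelWithCornersSelf_coe, range_id, contDiffWithinAt_univ] at hf'
  set φ := extChartAt 𝓘(𝕜, E₁) x with hφ
  set ψ := extChartAt 𝓘(𝕜, E₂) (f x) with hψ
  have h0 : (ψ ∘ f ∘ φ.symm) (φ x) = ψ (f x) := by
    simp [hφ]
  have hd : fderiv 𝕜 (ψ ∘ f ∘ φ.symm) (φ x) = diffAt 𝓘(𝕜, E₁) 𝓘(𝕜, E₂) f x := by
    have hm := hf.mdifferentiableAt (by simp)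
    simp only [diffAt, mfderiv, hm, writtenInExtChartAt, modelWithCornersSelf_coe,
      range_id, fderivWithin_univ]
    rfl
  obtain ⟨s, hs1, hs2, hs3⟩ := hf'.exists_local_section (by rw [hd]; exact h)
  rw [h0] at hs1 hs2 hs3
  have hψc : ContMDiffAt 𝓘(𝕜, E₂) 𝓘(𝕜, E₂) ∞ ψ (f x) := contMDiffAt_extChartAt
  have hφc : ContMDiffAt 𝓘(𝕜, E₁) 𝓘(𝕜, E₁) ∞ φ.symm (φ x) :=
    (contMDiffOn_extChartAt_symm x).contMDiffAt (extChartAt_target_mem_nhds x)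
  have hsm : ContMDiffAt 𝓘(𝕜, E₂) 𝓘(𝕜, E₁) ∞ (fun y => φ.symm (s (ψ y))) (f x) := by
    refine ContMDiffAt.comp (f x) (g := φ.symm) ?_ (hs2.contMDiffAt.comp (f x) hψc)
    simp only [hs1]; exact hφc
  have e0 : φ.symm (s (ψ (f x))) = x := by rw [hs1]; simp [hφ]
  refine ⟨fun y => φ.symm (s (ψ y)), e0, hsm, ?_⟩
  -- The section equation is known only after applying `ψ`. To cancel `ψ`, both points must lie in
  -- its source.
  have c1 : ∀ᶠ y in 𝓝 (f x), f (φ.symm (s (ψ y))) ∈ ψ.source := by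
    have : ContinuousAt (fun y => f (φ.symm (s (ψ y)))) (f x) :=
      ContinuousAt.comp (g := f) (by rw [e0]; exact hf.continuousAt) hsm.continuousAt
    refine this.eventually ?_
    simp only [e0]
    exact extChartAt_source_mem_nhds (f x)
  have c2 : ∀ᶠ y in 𝓝 (f x), y ∈ ψ.source := extChartAt_source_mem_nhds (f x)
  have c3 := hψc.continuousAt.eventually hs3
  filter_upwards [c1, c2, c3] with y h1 h2 h3
  exact ψ.injOn h1 h2 h3

/-- A smooth map with surjective differential is open. -/
theorem ContMDiff.isOpenMap_of_submersion {f : M₁ → M₂} (hf : ContMDiff 𝓘(𝕜, E₁) 𝓘(𝕜, E₂) ∞ f)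
    (h : ∀ x, Function.Surjective (diffAt 𝓘(𝕜, E₁) 𝓘(𝕜, E₂) f x)) : IsOpenMap f := by
  refine IsOpenMap.of_nhds_le fun x => ?_
  obtain ⟨s, h1, h2, h3⟩ := hf.contMDiffAt.exists_local_section (h x)
  intro U hU
  have : ∀ᶠ y in 𝓝 (f x), s y ∈ f ⁻¹' U := by
    refine h2.continuousAt.eventually ?_
    rw [h1]; exact hU
  filter_upwards [this, h3] with y hy hy'
  rw [← hy']; exact hy

end LocalSection

/-! ### The constant rank theorem. -/

section ConstantRank

variable {X : Type*} [NormedAddCommGroup X] [NormedSpace 𝕜 X] [FiniteDimensional 𝕜 X]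
  {Y : Type*} [NormedAddCommGroup Y] [NormedSpace 𝕜 Y]
  {Z : Type*} [NormedAddCommGroup Z] [NormedSpace 𝕜 Z]

/-- A form of the constant rank theorem: if the projection `P ∘ R` of a smooth map `R` is a
submersion at `x` and has near `x` the same critical directions as `R`, then near `x` the value of
`R` depends only on that of `P ∘ R`. -/
theorem ContDiffAt.eventually_eq_of_proj_eq {R : X → Y} {x : X} (hR : ContDiffAt 𝕜 ∞ R x)
    (P : Y →L[𝕜] Z) (hP : Function.Surjective fun w => P (fderiv 𝕜 R x w))
    (hker : ∀ᶠ y in 𝓝 x, ∀ w, P (fderiv 𝕜 R y w) = 0 → fderiv 𝕜 R y w = 0) :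
    ∃ U ∈ 𝓝 x, ∀ y ∈ U, ∀ y' ∈ U, P (R y) = P (R y') → R y = R y' := by
  have : CompleteSpace X := FiniteDimensional.complete 𝕜 X
  let A : X →L[𝕜] Z := P.comp (fderiv 𝕜 R x)
  obtain ⟨C, hC⟩ := LinearMap.exists_leftInverse_of_injective (A : X →ₗ[𝕜] Z).ker.subtype
    (by simp)
  let C' : X →L[𝕜] (A : X →ₗ[𝕜] Z).ker := LinearMap.toContinuousLinearMap C
  have hC' : ∀ k : (A : X →ₗ[𝕜] Z).ker, C' k = k := fun k => LinearMap.congr_fun hC k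
  -- Completing `P ∘ R` by a linear projection to the kernel of its differential gives local
  -- coordinates. What must be shown is that `R` does not depend on the second one.
  let ψ : X → Z × (A : X →ₗ[𝕜] Z).ker := fun y => (P (R y), C' y)
  let ψ' : X →ₗ[𝕜] Z × (A : X →ₗ[𝕜] Z).ker := (A : X →ₗ[𝕜] Z).prod C
  have hinj : Function.Injective ψ' := by
    rw [← LinearMap.ker_eq_bot, LinearMap.ker_eq_bot']
    intro v hv
    have h1 : A v = 0 := congrArg Prod.fst hv
    have h2 : C' v = 0 := congrArg Prod.snd hv
    have h3 := hC' ⟨v, h1⟩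
    simp only [h2] at h3
    exact (congrArg Subtype.val h3).symm
  have hsurj : Function.Surjective ψ' := by
    rintro ⟨z, k⟩
    obtain ⟨w, hw⟩ := hP z
    have hw' : A w = z := hw
    refine ⟨w + (k - C w : (A : X →ₗ[𝕜] Z).ker), Prod.ext ?_ ?_⟩
    · change A (w + (k - C w : (A : X →ₗ[𝕜] Z).ker)) = z
      rw [map_add, show A ((k - C w : (A : X →ₗ[𝕜] Z).ker) : X) = 0 from (k - C w).2, hw', add_zero]
    · change C (w + (k - C w : (A : X →ₗ[𝕜] Z).ker)) = k
      have := hC' (k - C w)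
      change C _ = _ at this
      rw [map_add, this, add_sub_cancel]
  let ψe : X ≃L[𝕜] Z × (A : X →ₗ[𝕜] Z).ker :=
    (LinearEquiv.ofBijective ψ' ⟨hinj, hsurj⟩).toContinuousLinearEquiv
  have hψ : ContDiffAt 𝕜 ∞ ψ x := (P.contDiff.contDiffAt.comp x hR).prodMk C'.contDiff.contDiffAt
  have hψ' : HasFDerivAt ψ (ψe : X →L[𝕜] Z × (A : X →ₗ[𝕜] Z).ker) x :=
    (P.hasFDerivAt.comp x (hR.differentiableAt (by simp)).hasFDerivAt).prodMk C'.hasFDerivAt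
  let Ψ := hψ.toOpenPartialHomeomorph ψ hψ' (by simp)
  have hxs : x ∈ Ψ.source := hψ.mem_toOpenPartialHomeomorph_source hψ' (by simp)
  have hΨ : ContDiffAt 𝕜 ∞ Ψ.symm (Ψ x) := hψ.to_localInverse hψ' (by simp)
  have hxt : Ψ x ∈ Ψ.target := Ψ.map_source hxs
  have hcont := hΨ.continuousAt
  have hback : Ψ.symm (Ψ x) = x := Ψ.left_inv hxs
  have e1 : ∀ᶠ p in 𝓝 (Ψ x), ContDiffAt 𝕜 1 Ψ.symm p :=
    (hΨ.of_le (by exact_mod_cast le_top)).eventually (by simp)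
  have e2 : ∀ᶠ p in 𝓝 (Ψ x), ContDiffAt 𝕜 1 R (Ψ.symm p) ∧
      ∀ w, P (fderiv 𝕜 R (Ψ.symm p) w) = 0 → fderiv 𝕜 R (Ψ.symm p) w = 0 := by
    have h1 : ∀ᶠ y in 𝓝 (Ψ.symm (Ψ x)), ContDiffAt 𝕜 1 R y ∧
        ∀ w, P (fderiv 𝕜 R y w) = 0 → fderiv 𝕜 R y w = 0 := by
      rw [hback]
      exact ((hR.of_le (by exact_mod_cast le_top)).eventually (by simp)).and hker
    exact hcont.eventually h1
  obtain ⟨ε, hε, hball⟩ := Metric.eventually_nhds_iff_ball.1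
    ((e1.and e2).and (Ψ.open_target.mem_nhds hxt))
  have hconst : ∀ (z : Z) (k k' : (A : X →ₗ[𝕜] Z).ker), (z, k) ∈ Metric.ball (Ψ x) ε →
      (z, k') ∈ Metric.ball (Ψ x) ε → R (Ψ.symm (z, k)) = R (Ψ.symm (z, k')) := by
    intro z k k' hk hk'
    have hsplit : ∀ q, (z, q) ∈ Metric.ball (Ψ x) ε ↔
        z ∈ Metric.ball (Ψ x).1 ε ∧ q ∈ Metric.ball (Ψ x).2 ε := by
      intro q
      rw [show Ψ x = ((Ψ x).1, (Ψ x).2) from rfl, ← ball_prod_same, Set.mem_prod]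
    have hd : ∀ q ∈ Metric.ball (Ψ x).2 ε,
        HasFDerivAt (𝕜 := 𝕜) (fun q => R (Ψ.symm (z, q))) 0 q := by
      intro q hq
      obtain ⟨⟨h1, h2, h3⟩, h4⟩ := hball (z, q) ((hsplit q).2 ⟨((hsplit k).1 hk).1, hq⟩)
      have d1 := (h1.differentiableAt (by simp)).hasFDerivAt
      have d2 := (h2.differentiableAt (by simp)).hasFDerivAt
      have d3 := (d2.comp (z, q) d1).comp q (hasFDerivAt_prodMk_right z q)
      have d4 : HasFDerivAt (fun p => P (R (Ψ.symm p)))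
          (P.comp ((fderiv 𝕜 R (Ψ.symm (z, q))).comp (fderiv 𝕜 Ψ.symm (z, q)))) (z, q) :=
        P.hasFDerivAt.comp _ (d2.comp (z, q) d1)
      have d5 : HasFDerivAt (fun p => P (R (Ψ.symm p)))
          (ContinuousLinearMap.fst 𝕜 Z (A : X →ₗ[𝕜] Z).ker) (z, q) := by
        refine hasFDerivAt_fst.congr_of_eventuallyEq ?_
        filter_upwards [Ψ.open_target.mem_nhds h4] with p hp
        exact congrArg Prod.fst (Ψ.right_inv hp)
      -- A direction of the second factor leaves `P ∘ R` unchanged, so the hypothesis on critical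
      -- directions makes `R` stationary along it.
      have d6 : ((fderiv 𝕜 R (Ψ.symm (z, q))).comp (fderiv 𝕜 Ψ.symm (z, q))).comp
          (ContinuousLinearMap.inr 𝕜 Z (A : X →ₗ[𝕜] Z).ker) = 0 := by
        ext1 w
        exact h3 _ (DFunLike.congr_fun (d4.unique d5) (0, w))
      rwa [d6] at d3
    -- Convexity of the ball is a real notion, also when the scalars are complex.
    let _ : NormedSpace ℝ (A : X →ₗ[𝕜] Z).ker := NormedSpace.restrictScalars ℝ 𝕜 _
    exact (convex_ball (Ψ x).2 ε).is_const_of_fderivWithin_eq_zero (𝕜 := 𝕜)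
      (fun q hq => (hd q hq).differentiableAt.differentiableWithinAt)
      (fun q hq => by
        rw [fderivWithin_of_isOpen Metric.isOpen_ball hq, (hd q hq).fderiv])
      ((hsplit k).1 hk).2 ((hsplit k').1 hk').2
  refine ⟨Ψ.source ∩ ψ ⁻¹' Metric.ball (Ψ x) ε, inter_mem (Ψ.open_source.mem_nhds hxs)
    (hψ.continuousAt.preimage_mem_nhds (Metric.ball_mem_nhds _ hε)), ?_⟩
  rintro y ⟨hy1, hy2⟩ y' ⟨hy1', hy2'⟩ hyy
  have h1 : Ψ.symm (P (R y), C' y) = y := Ψ.left_inv hy1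
  have h2 : Ψ.symm (P (R y'), C' y') = y' := Ψ.left_inv hy1'
  have h3 : ((P (R y'), C' y') : Z × _) ∈ Metric.ball (Ψ x) ε := hy2'
  rw [← hyy] at h2 h3
  rw [← h1, ← h2]
  exact hconst _ _ _ hy2 h3

end ConstantRank

/-! ### Transport of manifold structures along open embeddings. -/

section Transfer

variable {EN : Type*} [NormedAddCommGroup EN] [NormedSpace 𝕜 EN] {HN : Type*} [TopologicalSpace HN]
  (I : ModelWithCorners 𝕜 EN HN) [I.Boundaryless] {N : Type*} [TopologicalSpace N]
  [ChartedSpace HN N] [IsManifold I ∞ N]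
  {V : Type*} [NormedAddCommGroup V] [NormedSpace 𝕜 V]
  {Z : Type*} [TopologicalSpace Z] [Nonempty Z] {e : Z → N}

/-- The manifold structure of an open subset, modelled on a space isomorphic to the given one. -/
theorem Topology.IsOpenEmbedding.exists_chartedSpace (L : EN ≃L[𝕜] V) (he : IsOpenEmbedding e) :
    ∃ _ : ChartedSpace V Z, IsManifold 𝓘(𝕜, V) ∞ Z ∧ ContMDiff 𝓘(𝕜, V) I ∞ e ∧
      ∃ s : N → Z, (∀ z, s (e z) = z) ∧ ContMDiffOn I 𝓘(𝕜, V) ∞ s (range e) := by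
  let Λ : HN ≃ₜ V := I.toHomeomorph.trans L.toHomeomorph
  let ep : OpenPartialHomeomorph Z N := he.toOpenPartialHomeomorph e
  have eps : ∀ z, ep.symm (e z) = z := fun z => ep.left_inv (by simp [ep])
  let c : Z → OpenPartialHomeomorph Z V := fun z =>
    ep.trans ((chartAt HN (e z)).transHomeomorph Λ)
  have hc : ∀ z y, c z y = L (extChartAt I (e z) (e y)) := fun z y => rfl
  have hcs : ∀ z v, (c z).symm v = ep.symm ((extChartAt I (e z)).symm (L.symm v)) := fun z v => rfl
  have hcsrc : ∀ z y, y ∈ (c z).source ↔ e y ∈ (extChartAt I (e z)).source := by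
    intro z y; simp [c, ep]
  let cs : ChartedSpace V Z :=
    { atlas := range c
      chartAt := c
      mem_chart_source := fun z => by rw [hcsrc]; exact mem_extChartAt_source _
      chart_mem_atlas := fun z => ⟨z, rfl⟩ }
  have hctgt : ∀ z v, v ∈ (c z).target → L.symm v ∈ (extChartAt I (e z)).target ∧
      (extChartAt I (e z)).symm (L.symm v) = e ((c z).symm v) := by
    intro z v hv
    have h1 := (c z).map_target hv
    have h2 : c z ((c z).symm v) = v := (c z).right_inv hv
    rw [hcsrc] at h1
    rw [hc] at h2
    have h3 : extChartAt I (e z) (e ((c z).symm v)) = L.symm v := by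
      rw [← h2, L.symm_apply_apply, h2]
    rw [← h3]
    exact ⟨(extChartAt I (e z)).map_source h1, (extChartAt I (e z)).left_inv h1⟩
  have hman : IsManifold 𝓘(𝕜, V) ∞ Z := by
    refine isManifold_of_contDiffOn _ _ _ ?_
    rintro _ _ ⟨z, rfl⟩ ⟨z', rfl⟩
    simp only [modelWithCornersSelf_coe, modelWithCornersSelf_coe_symm, Function.comp_id,
      Function.id_comp, range_id, inter_univ, preimage_id]
    have h1 := contDiffOn_ext_coord_change (I := I) (n := ∞) (e z') (e z)
    have h2 : ContDiffOn 𝕜 ∞ (L ∘ (extChartAt I (e z') ∘ (extChartAt I (e z)).symm) ∘ L.symm)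
        ((c z).symm.trans (c z')).source := by
      refine L.contDiff.comp_contDiffOn (h1.comp L.symm.contDiff.contDiffOn ?_)
      intro v hv
      simp only [OpenPartialHomeomorph.trans_source, OpenPartialHomeomorph.symm_source,
        mem_inter_iff, mem_preimage] at hv
      obtain ⟨t1, t2⟩ := hctgt z v hv.1
      refine ⟨t1, ?_⟩
      change (extChartAt I (e z)).symm (L.symm v) ∈ (extChartAt I (e z')).source
      rw [t2, ← hcsrc]; exact hv.2
    refine h2.congr ?_
    intro v hv
    simp only [OpenPartialHomeomorph.trans_source, OpenPartialHomeomorph.symm_source,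
      mem_inter_iff, mem_preimage] at hv
    simp only [OpenPartialHomeomorph.coe_trans, Function.comp]
    rw [hc, (hctgt z v hv.1).2]
  have hext : ∀ z, extChartAt 𝓘(𝕜, V) z = (c z).toPartialEquiv := by
    intro z
    simp only [extChartAt, mfld_simps]
    rfl
  refine ⟨cs, hman, ?_, ep.symm, eps, ?_⟩
  · intro z
    refine contMDiffAt_iff.2 ⟨he.continuous.continuousAt, ?_⟩
    rw [hext]
    simp only [modelWithCornersSelf_coe, range_id, contDiffWithinAt_univ]
    refine L.symm.contDiff.contDiffAt.congr_of_eventuallyEq ?_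
    have hz : z ∈ (c z).source := mem_chart_source V z
    filter_upwards [(c z).open_target.mem_nhds ((c z).map_source hz)] with v hv
    obtain ⟨t1, t2⟩ := hctgt z v hv
    change extChartAt I (e z) (e ((c z).symm v)) = L.symm v
    rw [← t2, (extChartAt I (e z)).right_inv t1]
  · rintro _ ⟨z, rfl⟩
    refine ContMDiffAt.contMDiffWithinAt ?_
    have hr : range e ∈ 𝓝 (e z) := he.isOpen_range.mem_nhds ⟨z, rfl⟩
    refine contMDiffAt_iff.2 ⟨?_, ?_⟩
    · refine ep.symm.continuousAt ?_
      simp [ep]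
    rw [eps, hext, I.range_eq_univ, contDiffWithinAt_univ]
    refine L.contDiff.contDiffAt.congr_of_eventuallyEq ?_
    have h1 : ∀ᶠ v in 𝓝 (extChartAt I (e z) (e z)), (extChartAt I (e z)).symm v ∈ range e := by
      refine (continuousAt_extChartAt_symm (I := I) (e z)).eventually ?_
      rw [extChartAt_to_inv]; exact hr
    filter_upwards [h1, extChartAt_target_mem_nhds (I := I) (e z)] with v hv hv'
    obtain ⟨y, hy⟩ := hv
    change c z (ep.symm ((extChartAt I (e z)).symm v)) = L v
    rw [hc, ← hy, eps, hy, (extChartAt I (e z)).right_inv hv']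

end Transfer

/-! ### Functions with zero differential. -/

section ConstantOfDeriv

variable {E : Type*} [NormedAddCommGroup E] [NormedSpace 𝕜 E]
  {M : Type*} [TopologicalSpace M] [ChartedSpace E M] [IsManifold 𝓘(𝕜, E) ∞ M]

/-- A function with vanishing differential on a connected manifold is constant. -/
theorem eq_of_hasDiffAt_zero [PreconnectedSpace M] {f : M → 𝕜}
    (hf : ∀ x, HasDiffAt 𝓘(𝕜, E) 𝓘(𝕜, 𝕜) f x 0) (x y : M) : f x = f y := by
  have hloc : IsLocallyConstant f := by
    rw [IsLocallyConstant.iff_eventually_eq]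
    intro x
    set φ := extChartAt 𝓘(𝕜, E) x with hφ
    have ht : φ.target ∈ 𝓝 (φ x) := extChartAt_target_mem_nhds x
    obtain ⟨ε, hε, hball⟩ := Metric.mem_nhds_iff.1 ht
    have hd : ∀ v ∈ Metric.ball (φ x) ε, HasFDerivAt (𝕜 := 𝕜) (fun v => f (φ.symm v)) 0 v := by
      intro v hv
      have h1 : MDifferentiableAt 𝓘(𝕜, E) 𝓘(𝕜, E) φ.symm v :=
        ((contMDiffOn_extChartAt_symm (n := 1) x).contMDiffAt
          (Filter.mem_of_superset (Metric.isOpen_ball.mem_nhds hv) hball)).mdifferentiableAt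
          (by simp)
      have h2 := (hf (φ.symm v)).comp (hasDiffAt_diffAt h1) rfl
      simpa using h2.hasFDerivAt
    have hsrc : φ.source ∩ φ ⁻¹' Metric.ball (φ x) ε ∈ 𝓝 x :=
      inter_mem (extChartAt_source_mem_nhds x)
        ((continuousAt_extChartAt x).preimage_mem_nhds (Metric.ball_mem_nhds _ hε))
    let _ : NormedSpace ℝ E := NormedSpace.restrictScalars ℝ 𝕜 E
    filter_upwards [hsrc] with y hy
    have := (convex_ball (φ x) ε).is_const_of_fderivWithin_eq_zero (𝕜 := 𝕜)
      (fun v hv => (hd v hv).differentiableAt.differentiableWithinAt)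
      (fun v hv => by
        rw [fderivWithin_of_isOpen Metric.isOpen_ball hv, (hd v hv).fderiv])
      hy.2 (Metric.mem_ball_self hε)
    simpa [φ.left_inv hy.1, φ.left_inv (mem_extChartAt_source x)] using this
  exact hloc.apply_eq_of_isPreconnected isPreconnected_univ (mem_univ _) (mem_univ _)

end ConstantOfDeriv

end Calculus

/-! ### Differentials of the group operations, and the bracket as the differential of `Ad`. -/

section LieGroupCalculus

variable {𝕜 : Type*} [RCLike 𝕜] {E : Type*} [NormedAddCommGroup E] [NormedSpace 𝕜 E]
  {G : Type*} [TopologicalSpace G] [ChartedSpace E G] [Group G]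

section

variable [LieGroup 𝓘(𝕜, E) ∞ G]

theorem hasDiffAt_mul_one :
    HasDiffAt (𝓘(𝕜, E).prod 𝓘(𝕜, E)) 𝓘(𝕜, E) (fun p : G × G => p.1 * p.2) (1, 1)
      ((ContinuousLinearMap.id 𝕜 E).coprod (.id 𝕜 E)) := by
  refine HasDiffAt.of_prod ((contMDiff_mul 𝓘(𝕜, E) ∞).mdifferentiableAt (by simp)) ?_ ?_
  · simpa using hasDiffAt_id (1 : G)
  · simpa using hasDiffAt_id (1 : G)

variable {E₁ : Type*} [NormedAddCommGroup E₁] [NormedSpace 𝕜 E₁] {H₁ : Type*} [TopologicalSpace H₁]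
  {I₁ : ModelWithCorners 𝕜 E₁ H₁} {M : Type*} [TopologicalSpace M] [ChartedSpace H₁ M]

theorem HasDiffAt.mul_of_eq_one {a b : M → G} {x : M} {A B : E₁ →L[𝕜] E}
    (ha : HasDiffAt I₁ 𝓘(𝕜, E) a x A) (hb : HasDiffAt I₁ 𝓘(𝕜, E) b x B)
    (ha1 : a x = 1) (hb1 : b x = 1) :
    HasDiffAt I₁ 𝓘(𝕜, E) (fun y => a y * b y) x (A + B) := by
  have h := hasDiffAt_mul_one.comp (ha.prodMk hb) (by rw [ha1, hb1])
  convert h using 1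
  ext v; simp

/-- Obtained by differentiating `x * x⁻¹ = 1` at `1`. -/
theorem hasDiffAt_inv_one :
    HasDiffAt 𝓘(𝕜, E) 𝓘(𝕜, E) (fun x : G => x⁻¹) 1 (-.id 𝕜 E) := by
  have h := (contMDiff_inv (G := G) 𝓘(𝕜, E) ∞).hasDiffAt 1
  have h1 := (hasDiffAt_id (I₁ := 𝓘(𝕜, E)) (1 : G)).mul_of_eq_one h rfl inv_one
  simp only [mul_inv_cancel] at h1
  have h2 := h1.unique (hasDiffAt_const _ _)
  rwa [eq_neg_of_add_eq_zero_right h2] at h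

theorem HasDiffAt.inv_of_eq_one {a : M → G} {x : M} {A : E₁ →L[𝕜] E}
    (ha : HasDiffAt I₁ 𝓘(𝕜, E) a x A) (ha1 : a x = 1) :
    HasDiffAt I₁ 𝓘(𝕜, E) (fun y => (a y)⁻¹) x (-A) := by
  have h := hasDiffAt_inv_one.comp ha ha1
  convert h using 1
  ext v; simp

theorem hasDiffAt_mul_left (g x : G) :
    HasDiffAt 𝓘(𝕜, E) 𝓘(𝕜, E) (fun y : G => g * y) x
      (diffAt 𝓘(𝕜, E) 𝓘(𝕜, E) (fun y : G => g * y) x) :=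
  contMDiff_mul_left.hasDiffAt x

theorem hasDiffAt_leftTriv (g : G) :
    HasDiffAt 𝓘(𝕜, E) 𝓘(𝕜, E) (fun x : G => g⁻¹ * x) g (leftTriv 𝕜 E g) :=
  contMDiff_mul_left.hasDiffAt g

theorem hasDiffAt_conj (g : G) :
    HasDiffAt 𝓘(𝕜, E) 𝓘(𝕜, E) (fun x : G => g * x * g⁻¹) 1 (Ad 𝕜 E g) :=
  (contMDiff_conj g).hasDiffAt 1

variable (𝕜 E) in
/-- The differential at `1` of the left translation by `g`. -/
def leftTrans (g : G) : E →L[𝕜] E := diffAt 𝓘(𝕜, E) 𝓘(𝕜, E) (fun x : G => g * x) 1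

theorem hasDiffAt_leftTrans (g : G) :
    HasDiffAt 𝓘(𝕜, E) 𝓘(𝕜, E) (fun x : G => g * x) 1 (leftTrans 𝕜 E g) :=
  hasDiffAt_mul_left g 1

theorem leftTriv_leftTrans (g : G) (v : E) : leftTriv 𝕜 E g (leftTrans 𝕜 E g v) = v := by
  have h := (hasDiffAt_leftTriv g).comp (hasDiffAt_leftTrans (𝕜 := 𝕜) (E := E) g) (mul_one g)
  simp only [inv_mul_cancel_left] at h
  exact DFunLike.congr_fun (h.unique (hasDiffAt_id 1)) v

theorem leftTrans_leftTriv (g : G) (v : E) : leftTrans 𝕜 E g (leftTriv 𝕜 E g v) = v := by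
  have h := (hasDiffAt_leftTrans g).comp (hasDiffAt_leftTriv (𝕜 := 𝕜) (E := E) g)
    (inv_mul_cancel g)
  simp only [mul_inv_cancel_left] at h
  exact DFunLike.congr_fun (h.unique (hasDiffAt_id g)) v

theorem leftTriv_injective (g : G) : Function.Injective (leftTriv 𝕜 E g) :=
  Function.LeftInverse.injective (leftTrans_leftTriv g)

theorem leftTriv_surjective (g : G) : Function.Surjective (leftTriv 𝕜 E g) :=
  Function.RightInverse.surjective (leftTriv_leftTrans g)

/-- A map to a Lie group is differentiable if its left translate is. -/
theorem HasDiffAt.of_inv_mul {a : M → G} {x : M} {A : E₁ →L[𝕜] E} {g : G} (hg : a x = g)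
    (h : HasDiffAt I₁ 𝓘(𝕜, E) (fun y => g⁻¹ * a y) x A) :
    HasDiffAt I₁ 𝓘(𝕜, E) a x ((leftTrans 𝕜 E g).comp A) := by
  have h1 := (hasDiffAt_leftTrans g).comp h (by simp [hg])
  simpa using h1

theorem Ad_inv_Ad (g : G) (v : E) : Ad 𝕜 E g⁻¹ (Ad 𝕜 E g v) = v := by
  have := Ad_mul (𝕜 := 𝕜) (E := E) g⁻¹ g
  rw [inv_mul_cancel, Ad_one] at this
  exact (DFunLike.congr_fun this v).symm

theorem Ad_Ad_inv (g : G) (v : E) : Ad 𝕜 E g (Ad 𝕜 E g⁻¹ v) = v := by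
  simpa using Ad_inv_Ad (𝕜 := 𝕜) (E := E) g⁻¹ v

/-- The differential of the two-sided translation `x ↦ h x h'⁻¹` in the left trivialisation. -/
theorem leftTriv_diffAt_mul_mul_inv (h h' g : G) {A : E →L[𝕜] E}
    (hA : HasDiffAt 𝓘(𝕜, E) 𝓘(𝕜, E) (fun x : G => h * x * h'⁻¹) g A) (v : E) :
    leftTriv 𝕜 E (h * g * h'⁻¹) (A v) = Ad 𝕜 E h' (leftTriv 𝕜 E g v) := by
  have h1 := (hasDiffAt_leftTriv (h * g * h'⁻¹)).comp hA rfl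
  have h2 := (hasDiffAt_conj h').comp (hasDiffAt_leftTriv (𝕜 := 𝕜) (E := E) g) (by simp)
  have : (fun x : G => (h * g * h'⁻¹)⁻¹ * (h * x * h'⁻¹)) = fun x => h' * (g⁻¹ * x) * h'⁻¹ := by
    ext x; simp [mul_assoc]
  rw [this] at h1
  exact DFunLike.congr_fun (h1.unique h2) v

/-- The differential of the orbit map of the action of `G × G` on `G` by `x ↦ h x h'⁻¹`. -/
theorem HasDiffAt.mul_const_mul_inv {a b : M → G} {x : M} {A B : E₁ →L[𝕜] E}
    (ha : HasDiffAt I₁ 𝓘(𝕜, E) a x A) (hb : HasDiffAt I₁ 𝓘(𝕜, E) b x B)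
    (ha1 : a x = 1) (hb1 : b x = 1) (g : G) :
    HasDiffAt I₁ 𝓘(𝕜, E) (fun y => a y * g * (b y)⁻¹) x
      ((leftTrans 𝕜 E g).comp ((Ad 𝕜 E g⁻¹).comp A - B)) := by
  refine HasDiffAt.of_inv_mul (by simp [ha1, hb1]) ?_
  -- Translated by `g⁻¹`, the map becomes `(g⁻¹ a g) b⁻¹`, a product of two factors that are both
  -- `1` at `x`.
  have h1 := ((hasDiffAt_conj g⁻¹).comp ha ha1).mul_of_eq_one (hb.inv_of_eq_one hb1)
    (by simp [ha1]) (by simp [hb1])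
  rw [← sub_eq_add_neg] at h1
  convert h1 using 2
  simp [mul_assoc]

variable (𝕜 E) in
-- The tangent space at `1` is identified with `E` through the preferred chart at `1`, so this chart
-- has identity differential there. This lets the chart computations below be read directly in the
-- Lie algebra.
theorem hasDiffAt_extChartAt_one :
    HasDiffAt 𝓘(𝕜, E) 𝓘(𝕜, E) (extChartAt 𝓘(𝕜, E) (1 : G)) 1 (.id 𝕜 E) := by
  have : IsManifold 𝓘(𝕜, E) 1 G := .of_le (n := ∞) (by exact_mod_cast le_top)
  have h : HasDiffAt 𝓘(𝕜, E) 𝓘(𝕜, E) (extChartAt 𝓘(𝕜, E) (1 : G)) 1 _ :=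
    (contMDiffAt_extChartAt (n := ∞)).hasDiffAt
  have h1 : diffAt 𝓘(𝕜, E) 𝓘(𝕜, E) (extChartAt 𝓘(𝕜, E) (1 : G)) 1 = .id 𝕜 E :=
    mfderiv_extChartAt_self
  rwa [h1] at h

variable (𝕜 E) in
theorem hasDiffAt_extChartAt_one_symm :
    HasDiffAt 𝓘(𝕜, E) 𝓘(𝕜, E) (extChartAt 𝓘(𝕜, E) (1 : G)).symm
      (extChartAt 𝓘(𝕜, E) (1 : G) 1) (.id 𝕜 E) := by
  have : IsManifold 𝓘(𝕜, E) 1 G := .of_le (n := ∞) (by exact_mod_cast le_top)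
  have h : HasDiffAt 𝓘(𝕜, E) 𝓘(𝕜, E) (extChartAt 𝓘(𝕜, E) (1 : G)).symm
      (extChartAt 𝓘(𝕜, E) (1 : G) 1) _ :=
    ((contMDiffOn_extChartAt_symm (n := ∞) (1 : G)).contMDiffAt
      (extChartAt_target_mem_nhds (1 : G))).hasDiffAt
  have h1 : diffAt 𝓘(𝕜, E) 𝓘(𝕜, E) (extChartAt 𝓘(𝕜, E) (1 : G)).symm
      (extChartAt 𝓘(𝕜, E) (1 : G) 1) = .id 𝕜 E := by
    have := mfderivWithin_range_extChartAt_symm (I := 𝓘(𝕜, E)) (x := (1 : G))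
    rw [ModelWithCorners.range_eq_univ, mfderivWithin_univ] at this
    exact this
  rwa [h1] at h

/-- Conjugation is jointly smooth, and its partial differential along the constant section `1` is
smooth in tangent coordinates. Since the base point stays at `1`, the coordinate changes involved
are the identity. -/
theorem contMDiff_Ad : ContMDiff 𝓘(𝕜, E) 𝓘(𝕜, E →L[𝕜] E) ∞ (Ad 𝕜 E : G → E →L[𝕜] E) := by
  have : IsManifold 𝓘(𝕜, E) 1 G := .of_le (n := ∞) (by exact_mod_cast le_top)
  intro g₀
  have hf : ContMDiff (𝓘(𝕜, E).prod 𝓘(𝕜, E)) 𝓘(𝕜, E) ∞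
      (Function.uncurry fun g x : G => g * x * g⁻¹) :=
    (contMDiff_fst.mul contMDiff_snd).mul contMDiff_fst.inv
  have h := ContMDiffAt.mfderiv (n := ∞) (m := ∞) (x₀ := g₀) (fun g x : G => g * x * g⁻¹)
    (fun _ => (1 : G)) hf.contMDiffAt contMDiffAt_const (by simp)
  have he : (fun g : G => g * 1 * g⁻¹) = fun _ => 1 := by ext g; simp
  rw [he] at h
  refine h.congr_of_eventuallyEq (Eventually.of_forall fun g => ?_)
  have h2 : diffAt 𝓘(𝕜, E) 𝓘(𝕜, E) (extChartAt 𝓘(𝕜, E) (1 : G)) 1 = .id 𝕜 E :=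
    mfderiv_extChartAt_self
  have h3 := mfderivWithin_range_extChartAt_symm (I := 𝓘(𝕜, E)) (x := (1 : G))
  have h1 := inTangentCoordinates_eq_mfderiv_comp (I := 𝓘(𝕜, E)) (I' := 𝓘(𝕜, E))
    (f := fun _ : G => (1 : G)) (g := fun _ : G => (1 : G)) (x₀ := g₀) (x := g)
    (ϕ := fun x => (Ad 𝕜 E x :)) (mem_chart_source E (1 : G)) (mem_chart_source E (1 : G))
  refine Eq.trans ?_ h1.symm
  refine ContinuousLinearMap.ext fun v => ?_
  have h4 := DFunLike.congr_fun h3 v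
  have h5 := DFunLike.congr_fun h2 (Ad 𝕜 E g v)
  refine h5.symm.trans ?_
  exact congrArg (fun w : E => diffAt 𝓘(𝕜, E) 𝓘(𝕜, E) (extChartAt 𝓘(𝕜, E) (1 : G)) 1
    (Ad 𝕜 E g w)) h4.symm

variable (𝕜 E G) in
/-- The multiplication of `G` in the chart at `1`. -/
def chartMul (p : E × E) : E :=
  extChartAt 𝓘(𝕜, E) (1 : G)
    ((extChartAt 𝓘(𝕜, E) (1 : G)).symm p.1 * (extChartAt 𝓘(𝕜, E) (1 : G)).symm p.2)

theorem contDiffAt_chartMul :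
    ContDiffAt 𝕜 ∞ (chartMul 𝕜 E G)
      (extChartAt 𝓘(𝕜, E) (1 : G) 1, extChartAt 𝓘(𝕜, E) (1 : G) 1) := by
  have h : ContMDiffAt 𝓘(𝕜, E) 𝓘(𝕜, E) ∞ (extChartAt 𝓘(𝕜, E) (1 : G)).symm
      (extChartAt 𝓘(𝕜, E) (1 : G) 1) :=
    (contMDiffOn_extChartAt_symm (1 : G)).contMDiffAt (extChartAt_target_mem_nhds (1 : G))
  have h1 : ContMDiffAt 𝓘(𝕜, E × E) 𝓘(𝕜, E) ∞
      (fun p : E × E => (extChartAt 𝓘(𝕜, E) (1 : G)).symm p.1)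
      (extChartAt 𝓘(𝕜, E) (1 : G) 1, extChartAt 𝓘(𝕜, E) (1 : G) 1) :=
    ContMDiffAt.comp _ h contDiff_fst.contMDiff.contMDiffAt
  have h2 : ContMDiffAt 𝓘(𝕜, E × E) 𝓘(𝕜, E) ∞
      (fun p : E × E => (extChartAt 𝓘(𝕜, E) (1 : G)).symm p.2)
      (extChartAt 𝓘(𝕜, E) (1 : G) 1, extChartAt 𝓘(𝕜, E) (1 : G) 1) :=
    ContMDiffAt.comp _ h contDiff_snd.contMDiff.contMDiffAt
  refine (ContMDiffAt.comp _ (g := extChartAt 𝓘(𝕜, E) (1 : G)) ?_ (h1.mul h2)).contDiffAt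
  change ContMDiffAt 𝓘(𝕜, E) 𝓘(𝕜, E) ∞ (extChartAt 𝓘(𝕜, E) (1 : G))
    ((extChartAt 𝓘(𝕜, E) (1 : G)).symm (extChartAt 𝓘(𝕜, E) (1 : G) 1) *
      (extChartAt 𝓘(𝕜, E) (1 : G)).symm (extChartAt 𝓘(𝕜, E) (1 : G) 1))
  rw [extChartAt_to_inv, mul_one]
  exact contMDiffAt_extChartAt

/-- In the chart, left translation by `x` is `y ↦ m (x, y)`, so a left-invariant field is read there
as the partial derivative of `m` in its second argument at the unit. -/
theorem eventually_chartMul_left [CompleteSpace E] :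
    ∀ᶠ x in 𝓝 (extChartAt 𝓘(𝕜, E) (1 : G) 1), ∀ v : E,
      VectorField.mpullbackWithin 𝓘(𝕜, E) 𝓘(𝕜, E) (extChartAt 𝓘(𝕜, E) (1 : G)).symm
        (mulInvariantVectorField (I := 𝓘(𝕜, E)) (G := G) v) (range 𝓘(𝕜, E)) x
      = fderiv 𝕜 (chartMul 𝕜 E G) (x, extChartAt 𝓘(𝕜, E) (1 : G) 1) (0, v) := by
  have : IsManifold 𝓘(𝕜, E) 1 G := .of_le (n := ∞) (by exact_mod_cast le_top)
  set φ := extChartAt 𝓘(𝕜, E) (1 : G) with hφ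
  have e1 : ∀ᶠ x in 𝓝 (φ 1), ContDiffAt 𝕜 1 (chartMul 𝕜 E G) (x, φ 1) := by
    have h := ((contDiffAt_chartMul (𝕜 := 𝕜) (E := E) (G := G)).of_le
      (m := 1) (by exact_mod_cast le_top)).eventually (by simp)
    exact (Continuous.prodMk_left (φ 1)).continuousAt.eventually h
  filter_upwards [e1, extChartAt_target_mem_nhds (I := 𝓘(𝕜, E)) (1 : G)] with x h1 h2 v
  have hmx : chartMul 𝕜 E G (x, φ 1) = x := by
    simp only [chartMul]
    rw [extChartAt_to_inv, mul_one, φ.right_inv h2]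
  have hA : HasDiffAt 𝓘(𝕜, E) 𝓘(𝕜, E) φ.symm x _ :=
    ((contMDiffOn_extChartAt_symm (n := ∞) (1 : G)).contMDiffAt
      ((isOpen_extChartAt_target (I := 𝓘(𝕜, E)) (1 : G)).mem_nhds h2)).hasDiffAt
  have hm := (h1.differentiableAt (by simp)).hasFDerivAt.comp (φ 1)
    (hasFDerivAt_prodMk_right x (φ 1))
  have hL := hA.comp hm.hasDiffAt hmx
  have hR := (hasDiffAt_leftTrans (φ.symm x)).comp
    (hasDiffAt_extChartAt_one_symm 𝕜 E (G := G)) (extChartAt_to_inv _)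
  have hev : (fun y => φ.symm x * φ.symm y) =ᶠ[𝓝 (φ 1)]
      fun y => φ.symm (chartMul 𝕜 E G (x, y)) := by
    have hc : ContinuousAt (fun y => φ.symm x * φ.symm y) (φ 1) :=
      hR.mdifferentiableAt.continuousAt
    have hs : φ.source ∈ 𝓝 (φ.symm x * φ.symm (φ 1)) := by
      rw [extChartAt_to_inv, mul_one]
      exact (isOpen_extChartAt_source (I := 𝓘(𝕜, E)) (1 : G)).mem_nhds (φ.map_target h2)
    filter_upwards [hc.preimage_mem_nhds hs] with y hy
    exact (φ.left_inv hy).symm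
  have key := DFunLike.congr_fun (hR.unique (hL.congr hev)) v
  have hinv := isInvertible_mfderivWithin_extChartAt_symm (I := 𝓘(𝕜, E)) h2
  refine (ContinuousLinearMap.IsInvertible.inverse_apply_eq hinv).2 ?_
  rw [ModelWithCorners.range_eq_univ, mfderivWithin_univ]
  exact key

/-- This is `x y = (x y x⁻¹) x`, differentiated in `y` at the unit. -/
theorem eventually_chartMul_right :
    ∀ᶠ x in 𝓝 (extChartAt 𝓘(𝕜, E) (1 : G) 1), ∀ v : E,
      fderiv 𝕜 (chartMul 𝕜 E G) (x, extChartAt 𝓘(𝕜, E) (1 : G) 1) (0, v)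
      = fderiv 𝕜 (chartMul 𝕜 E G) (extChartAt 𝓘(𝕜, E) (1 : G) 1, x)
        (Ad 𝕜 E ((extChartAt 𝓘(𝕜, E) (1 : G)).symm x) v, 0) := by
  set φ := extChartAt 𝓘(𝕜, E) (1 : G) with hφ
  have h := ((contDiffAt_chartMul (𝕜 := 𝕜) (E := E) (G := G)).of_le
    (m := 1) (by exact_mod_cast le_top)).eventually (by simp)
  have e1 : ∀ᶠ x in 𝓝 (φ 1), ContDiffAt 𝕜 1 (chartMul 𝕜 E G) (x, φ 1) :=
    (Continuous.prodMk_left (φ 1)).continuousAt.eventually h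
  have e2 : ∀ᶠ x in 𝓝 (φ 1), ContDiffAt 𝕜 1 (chartMul 𝕜 E G) (φ 1, x) :=
    (Continuous.prodMk_right (φ 1)).continuousAt.eventually h
  filter_upwards [e1, e2] with x h1 h2 v
  set g := φ.symm x
  have hm := (h1.differentiableAt (by simp)).hasFDerivAt.comp (φ 1)
    (hasFDerivAt_prodMk_right x (φ 1))
  have hm' := (h2.differentiableAt (by simp)).hasFDerivAt
  have hc0 := (hasDiffAt_conj g).comp
    (hasDiffAt_extChartAt_one_symm 𝕜 E (G := G)) (extChartAt_to_inv _)
  have hc := (hasDiffAt_extChartAt_one 𝕜 E).comp hc0 (by rw [extChartAt_to_inv]; simp)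
  have hc' : φ (g * φ.symm (φ 1) * g⁻¹) = φ 1 := by rw [extChartAt_to_inv]; simp
  have hd := (hasFDerivAt_prodMk_left (𝕜 := 𝕜) (φ 1) x).hasDiffAt.comp hc hc'
  have hR := hm'.hasDiffAt.comp hd (by rw [hc'])
  have hev : (chartMul 𝕜 E G ∘ fun y => (x, y)) =ᶠ[𝓝 (φ 1)]
      fun y => chartMul 𝕜 E G (φ (g * φ.symm y * g⁻¹), x) := by
    have hs : φ.source ∈ 𝓝 (g * φ.symm (φ 1) * g⁻¹) := by
      rw [extChartAt_to_inv]
      rw [mul_one, mul_inv_cancel]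
      exact extChartAt_source_mem_nhds (I := 𝓘(𝕜, E)) (1 : G)
    filter_upwards [hc0.mdifferentiableAt.continuousAt.preimage_mem_nhds hs] with y hy
    simp only [chartMul, Function.comp]
    rw [φ.left_inv hy]
    simp [g, hφ]
  exact DFunLike.congr_fun (hm.hasDiffAt.unique (hR.congr hev)) v

/-- The differential of `Ad` at `1` is the bracket. -/
theorem lieBr_eq_diffAt_Ad [CompleteSpace E] (X Y : E) :
    lieBr 𝕜 G X Y = diffAt 𝓘(𝕜, E) 𝓘(𝕜, E →L[𝕜] E) (Ad 𝕜 E : G → E →L[𝕜] E) 1 X Y := by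
  set φ := extChartAt 𝓘(𝕜, E) (1 : G) with hφ
  set e := φ 1 with he
  set m := chartMul 𝕜 E G with hm
  have hmc : ContDiffAt 𝕜 ∞ m (e, e) := contDiffAt_chartMul
  have hm2 : HasFDerivAt (fderiv 𝕜 m) (fderiv 𝕜 (fderiv 𝕜 m) (e, e)) (e, e) :=
    (((contDiffAt_infty.1 hmc 2).fderiv_right (m := 1) (by norm_num)).differentiableAt
      (by simp)).hasFDerivAt
  have hsymm : IsSymmSndFDerivAt 𝕜 m (e, e) := (contDiffAt_infty.1 hmc 2).isSymmSndFDerivAt (by simp)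
  have hV : ∀ v : E, HasFDerivAt (fun x => fderiv 𝕜 m (x, e) (0, v))
      ((ContinuousLinearMap.apply 𝕜 E ((0 : E), v)).comp
        ((fderiv 𝕜 (fderiv 𝕜 m) (e, e)).comp (.inl 𝕜 E E))) e := fun v =>
    (ContinuousLinearMap.apply 𝕜 E ((0 : E), v)).hasFDerivAt.comp e
      (HasFDerivAt.comp (f := fun x => (x, e)) e hm2 (hasFDerivAt_prodMk_left e e))
  have hAd := ((contMDiff_Ad (𝕜 := 𝕜) (E := E) (G := G)).hasDiffAt 1).comp
    (hasDiffAt_extChartAt_one_symm 𝕜 E) (extChartAt_to_inv _)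
  have hAd' := hAd.hasFDerivAt
  have hR : HasFDerivAt (fun x => fderiv 𝕜 m (e, x) (Ad 𝕜 E (φ.symm x) Y, 0)) _ e :=
    (hm2.comp e (hasFDerivAt_prodMk_right e e)).clm_apply
      (((ContinuousLinearMap.apply 𝕜 E Y).hasFDerivAt.comp e hAd').prodMk
        (hasFDerivAt_const (0 : E) e))
  have ht : φ.target ∈ 𝓝 e := extChartAt_target_mem_nhds (I := 𝓘(𝕜, E)) (1 : G)
  have hφe : φ.symm e = 1 := extChartAt_to_inv _
  have hm1 := (hmc.differentiableAt (by simp)).hasFDerivAt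
  have hme : ∀ v, fderiv 𝕜 m (e, e) (v, 0) = v := by
    intro v
    have h1 : HasFDerivAt (fun x => m (x, e)) _ e :=
      HasFDerivAt.comp (f := fun x => (x, e)) e hm1 (hasFDerivAt_prodMk_left e e)
    have h2 : (fun x => m (x, e)) =ᶠ[𝓝 e] fun x => x := by
      filter_upwards [ht] with x hx
      change φ (φ.symm x * φ.symm e) = x
      rw [hφe, mul_one, φ.right_inv hx]
    exact DFunLike.congr_fun (h1.unique ((hasFDerivAt_id (𝕜 := 𝕜) e).congr_of_eventuallyEq h2)) v
  have hme' : ∀ v, fderiv 𝕜 m (e, e) (0, v) = v := by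
    intro v
    have h1 : HasFDerivAt (fun x => m (e, x)) _ e :=
      HasFDerivAt.comp (f := fun x => (e, x)) e hm1 (hasFDerivAt_prodMk_right e e)
    have h2 : (fun x => m (e, x)) =ᶠ[𝓝 e] fun x => x := by
      filter_upwards [ht] with x hx
      change φ (φ.symm e * φ.symm x) = x
      rw [hφe, one_mul, φ.right_inv hx]
    exact DFunLike.congr_fun (h1.unique ((hasFDerivAt_id (𝕜 := 𝕜) e).congr_of_eventuallyEq h2)) v
  have hev : (fun x => fderiv 𝕜 m (x, e) (0, Y)) =ᶠ[𝓝 e]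
      fun x => fderiv 𝕜 m (e, x) (Ad 𝕜 E (φ.symm x) Y, 0) := by
    filter_upwards [eventually_chartMul_right (𝕜 := 𝕜) (E := E) (G := G)] with x hx
    exact hx Y
  -- The identity derived from `x y = (x y x⁻¹) x` is differentiated once more, now in `x`. This
  -- brings in the differential of `Ad`.
  have key := DFunLike.congr_fun ((hV Y).unique (hR.congr_of_eventuallyEq hev)) X
  have hpull : ∀ v : E, VectorField.mpullbackWithin 𝓘(𝕜, E) 𝓘(𝕜, E) φ.symm
      (mulInvariantVectorField (I := 𝓘(𝕜, E)) (G := G) v) (range 𝓘(𝕜, E))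
      =ᶠ[𝓝 e] fun x => fderiv 𝕜 m (x, e) (0, v) := fun v => by
    filter_upwards [eventually_chartMul_left (𝕜 := 𝕜) (E := E) (G := G)] with x hx
    exact hx v
  -- The bracket is the antisymmetrised mixed second derivative of the multiplication.
  have hbr : lieBr 𝕜 G X Y = fderiv 𝕜 (fderiv 𝕜 m) (e, e) (X, 0) (0, Y)
      - fderiv 𝕜 (fderiv 𝕜 m) (e, e) (Y, 0) (0, X) := by
    let W : E → E → E := fun v => VectorField.mpullbackWithin 𝓘(𝕜, E) 𝓘(𝕜, E) φ.symm
      (mulInvariantVectorField (I := 𝓘(𝕜, E)) (G := G) v) (range 𝓘(𝕜, E))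
    have h1 : lieBr 𝕜 G X Y = VectorField.lieBracket 𝕜 (W X) (W Y) e := by
      have hone : (mfderiv 𝓘(𝕜, E) 𝓘(𝕜, E) φ (1 : G) : E →L[𝕜] E) = .id 𝕜 E :=
        (hasDiffAt_extChartAt_one 𝕜 E (G := G)).diffAt_eq
      have h2 : ∀ v : E, (mfderiv 𝓘(𝕜, E) 𝓘(𝕜, E) φ (1 : G) : E →L[𝕜] E).inverse v = v := by
        intro v
        have : IsManifold 𝓘(𝕜, E) 1 G := .of_le (n := ∞) (by exact_mod_cast le_top)
        exact (ContinuousLinearMap.IsInvertible.inverse_apply_eq (isInvertible_mfderiv_extChartAt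
          (mem_extChartAt_source (I := 𝓘(𝕜, E)) (1 : G)))).2 (DFunLike.congr_fun hone v).symm
      have h3 : VectorField.lieBracketWithin 𝕜 (W X) (W Y)
          (φ.symm ⁻¹' univ ∩ range 𝓘(𝕜, E)) e = VectorField.lieBracket 𝕜 (W X) (W Y) e := by
        rw [ModelWithCorners.range_eq_univ, preimage_univ, inter_univ,
          VectorField.lieBracketWithin_univ]
      exact (h2 _).trans h3
    have hX : W X =ᶠ[𝓝 e] fun x => fderiv 𝕜 m (x, e) (0, X) := hpull X
    have hY : W Y =ᶠ[𝓝 e] fun x => fderiv 𝕜 m (x, e) (0, Y) := hpull Y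
    rw [h1, hX.lieBracket_vectorField_eq hY, VectorField.lieBracket_eq]
    simp only [(hV X).fderiv, (hV Y).fderiv, hme']
    rfl
  rw [hbr]
  have key2 : fderiv 𝕜 (fderiv 𝕜 m) (e, e) (X, 0) (0, Y) =
      fderiv 𝕜 m (e, e) (diffAt 𝓘(𝕜, E) 𝓘(𝕜, E →L[𝕜] E) (Ad 𝕜 E : G → E →L[𝕜] E) 1 X Y, 0)
      + fderiv 𝕜 (fderiv 𝕜 m) (e, e) (0, X) (Ad 𝕜 E (φ.symm e) Y, 0) := key
  -- By symmetry of second derivatives the remaining mixed term cancels the subtracted one, leaving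
  -- the differential of `Ad`.
  rw [key2, hme, hφe, Ad_one, hsymm (0, X)]
  simp

end

end LieGroupCalculus

/-! ### Bilinearity and naturality of the bracket. -/

section LieBracket

variable {𝕜 : Type*} [RCLike 𝕜] {E : Type*} [NormedAddCommGroup E] [NormedSpace 𝕜 E]
  {G : Type*} [TopologicalSpace G] [ChartedSpace E G] [Group G]

variable (𝕜 G) in
/-- The bracket of the Lie algebra of a Lie group, as a bilinear map. -/
def lieBrL : E →L[𝕜] E →L[𝕜] E :=
  diffAt 𝓘(𝕜, E) 𝓘(𝕜, E →L[𝕜] E) (Ad 𝕜 E : G → E →L[𝕜] E) 1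

theorem lieBr_skew (X Y : E) : lieBr 𝕜 G X Y = -lieBr 𝕜 G Y X :=
  VectorField.mlieBracket_swap_apply

/-- The map `ξ ↦ coAd g ξ` is linear. -/
def coAdL (g : G) : (E →L[𝕜] 𝕜) →L[𝕜] (E →L[𝕜] 𝕜) :=
  (ContinuousLinearMap.compL 𝕜 E E 𝕜).flip (Ad 𝕜 E g⁻¹)

theorem coAdL_apply (g : G) (ξ : E →L[𝕜] 𝕜) : coAdL g ξ = coAd g ξ := rfl

variable [LieGroup 𝓘(𝕜, E) ∞ G]

theorem lieBrL_apply [CompleteSpace E] (X Y : E) : lieBrL 𝕜 G X Y = lieBr 𝕜 G X Y :=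
  (lieBr_eq_diffAt_Ad X Y).symm

theorem hasDiffAt_Ad :
    HasDiffAt 𝓘(𝕜, E) 𝓘(𝕜, E →L[𝕜] E) (Ad 𝕜 E : G → E →L[𝕜] E) 1 (lieBrL 𝕜 G) :=
  contMDiff_Ad.hasDiffAt 1

theorem hasDiffAt_Ad_inv :
    HasDiffAt 𝓘(𝕜, E) 𝓘(𝕜, E →L[𝕜] E) (fun g : G => Ad 𝕜 E g⁻¹) 1 (-lieBrL 𝕜 G) := by
  have h := hasDiffAt_Ad.comp (hasDiffAt_inv_one (𝕜 := 𝕜) (E := E) (G := G)) inv_one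
  convert h using 1
  ext X; simp

theorem lieBr_add_left [CompleteSpace E] (X Y Z : E) :
    lieBr 𝕜 G (X + Y) Z = lieBr 𝕜 G X Z + lieBr 𝕜 G Y Z := by
  simp [← lieBrL_apply]

theorem lieBr_sub_left [CompleteSpace E] (X Y Z : E) :
    lieBr 𝕜 G (X - Y) Z = lieBr 𝕜 G X Z - lieBr 𝕜 G Y Z := by
  simp [← lieBrL_apply]

theorem lieBr_smul_left [CompleteSpace E] (c : 𝕜) (X Y : E) :
    lieBr 𝕜 G (c • X) Y = c • lieBr 𝕜 G X Y := by
  simp [← lieBrL_apply]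

theorem lieBr_add_right [CompleteSpace E] (X Y Z : E) :
    lieBr 𝕜 G X (Y + Z) = lieBr 𝕜 G X Y + lieBr 𝕜 G X Z := by
  simp [← lieBrL_apply]

theorem lieBr_sub_right [CompleteSpace E] (X Y Z : E) :
    lieBr 𝕜 G X (Y - Z) = lieBr 𝕜 G X Y - lieBr 𝕜 G X Z := by
  simp [← lieBrL_apply]

theorem lieBr_smul_right [CompleteSpace E] (c : 𝕜) (X Y : E) :
    lieBr 𝕜 G X (c • Y) = c • lieBr 𝕜 G X Y := by
  simp [← lieBrL_apply]

variable {E₁ : Type*} [NormedAddCommGroup E₁] [NormedSpace 𝕜 E₁]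
  {K : Type*} [TopologicalSpace K] [ChartedSpace E₁ K] [Group K] [LieGroup 𝓘(𝕜, E₁) ∞ K]

/-- The differential of a homomorphism of Lie groups intertwines the adjoint actions. -/
theorem HasDiffAt.map_Ad {f : G →* K} {A : E →L[𝕜] E₁}
    (hA : HasDiffAt 𝓘(𝕜, E) 𝓘(𝕜, E₁) f 1 A) (g : G) (Y : E) :
    A (Ad 𝕜 E g Y) = Ad 𝕜 E₁ (f g) (A Y) := by
  have h1 := hA.comp (hasDiffAt_conj (𝕜 := 𝕜) (E := E) g) (by simp)
  have h2 := (hasDiffAt_conj (f g)).comp hA (map_one f)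
  simp only [map_mul, map_inv] at h1
  exact DFunLike.congr_fun (h1.unique h2) Y

/-- The differential of a homomorphism of Lie groups is a homomorphism of Lie algebras. -/
theorem HasDiffAt.map_lieBr [CompleteSpace E] [CompleteSpace E₁] {f : G →* K} {A : E →L[𝕜] E₁}
    (hA : HasDiffAt 𝓘(𝕜, E) 𝓘(𝕜, E₁) f 1 A) (X Y : E) :
    A (lieBr 𝕜 G X Y) = lieBr 𝕜 K (A X) (A Y) := by
  have h1 := A.hasDiffAt _ |>.comp
    (((ContinuousLinearMap.apply 𝕜 E Y).hasDiffAt _).comp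
      (hasDiffAt_Ad (𝕜 := 𝕜) (E := E) (G := G)) rfl) rfl
  have h2 := ((ContinuousLinearMap.apply 𝕜 E₁ (A Y)).hasDiffAt _).comp
      ((hasDiffAt_Ad (𝕜 := 𝕜) (E := E₁) (G := K)).comp hA (map_one f)) rfl
  have h3 : (fun g : G => A (ContinuousLinearMap.apply 𝕜 E Y (Ad 𝕜 E g)))
      = fun g => ContinuousLinearMap.apply 𝕜 E₁ (A Y) (Ad 𝕜 E₁ (f g)) := by
    ext g; exact hA.map_Ad g Y
  rw [h3] at h1
  rw [← lieBrL_apply, ← lieBrL_apply]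
  exact DFunLike.congr_fun (h1.unique h2) X

/-- Conjugation by `g` is a homomorphism of Lie groups with differential `Ad g`. -/
theorem Ad_lieBr [CompleteSpace E] (g : G) (X Y : E) :
    Ad 𝕜 E g (lieBr 𝕜 G X Y) = lieBr 𝕜 G (Ad 𝕜 E g X) (Ad 𝕜 E g Y) :=
  HasDiffAt.map_lieBr (f := (MulAut.conj g).toMonoidHom) (hasDiffAt_conj g) X Y

theorem contMDiff_coAd :
    ContMDiff (𝓘(𝕜, E).prod 𝓘(𝕜, E →L[𝕜] 𝕜)) 𝓘(𝕜, E →L[𝕜] 𝕜) ∞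
      (fun p : G × (E →L[𝕜] 𝕜) => coAd p.1 p.2) :=
  ContMDiff.clm_comp contMDiff_snd (contMDiff_Ad.comp contMDiff_fst.inv)

end LieBracket

/-! ### The Lie algebra of `G_r` and its infinitesimal coadjoint action. -/

namespace RSubgroup

variable {𝕜 : Type*} [RCLike 𝕜] {E : Type*} [NormedAddCommGroup E] [NormedSpace 𝕜 E]
  {G : Type*} [TopologicalSpace G] [ChartedSpace E G] [Group G] {r : E →L[𝕜] E}
  {E' : Type*} [NormedAddCommGroup E'] [NormedSpace 𝕜 E']
  {Gr : Type*} [TopologicalSpace Gr] [ChartedSpace E' Gr] [Group Gr]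
  (S : RSubgroup G r E' Gr)

/-- The adjoint action of `G_r` on `𝔤_r`. -/
def Adr (h : Gr) : E →L[𝕜] E :=
  (S.lie.symm : E' →L[𝕜] E).comp ((Ad 𝕜 E' h).comp (S.lie : E →L[𝕜] E'))

theorem coAdr_eq (h : Gr) (f : E →L[𝕜] 𝕜) : S.coAdr h f = f.comp (S.Adr h⁻¹) := rfl

variable (G r) in
/-- The bracket of `𝔤_r` as a bilinear map. -/
def _root_.rBrL : E →L[𝕜] E →L[𝕜] E :=
  (1 / 2 : 𝕜) • ((lieBrL 𝕜 G).comp r + ((ContinuousLinearMap.compL 𝕜 E E E).flip r).comp (lieBrL 𝕜 G))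

theorem _root_.rBrL_apply [CompleteSpace E] [LieGroup 𝓘(𝕜, E) ∞ G] (X Y : E) :
    rBrL G r X Y = rBr 𝕜 G r X Y := by
  simp [rBrL, rBr, lieBrL_apply]

theorem _root_.rBr_skew [CompleteSpace E] [LieGroup 𝓘(𝕜, E) ∞ G] (X Y : E) :
    rBr 𝕜 G r X Y = -rBr 𝕜 G r Y X := by
  rw [rBr, rBr, lieBr_skew (r X), lieBr_skew X, ← neg_add, smul_neg, add_comm]

/-- The infinitesimal coadjoint action of `𝔤_r` at `f`. -/
def _root_.coadr (G : Type*) [TopologicalSpace G] [ChartedSpace E G] [Group G]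
    (r : E →L[𝕜] E) (f : E →L[𝕜] 𝕜) : E →L[𝕜] (E →L[𝕜] 𝕜) :=
  -(ContinuousLinearMap.compL 𝕜 E E 𝕜 f).comp (rBrL G r)

theorem _root_.coadr_apply [CompleteSpace E] [LieGroup 𝓘(𝕜, E) ∞ G] (f : E →L[𝕜] 𝕜) (X Y : E) : coadr G r f X Y = -f (rBr 𝕜 G r X Y) := by
  simp [coadr, rBrL_apply]

theorem hasDiffAt_plus [LieGroup 𝓘(𝕜, E') ∞ Gr] :
    HasDiffAt 𝓘(𝕜, E') 𝓘(𝕜, E) S.plus 1 ((rPlus r).comp (S.lie.symm : E' →L[𝕜] E)) := by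
  have h := S.contMDiff_plus.hasDiffAt 1
  convert h using 1
  ext v
  have := S.mfderiv_plus (S.lie.symm v)
  rw [S.lie.apply_symm_apply] at this
  exact this.symm

theorem hasDiffAt_minus [LieGroup 𝓘(𝕜, E') ∞ Gr] :
    HasDiffAt 𝓘(𝕜, E') 𝓘(𝕜, E) S.minus 1 ((rMinus r).comp (S.lie.symm : E' →L[𝕜] E)) := by
  have h := S.contMDiff_minus.hasDiffAt 1
  convert h using 1
  ext v
  have := S.mfderiv_minus (S.lie.symm v)
  rw [S.lie.apply_symm_apply] at this
  exact this.symm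

theorem Adr_one : S.Adr 1 = .id 𝕜 E := by ext X; simp [Adr, Ad_one]

theorem lie_Adr (h : Gr) (X : E) : S.lie (S.Adr h X) = Ad 𝕜 E' h (S.lie X) := by
  simp [Adr]

variable [LieGroup 𝓘(𝕜, E') ∞ Gr]

theorem Adr_mul (h k : Gr) (X : E) : S.Adr (h * k) X = S.Adr h (S.Adr k X) := by
  simp [Adr, Ad_mul]

theorem Adr_inv_Adr (h : Gr) (X : E) : S.Adr h⁻¹ (S.Adr h X) = X := by
  rw [← Adr_mul, inv_mul_cancel, Adr_one]; rfl

theorem Adr_Adr_inv (h : Gr) (X : E) : S.Adr h (S.Adr h⁻¹ X) = X := by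
  rw [← Adr_mul, mul_inv_cancel, Adr_one]; rfl

theorem contMDiff_Adr : ContMDiff 𝓘(𝕜, E') 𝓘(𝕜, E →L[𝕜] E) ∞ S.Adr :=
  contMDiff_const.clm_comp (contMDiff_Ad.clm_comp contMDiff_const)

theorem contMDiff_coAdr : ContMDiff (𝓘(𝕜, E').prod 𝓘(𝕜, E →L[𝕜] 𝕜)) 𝓘(𝕜, E →L[𝕜] 𝕜) ∞
    (fun p : Gr × (E →L[𝕜] 𝕜) => S.coAdr p.1 p.2) :=
  ContMDiff.clm_comp contMDiff_snd (S.contMDiff_Adr.comp contMDiff_fst.inv)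

variable [LieGroup 𝓘(𝕜, E) ∞ G]

/-- Naturality of `Ad` for the homomorphism `h ↦ h₊`, whose differential is `r₊` after the
identification `lie`. The next lemma is the same for `h ↦ h₋`. -/
theorem rPlus_Adr (h : Gr) (X : E) : rPlus r (S.Adr h X) = Ad 𝕜 E (S.plus h) (rPlus r X) := by
  have := S.hasDiffAt_plus.map_Ad h (S.lie X)
  simpa [Adr] using this

theorem rMinus_Adr (h : Gr) (X : E) : rMinus r (S.Adr h X) = Ad 𝕜 E (S.minus h) (rMinus r X) := by
  have := S.hasDiffAt_minus.map_Ad h (S.lie X)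
  simpa [Adr] using this

variable [CompleteSpace E] [CompleteSpace E']

/-- The isomorphism `lie` of `𝔤_r` with the Lie algebra of `G_r` preserves the brackets. -/
theorem lieBr_lie (X Y : E) : lieBr 𝕜 Gr (S.lie X) (S.lie Y) = S.lie (rBr 𝕜 G r X Y) := by
  have hp := S.hasDiffAt_plus.map_lieBr (S.lie X) (S.lie Y)
  have hm := S.hasDiffAt_minus.map_lieBr (S.lie X) (S.lie Y)
  simp only [ContinuousLinearMap.comp_apply, ContinuousLinearEquiv.coe_coe,
    S.lie.symm_apply_apply] at hp hm
  -- A vector is the difference of its images under `r₊` and `r₋`. Both differentials respect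
  -- brackets, so the bracket of `G_r` can be computed in `𝔤`.
  rw [← S.lie.symm_apply_eq, ← rPlus_sub_rMinus r (S.lie.symm _), hp, hm]
  simp only [rPlus, rMinus, rBr, smul_apply, add_apply, sub_apply, ContinuousLinearMap.id_apply,
    lieBr_add_left, lieBr_sub_left, lieBr_smul_left, lieBr_add_right, lieBr_sub_right,
    lieBr_smul_right]
  module

theorem hasDiffAt_Adr_apply (X Y : E) :
    diffAt 𝓘(𝕜, E') 𝓘(𝕜, E →L[𝕜] E) S.Adr 1 (S.lie X) Y = rBr 𝕜 G r X Y := by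
  have h1 := ((ContinuousLinearMap.apply 𝕜 E Y).hasDiffAt _).comp (S.contMDiff_Adr.hasDiffAt 1) rfl
  have h2 := (S.lie.symm : E' →L[𝕜] E).hasDiffAt _ |>.comp
    (((ContinuousLinearMap.apply 𝕜 E' (S.lie Y)).hasDiffAt _).comp
      (hasDiffAt_Ad (𝕜 := 𝕜) (E := E') (G := Gr)) rfl) rfl
  have h3 := DFunLike.congr_fun (h1.unique h2) (S.lie X)
  refine h3.trans ?_
  simp [lieBrL_apply, lieBr_lie]

/-- The coadjoint action composes `f` with `Adr k⁻¹`; the inversion is the source of the sign in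
`coadr`. -/
theorem hasDiffAt_coAdr (f : E →L[𝕜] 𝕜) :
    HasDiffAt 𝓘(𝕜, E') 𝓘(𝕜, E →L[𝕜] 𝕜) (fun k => S.coAdr k f) 1
      ((coadr G r f).comp (S.lie.symm : E' →L[𝕜] E)) := by
  have h1 := ((ContinuousLinearMap.compL 𝕜 E E 𝕜 f).hasDiffAt _).comp
    ((S.contMDiff_Adr.hasDiffAt 1).comp hasDiffAt_inv_one inv_one) rfl
  refine HasDiffAt.congr_deriv h1 fun v => ?_
  ext Y
  have := S.hasDiffAt_Adr_apply (S.lie.symm v) Y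
  rw [S.lie.apply_symm_apply] at this
  simp [coadr_apply, this]

end RSubgroup

/-! ### Linear coordinates on a coadjoint orbit near a point. -/

/-- A linear map of finite rank `d` has, on its range, coordinates with values in `𝕜^d`, which
extend to the whole space. -/
theorem exists_range_coordinates {𝕜 : Type*} [RCLike 𝕜] {X Y : Type*} [NormedAddCommGroup X]
    [NormedSpace 𝕜 X] [NormedAddCommGroup Y] [NormedSpace 𝕜 Y] [FiniteDimensional 𝕜 Y]
    (D : X →L[𝕜] Y) :
    ∃ (d : ℕ) (i : EuclideanSpace 𝕜 (Fin d) →L[𝕜] Y) (P : Y →L[𝕜] EuclideanSpace 𝕜 (Fin d)),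
      (∀ v, P (i v) = v) ∧ ∀ y, (∃ v, i v = y) ↔ ∃ x, D x = y := by
  let V := (D : X →ₗ[𝕜] Y).range
  obtain ⟨C, hC⟩ := LinearMap.exists_leftInverse_of_injective V.subtype (by simp)
  have hC' : ∀ k : V, C k = k := fun k => LinearMap.congr_fun hC k
  let L : V ≃ₗ[𝕜] EuclideanSpace 𝕜 (Fin (Module.finrank 𝕜 V)) :=
    LinearEquiv.ofFinrankEq _ _ (by simp)
  refine ⟨Module.finrank 𝕜 V, LinearMap.toContinuousLinearMap (V.subtype ∘ₗ L.symm.toLinearMap),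
    LinearMap.toContinuousLinearMap (L.toLinearMap ∘ₗ C), fun v => ?_, fun y => ?_⟩
  · change L (C (L.symm v : V)) = v
    rw [hC', L.apply_symm_apply]
  · constructor
    · rintro ⟨v, rfl⟩
      exact (L.symm v).2
    · rintro ⟨x, rfl⟩
      refine ⟨L ⟨D x, x, rfl⟩, ?_⟩
      change ((L.symm (L ⟨D x, x, rfl⟩) : V) : Y) = D x
      rw [L.symm_apply_apply]

namespace RSubgroup

variable {𝕜 : Type*} [RCLike 𝕜] {E : Type*} [NormedAddCommGroup E] [NormedSpace 𝕜 E]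
  {G : Type*} [TopologicalSpace G] [ChartedSpace E G] [Group G] {r : E →L[𝕜] E}
  {E' : Type*} [NormedAddCommGroup E'] [NormedSpace 𝕜 E']
  {Gr : Type*} [TopologicalSpace Gr] [ChartedSpace E' Gr] [Group Gr]
  (S : RSubgroup G r E' Gr)

/-- The map `f ↦ coAdr h f` is linear. -/
def coAdrL (h : Gr) : (E →L[𝕜] 𝕜) →L[𝕜] (E →L[𝕜] 𝕜) :=
  (ContinuousLinearMap.compL 𝕜 E E 𝕜).flip (S.Adr h⁻¹)

theorem coAdrL_apply (h : Gr) (f : E →L[𝕜] 𝕜) : S.coAdrL h f = S.coAdr h f := rfl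

variable [LieGroup 𝓘(𝕜, E') ∞ Gr]

theorem contMDiff_coAdrL :
    ContMDiff 𝓘(𝕜, E') 𝓘(𝕜, (E →L[𝕜] 𝕜) →L[𝕜] (E →L[𝕜] 𝕜)) ∞ S.coAdrL :=
  (ContDiff.contMDiff (f := (ContinuousLinearMap.compL 𝕜 E E 𝕜).flip)
    (ContinuousLinearMap.contDiff _)).comp (S.contMDiff_Adr.comp (contMDiff_inv 𝓘(𝕜, E') ∞))

theorem contMDiff_coAdr_left (f : E →L[𝕜] 𝕜) :
    ContMDiff 𝓘(𝕜, E') 𝓘(𝕜, E →L[𝕜] 𝕜) ∞ (fun k => S.coAdr k f) :=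
  S.contMDiff_coAdr.comp (contMDiff_id.prodMk contMDiff_const)

variable [LieGroup 𝓘(𝕜, E) ∞ G] [CompleteSpace E] [CompleteSpace E']

/-- Writing `k = h (h⁻¹ k)` reduces the differential at `h` to that at `1`. -/
theorem hasDiffAt_coAdr_left (f : E →L[𝕜] 𝕜) (h : Gr) :
    HasDiffAt 𝓘(𝕜, E') 𝓘(𝕜, E →L[𝕜] 𝕜) (fun k => S.coAdr k f) h
      ((S.coAdrL h).comp ((coadr G r f).comp
        ((S.lie.symm : E' →L[𝕜] E).comp (leftTriv 𝕜 E' h)))) := by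
  have h1 := ((S.coAdrL h).hasDiffAt _).comp
    ((S.hasDiffAt_coAdr f).comp (hasDiffAt_leftTriv h) (inv_mul_cancel h)) rfl
  refine (h1.congr (Eventually.of_forall fun k => ?_)).congr_deriv fun v => rfl
  simp only [coAdrL_apply]
  rw [← coAdr_mul, mul_inv_cancel_left]

/-- Near `1`, the point `coAdr k f` of the orbit is determined by its projection to the tangent
space of the orbit at `f`. -/
theorem exists_slice_nhd [FiniteDimensional 𝕜 E] [FiniteDimensional 𝕜 E'] (f : E →L[𝕜] 𝕜) {d : ℕ}
    {i : EuclideanSpace 𝕜 (Fin d) →L[𝕜] (E →L[𝕜] 𝕜)}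
    {P : (E →L[𝕜] 𝕜) →L[𝕜] EuclideanSpace 𝕜 (Fin d)} (hP : ∀ v, P (i v) = v)
    (hi : ∀ y, (∃ v, i v = y) ↔ ∃ X, coadr G r f X = y) :
    ∃ U : Set Gr, IsOpen U ∧ 1 ∈ U ∧
      (∀ k ∈ U, Function.Surjective
        (diffAt 𝓘(𝕜, E') 𝓘(𝕜, EuclideanSpace 𝕜 (Fin d)) (fun k => P (S.coAdr k f)) k)) ∧
      ∀ k ∈ U, ∀ k' ∈ U, P (S.coAdr k f) = P (S.coAdr k' f) → S.coAdr k f = S.coAdr k' f := by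
  -- `T k` tests whether `P` is still an isomorphism on the `k`-translate of the tangent space at
  -- `f`. It is the identity at `k = 1`, and invertibility is an open condition.
  let T : Gr → EuclideanSpace 𝕜 (Fin d) →L[𝕜] EuclideanSpace 𝕜 (Fin d) :=
    fun k => P.comp ((S.coAdrL k).comp i)
  have hT : Continuous T :=
    (continuous_const.clm_comp (S.contMDiff_coAdrL.continuous.clm_comp continuous_const))
  let U₀ : Set Gr := T ⁻¹' {A | IsUnit A}
  have hU₀ : IsOpen U₀ := Units.isOpen.preimage hT
  have hU₀1 : 1 ∈ U₀ := by
    have : T 1 = 1 := by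
      ext v : 1
      change P (S.coAdr 1 (i v)) = v
      rw [coAdr_one, hP]
    simp [U₀, this]
  have hbij : ∀ k ∈ U₀, Function.Bijective (T k) := by
    intro k hk
    obtain ⟨u, hu⟩ := hk
    refine ⟨Function.LeftInverse.injective (g := (↑u⁻¹ : _ →L[𝕜] _)) fun v => ?_,
      Function.RightInverse.surjective (g := (↑u⁻¹ : _ →L[𝕜] _)) fun v => ?_⟩
    · rw [← hu]; exact DFunLike.congr_fun u.inv_mul v
    · rw [← hu]; exact DFunLike.congr_fun u.mul_inv v
  set ρ : Gr → (E →L[𝕜] 𝕜) := fun k => S.coAdr k f with hρ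
  let A : Gr → E' →L[𝕜] (E →L[𝕜] 𝕜) := fun h => (S.coAdrL h).comp ((coadr G r f).comp
        ((S.lie.symm : E' →L[𝕜] E).comp (leftTriv 𝕜 E' h)))
  have hA : ∀ h, HasDiffAt 𝓘(𝕜, E') 𝓘(𝕜, E →L[𝕜] 𝕜) ρ h (A h) := S.hasDiffAt_coAdr_left f
  have hsurj : ∀ k ∈ U₀, Function.Surjective fun w => P (A k w) := by
    intro k hk y
    obtain ⟨v, hv⟩ := (hbij k hk).2 y
    obtain ⟨X, hX⟩ := (hi (i v)).1 ⟨v, rfl⟩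
    obtain ⟨w, hw⟩ := leftTriv_surjective (𝕜 := 𝕜) k (S.lie X)
    refine ⟨w, ?_⟩
    simp only [A, ContinuousLinearMap.comp_apply, hw, ContinuousLinearEquiv.coe_coe,
      S.lie.symm_apply_apply, hX]
    exact hv
  -- The image of `A k` is the translated tangent space, where `P` is injective because `T k` is.
  -- This is the hypothesis of the constant rank lemma.
  have hker : ∀ k ∈ U₀, ∀ w, P (A k w) = 0 → A k w = 0 := by
    intro k hk w hw
    obtain ⟨v, hv⟩ := (hi _).2 ⟨S.lie.symm (leftTriv 𝕜 E' k w), rfl⟩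
    have h1 : A k w = S.coAdrL k (i v) := by rw [hv]; rfl
    have h2 : T k v = T k 0 := by rw [map_zero, ← hw, h1]; rfl
    rw [h1, (hbij k hk).1 h2, map_zero, map_zero]
  set φ := extChartAt 𝓘(𝕜, E') (1 : Gr) with hφ
  have hφs : ∀ x ∈ φ.target, ContMDiffAt 𝓘(𝕜, E') 𝓘(𝕜, E') ∞ φ.symm x := fun x hx =>
    (contMDiffOn_extChartAt_symm (1 : Gr)).contMDiffAt
      ((isOpen_extChartAt_target (I := 𝓘(𝕜, E')) (1 : Gr)).mem_nhds hx)
  have hd : ∀ x ∈ φ.target, HasFDerivAt (fun x => ρ (φ.symm x))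
      ((A (φ.symm x)).comp (diffAt 𝓘(𝕜, E') 𝓘(𝕜, E') φ.symm x)) x := fun x hx =>
    ((hA _).comp (hφs x hx).hasDiffAt rfl).hasFDerivAt
  have ht : φ.target ∈ 𝓝 (φ 1) := extChartAt_target_mem_nhds (1 : Gr)
  have hR : ContDiffAt 𝕜 ∞ (fun x => ρ (φ.symm x)) (φ 1) :=
    (((S.contMDiff_coAdr_left f).contMDiffAt).comp (φ 1) (hφs _ (mem_of_mem_nhds ht))).contDiffAt
  have hφ1 : φ.symm (φ 1) = 1 := extChartAt_to_inv _
  have hsymm : ∀ᶠ x in 𝓝 (φ 1), φ.symm x ∈ U₀ := by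
    refine (hφs _ (mem_of_mem_nhds ht)).continuousAt.preimage_mem_nhds ?_
    rw [hφ1]
    exact hU₀.mem_nhds hU₀1
  obtain ⟨U', hU', hinj⟩ := hR.eventually_eq_of_proj_eq P
    (by
      rw [(hd _ (mem_of_mem_nhds ht)).fderiv, hφ1,
        (hasDiffAt_extChartAt_one_symm 𝕜 E' (G := Gr)).diffAt_eq]
      exact hsurj 1 hU₀1)
    (by
      filter_upwards [ht, hsymm] with x hx hx' w hw
      rw [(hd x hx).fderiv] at hw ⊢
      exact hker _ hx' _ hw)
  have hUn : U₀ ∩ (φ.source ∩ φ ⁻¹' U') ∈ 𝓝 (1 : Gr) :=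
    inter_mem (hU₀.mem_nhds hU₀1) (inter_mem (extChartAt_source_mem_nhds (1 : Gr))
      ((continuousAt_extChartAt (1 : Gr)).preimage_mem_nhds hU'))
  obtain ⟨U, hU, hUo, h1⟩ := mem_nhds_iff.1 hUn
  refine ⟨U, hUo, h1, fun k hk => ?_, fun k hk k' hk' h => ?_⟩
  · have := (P.hasDiffAt _).comp (hA k) rfl
    rw [this.diffAt_eq]
    exact hsurj k (hU hk).1
  · have := hinj (φ k) (hU hk).2.2 (φ k') (hU hk').2.2
    simp only [φ.left_inv (hU hk).2.1, φ.left_inv (hU hk').2.1] at this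
    exact this h

end RSubgroup

/-! ### The topology of the homogeneous space. -/

namespace RSubgroup

section Topological

variable {𝕜 : Type*} [RCLike 𝕜] {E : Type*} [NormedAddCommGroup E] [NormedSpace 𝕜 E]
  {G : Type*} [TopologicalSpace G] [ChartedSpace E G] [Group G] {r : E →L[𝕜] E}
  {E' : Type*} [NormedAddCommGroup E'] [NormedSpace 𝕜 E']
  {Gr : Type*} [TopologicalSpace Gr] [ChartedSpace E' Gr] [Group Gr]
  (S : RSubgroup G r E' Gr) (F : E →L[𝕜] 𝕜)

theorem orbitMap_surjective : Function.Surjective (S.orbitMap F) := by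
  rintro ⟨_, h, rfl⟩
  exact ⟨h, rfl⟩

theorem continuous_orbitMap : Continuous (S.orbitMap F) := continuous_coinduced_rng

theorem isQuotientMap_orbitMap : IsQuotientMap (S.orbitMap F) :=
  ⟨⟨rfl⟩, S.orbitMap_surjective F⟩

instance : Nonempty (S.Orbit F) := ⟨S.orbitMap F 1⟩

variable [LieGroup 𝓘(𝕜, E') ∞ Gr]

theorem smul_orbitMap (h k : Gr) : h • S.orbitMap F k = S.orbitMap F (h * k) :=
  Subtype.ext (S.coAdr_mul h k F).symm

theorem continuous_smul_orbit (h : Gr) : Continuous fun f : S.Orbit F => h • f := by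
  rw [(S.isQuotientMap_orbitMap F).continuous_iff]
  have : (fun f : S.Orbit F => h • f) ∘ S.orbitMap F = S.orbitMap F ∘ fun k => h * k := by
    ext1 k; exact S.smul_orbitMap F h k
  rw [this]
  exact (S.continuous_orbitMap F).comp
    (contMDiff_mul_left (I := 𝓘(𝕜, E')) (n := ∞) (a := h)).continuous

/-- The homeomorphism of the orbit given by an element of the group. -/
def smulHomeomorph (h : Gr) : S.Orbit F ≃ₜ S.Orbit F where
  toEquiv := MulAction.toPerm h
  continuous_toFun := S.continuous_smul_orbit F h
  continuous_invFun := S.continuous_smul_orbit F h⁻¹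

/-- The saturation of an open set is the union of its right translates by the stabilizer of `F`. -/
theorem isOpenMap_orbitMap : IsOpenMap (S.orbitMap F) := by
  intro W hW
  rw [← (S.isQuotientMap_orbitMap F).isOpen_preimage]
  have : S.orbitMap F ⁻¹' (S.orbitMap F '' W)
      = ⋃ t ∈ {t : Gr | S.orbitMap F t = S.orbitMap F 1}, (fun k => k * t) ⁻¹' W := by
    ext k
    simp only [mem_preimage, mem_image, mem_iUnion, mem_ofPred_eq, exists_prop]
    constructor
    · rintro ⟨w, hw, hwk⟩
      refine ⟨k⁻¹ * w, ?_, by simpa using hw⟩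
      rw [← smul_orbitMap, hwk, smul_orbitMap, inv_mul_cancel]
    · rintro ⟨t, ht, hkt⟩
      refine ⟨k * t, hkt, ?_⟩
      rw [← smul_orbitMap, ht, smul_orbitMap, mul_one]
  rw [this]
  exact isOpen_biUnion fun t _ =>
    hW.preimage (contMDiff_mul_right (I := 𝓘(𝕜, E')) (n := ∞) (a := t)).continuous

theorem continuous_coe_orbit : Continuous fun f : S.Orbit F => f.1 := by
  rw [(S.isQuotientMap_orbitMap F).continuous_iff]
  exact (S.contMDiff_coAdr_left F).continuous

theorem t2Space_orbit : T2Space (S.Orbit F) :=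
  T2Space.of_injective_continuous Subtype.val_injective (S.continuous_coe_orbit F)

end Topological

/-! ### An atlas of the coadjoint orbit. -/

section Charts

variable {𝕜 : Type*} [RCLike 𝕜] {E : Type*} [NormedAddCommGroup E] [NormedSpace 𝕜 E]
  {G : Type*} [TopologicalSpace G] [ChartedSpace E G] [Group G] {r : E →L[𝕜] E}
  {E' : Type*} [NormedAddCommGroup E'] [NormedSpace 𝕜 E']
  {Gr : Type*} [TopologicalSpace Gr] [ChartedSpace E' Gr] [Group Gr]
  (S : RSubgroup G r E' Gr) (F : E →L[𝕜] 𝕜) [LieGroup 𝓘(𝕜, E') ∞ Gr]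

/-- The manifold structure of the coadjoint orbit, given coordinates `P` of the orbit near `F`. -/
theorem exists_chartedSpace_orbit {d : ℕ} {P : (E →L[𝕜] 𝕜) →L[𝕜] EuclideanSpace 𝕜 (Fin d)}
    {U : Set Gr} (hU : IsOpen U) (hU1 : 1 ∈ U)
    (hsub : ∀ k ∈ U, Function.Surjective
        (diffAt 𝓘(𝕜, E') 𝓘(𝕜, EuclideanSpace 𝕜 (Fin d)) (fun k => P (S.coAdr k F)) k))
    (hinj : ∀ k ∈ U, ∀ k' ∈ U, P (S.coAdr k F) = P (S.coAdr k' F) → S.coAdr k F = S.coAdr k' F) :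
    ∃ _ : ChartedSpace (EuclideanSpace 𝕜 (Fin d)) (S.Orbit F),
      IsManifold 𝓘(𝕜, EuclideanSpace 𝕜 (Fin d)) ∞ (S.Orbit F) ∧
      ContMDiff 𝓘(𝕜, E') 𝓘(𝕜, EuclideanSpace 𝕜 (Fin d)) ∞ (S.orbitMap F) ∧
      ∀ k : Gr, ContMDiffAt 𝓘(𝕜, EuclideanSpace 𝕜 (Fin d)) 𝓘(𝕜, EuclideanSpace 𝕜 (Fin d)) ∞
        (fun f : S.Orbit F => P (S.coAdr k⁻¹ f.1)) (S.orbitMap F k) := by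
  let π := S.orbitMap F
  let q : Gr → EuclideanSpace 𝕜 (Fin d) := fun k => P (S.coAdr k F)
  have hq : ContMDiff 𝓘(𝕜, E') 𝓘(𝕜, EuclideanSpace 𝕜 (Fin d)) ∞ q :=
    P.contDiff.contMDiff.comp (S.contMDiff_coAdr_left F)
  have hI : InjOn (fun f : S.Orbit F => P f.1) (π '' U) := by
    rintro _ ⟨k, hk, rfl⟩ _ ⟨k', hk', rfl⟩ h
    exact Subtype.ext (hinj k hk k' hk' h)
  let e := hI.toPartialEquiv
  have hcont : Continuous fun f : S.Orbit F => P f.1 :=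
    P.continuous.comp (S.continuous_coe_orbit F)
  have hUo : IsOpen (π '' U) := S.isOpenMap_orbitMap F U hU
  have hopen : IsOpenMap (e.source.domRestrict e) := by
    refine IsOpenMap.of_nhds_le ?_
    rintro ⟨_, k, hk, rfl⟩ W hW
    obtain ⟨s, h1, h2, h3⟩ := hq.contMDiffAt.exists_local_section (hsub k hk)
    have hW' : Subtype.val '' (e.source.domRestrict e ⁻¹' W) ∈ 𝓝 (π k) :=
      hUo.isOpenEmbedding_subtypeVal.image_mem_nhds (x := ⟨π k, k, hk, rfl⟩) |>.2 hW
    have h4 : ∀ᶠ y in 𝓝 (q k), π (s y) ∈ Subtype.val '' (e.source.domRestrict e ⁻¹' W) := by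
      have hc : ContinuousAt (fun y => π (s y)) (q k) :=
        (S.continuous_orbitMap F).continuousAt.comp h2.continuousAt
      refine hc.preimage_mem_nhds ?_
      change s (q k) = k at h1
      rw [h1]
      exact hW'
    have : ∀ᶠ y in 𝓝 (q k), y ∈ W := by
      filter_upwards [h3, h4] with y hy ⟨x, hx, hx'⟩
      have : e.source.domRestrict e x = y := by
        change P x.1.1 = y
        rw [hx']; exact hy
      rw [← this]; exact hx
    exact this
  let c₀ : OpenPartialHomeomorph (S.Orbit F) (EuclideanSpace 𝕜 (Fin d)) :=
    .ofContinuousOpenRestrict e hcont.continuousOn hopen hUo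
  have hc₀ : ∀ f, c₀ f = P f.1 := fun f => rfl
  have hsrc : c₀.source = π '' U := rfl
  -- One chart around `F` suffices: the others are its translates by group elements.
  let c : Gr → OpenPartialHomeomorph (S.Orbit F) (EuclideanSpace 𝕜 (Fin d)) := fun h =>
    (S.smulHomeomorph F h⁻¹).transOpenPartialHomeomorph c₀
  have hc : ∀ h f, c h f = P (S.coAdr h⁻¹ f.1) := fun h f => rfl
  have hcs : ∀ h f, f ∈ (c h).source ↔ h⁻¹ • f ∈ π '' U := fun h f => Iff.rfl
  have hct : ∀ h, (c h).target = c₀.target := fun h => rfl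
  have hcsymm : ∀ h x, (c h).symm x = h • c₀.symm x := fun h x => by
    change h⁻¹⁻¹ • c₀.symm x = _
    rw [inv_inv]
  have hbase : ∀ h, π h ∈ (c h).source := fun h => by
    rw [hcs, smul_orbitMap, inv_mul_cancel]
    exact ⟨1, hU1, rfl⟩
  choose g hg using S.orbitMap_surjective F
  let cs : ChartedSpace (EuclideanSpace 𝕜 (Fin d)) (S.Orbit F) :=
    { atlas := range c
      chartAt := fun f => c (g f)
      mem_chart_source := fun f => by
        have := hbase (g f)
        rwa [show π (g f) = f from hg f] at this
      chart_mem_atlas := fun f => ⟨g f, rfl⟩ }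
  have hsmooth : ∀ h (k : Gr), ContMDiffAt 𝓘(𝕜, E') 𝓘(𝕜, EuclideanSpace 𝕜 (Fin d)) ∞
      (fun k => c h (π k)) k := by
    intro h k
    have : (fun k => c h (π k)) = fun k => q (h⁻¹ * k) := by
      ext1 k
      rw [hc]
      change P (S.coAdr h⁻¹ (S.coAdr k F)) = P (S.coAdr (h⁻¹ * k) F)
      rw [coAdr_mul]
    rw [this]
    exact (hq.comp contMDiff_mul_left).contMDiffAt
  have hman : IsManifold 𝓘(𝕜, EuclideanSpace 𝕜 (Fin d)) ∞ (S.Orbit F) := by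
    refine isManifold_of_contDiffOn _ _ _ ?_
    rintro _ _ ⟨h, rfl⟩ ⟨h', rfl⟩
    simp only [modelWithCornersSelf_coe, modelWithCornersSelf_coe_symm, Function.comp_id,
      Function.id_comp, range_id, inter_univ, preimage_id]
    intro x hx
    refine ContDiffAt.contDiffWithinAt ?_
    have hx' : x ∈ c₀.target := hx.1
    obtain ⟨u, hu, hux⟩ : c₀.symm x ∈ π '' U := c₀.map_target hx'
    have hqu : q u = x := by
      have := c₀.right_inv hx'
      rwa [← hux, hc₀] at this
    -- A transition map is computed by lifting to the group along a local section of the submersion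
    -- `q`, multiplying there, and applying a chart to the orbit map.
    obtain ⟨s, h1, h2, h3⟩ := hq.contMDiffAt.exists_local_section (hsub u hu)
    change s (q u) = u at h1
    change ContMDiffAt _ _ _ s (q u) at h2
    change ∀ᶠ y in 𝓝 (q u), q (s y) = y at h3
    rw [hqu] at h1 h2 h3
    have h4 : ∀ᶠ y in 𝓝 x, s y ∈ U := h2.continuousAt.preimage_mem_nhds
      (by rw [h1]; exact hU.mem_nhds hu)
    have h5 : ContMDiffAt 𝓘(𝕜, EuclideanSpace 𝕜 (Fin d)) 𝓘(𝕜, EuclideanSpace 𝕜 (Fin d)) ∞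
        (fun y => c h' (π (h * s y))) x :=
      (hsmooth h' (h * s x)).comp (f := fun y => h * s y) x (contMDiffAt_const.mul h2)
    refine h5.contDiffAt.congr_of_eventuallyEq ?_
    filter_upwards [h3, h4] with y hy hy'
    have h6 : c₀.symm y = π (s y) := by
      have := c₀.left_inv (x := π (s y)) ⟨s y, hy', rfl⟩
      rwa [hc₀, show P (π (s y)).1 = y from hy] at this
    change c h' ((c h).symm y) = _
    rw [hcsymm, h6, smul_orbitMap]
  have hatlas : ∀ h, c h ∈ IsManifold.maximalAtlas 𝓘(𝕜, EuclideanSpace 𝕜 (Fin d)) ∞ (S.Orbit F) :=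
    fun h => IsManifold.subset_maximalAtlas ⟨h, rfl⟩
  refine ⟨cs, hman, fun k => ?_, fun k => ?_⟩
  · rw [contMDiffAt_iff_target]
    refine ⟨(S.continuous_orbitMap F).continuousAt, ?_⟩
    have : extChartAt 𝓘(𝕜, EuclideanSpace 𝕜 (Fin d)) (S.orbitMap F k) ∘ S.orbitMap F
        = fun k' => c (g (S.orbitMap F k)) (π k') := by
      simp only [extChartAt, mfld_simps]
      rfl
    rw [this]
    exact hsmooth _ k
  · exact contMDiffAt_of_mem_maximalAtlas (hatlas k) (hbase k)

end Charts

end RSubgroup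

/-! ### The coadjoint orbit as an immersed homogeneous manifold. -/

namespace RSubgroup

section OrbitManifold

variable {𝕜 : Type*} [RCLike 𝕜] {E : Type*} [NormedAddCommGroup E] [NormedSpace 𝕜 E]
  {G : Type*} [TopologicalSpace G] [ChartedSpace E G] [Group G] {r : E →L[𝕜] E}
  {E' : Type*} [NormedAddCommGroup E'] [NormedSpace 𝕜 E']
  {Gr : Type*} [TopologicalSpace Gr] [ChartedSpace E' Gr] [Group Gr]
  {S : RSubgroup G r E' Gr} {F : E →L[𝕜] 𝕜} [LieGroup 𝓘(𝕜, E') ∞ Gr]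

section

variable {d : ℕ} [ChartedSpace (EuclideanSpace 𝕜 (Fin d)) (S.Orbit F)]

namespace IsOrbitManifold

/-- The action of `G_r` on its coadjoint orbit has local sections. -/
theorem exists_section (hO : S.IsOrbitManifold F (d := d)) (f : S.Orbit F) :
    ∃ s : S.Orbit F → Gr, s f = 1 ∧ ContMDiffAt 𝓘(𝕜, EuclideanSpace 𝕜 (Fin d)) 𝓘(𝕜, E') ∞ s f ∧
      ∀ᶠ y in 𝓝 f, s y • f = y := by
  obtain ⟨k, rfl⟩ := S.orbitMap_surjective F f
  obtain ⟨s, h1, h2, h3⟩ := hO.contMDiff.contMDiffAt.exists_local_section (hO.submersion k)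
  refine ⟨fun y => s y * k⁻¹, by simp [h1], h2.mul contMDiffAt_const, ?_⟩
  filter_upwards [h3] with y hy
  rw [smul_orbitMap, inv_mul_cancel_right, hy]

/-- Locally in the orbit, the action lifts along a section to multiplication in the group, followed
by the smooth orbit map. -/
theorem contMDiff_smul (hO : S.IsOrbitManifold F (d := d)) :
    ContMDiff (𝓘(𝕜, E').prod 𝓘(𝕜, EuclideanSpace 𝕜 (Fin d))) 𝓘(𝕜, EuclideanSpace 𝕜 (Fin d)) ∞
      (fun p : Gr × S.Orbit F => p.1 • p.2) := by
  rintro ⟨h, f⟩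
  obtain ⟨s, h1, h2, h3⟩ := hO.exists_section f
  obtain ⟨k, rfl⟩ := S.orbitMap_surjective F f
  have h4 : ContMDiffAt (𝓘(𝕜, E').prod 𝓘(𝕜, EuclideanSpace 𝕜 (Fin d)))
      𝓘(𝕜, EuclideanSpace 𝕜 (Fin d)) ∞
      (fun p : Gr × S.Orbit F => S.orbitMap F (p.1 * (s p.2 * k))) (h, S.orbitMap F k) := by
    refine (hO.contMDiff _).comp _ ?_
    exact contMDiffAt_fst.mul ((ContMDiffAt.comp (h, S.orbitMap F k) (g := s) (f := Prod.snd) h2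
      contMDiffAt_snd).mul contMDiffAt_const)
  refine h4.congr_of_eventuallyEq ?_
  filter_upwards [continuousAt_snd.eventually h3] with p hp
  rw [← S.smul_orbitMap, ← S.smul_orbitMap, hp]

theorem contMDiff_smul_left (hO : S.IsOrbitManifold F (d := d)) (f : S.Orbit F) :
    ContMDiff 𝓘(𝕜, E') 𝓘(𝕜, EuclideanSpace 𝕜 (Fin d)) ∞ (fun k : Gr => k • f) :=
  hO.contMDiff_smul.comp (contMDiff_id.prodMk contMDiff_const)

theorem contMDiff_smul_right (hO : S.IsOrbitManifold F (d := d)) (k : Gr) :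
    ContMDiff 𝓘(𝕜, EuclideanSpace 𝕜 (Fin d)) 𝓘(𝕜, EuclideanSpace 𝕜 (Fin d)) ∞
      (fun f : S.Orbit F => k • f) :=
  hO.contMDiff_smul.comp (contMDiff_const.prodMk contMDiff_id)

theorem contMDiff_coe (hO : S.IsOrbitManifold F (d := d)) :
    ContMDiff 𝓘(𝕜, EuclideanSpace 𝕜 (Fin d)) 𝓘(𝕜, E →L[𝕜] 𝕜) ∞ (fun f : S.Orbit F => f.1) := by
  intro f
  obtain ⟨s, h1, h2, h3⟩ := hO.exists_section f
  refine ((S.contMDiff_coAdr_left f.1).contMDiffAt.comp f h2).congr_of_eventuallyEq ?_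
  filter_upwards [h3] with y hy
  exact congrArg Subtype.val hy.symm

end IsOrbitManifold

variable (S F) in
/-- The infinitesimal action of `𝔤_r` on the coadjoint orbit. -/
def fundVecL (f : S.Orbit F) : E →L[𝕜] EuclideanSpace 𝕜 (Fin d) :=
  (diffAt 𝓘(𝕜, E') 𝓘(𝕜, EuclideanSpace 𝕜 (Fin d)) (fun k : Gr => k • f) 1).comp
    (S.lie : E →L[𝕜] E')

theorem IsOrbitManifold.hasDiffAt_smul (hO : S.IsOrbitManifold F (d := d)) (f : S.Orbit F) :
    HasDiffAt 𝓘(𝕜, E') 𝓘(𝕜, EuclideanSpace 𝕜 (Fin d)) (fun k : Gr => k • f) 1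
      ((S.fundVecL F f).comp (S.lie.symm : E' →L[𝕜] E)) :=
  ((hO.contMDiff_smul_left f).hasDiffAt 1).congr_deriv fun v => by simp [fundVecL]

/-- Differentiating `s y • f = y` at `f` for a local section `s` writes every tangent vector as one
generated by `𝔤_r`. -/
theorem IsOrbitManifold.fundVecL_surjective (hO : S.IsOrbitManifold F (d := d)) (f : S.Orbit F) :
    Function.Surjective (S.fundVecL F (d := d) f) := by
  intro v
  obtain ⟨s, h1, h2, h3⟩ := hO.exists_section f
  have h4 := ((hO.hasDiffAt_smul f).comp h2.hasDiffAt h1).unique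
    ((hasDiffAt_id f).congr h3)
  exact ⟨_, DFunLike.congr_fun h4 v⟩

variable (S F) in
/-- The differential of the inclusion of the coadjoint orbit in `𝔤_r*`. -/
def coeL (f : S.Orbit F) : EuclideanSpace 𝕜 (Fin d) →L[𝕜] (E →L[𝕜] 𝕜) :=
  diffAt 𝓘(𝕜, EuclideanSpace 𝕜 (Fin d)) 𝓘(𝕜, E →L[𝕜] 𝕜) (fun f : S.Orbit F => f.1) f

theorem IsOrbitManifold.hasDiffAt_coe (hO : S.IsOrbitManifold F (d := d)) (f : S.Orbit F) :
    HasDiffAt 𝓘(𝕜, EuclideanSpace 𝕜 (Fin d)) 𝓘(𝕜, E →L[𝕜] 𝕜) (fun f : S.Orbit F => f.1) f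
      (S.coeL F f) :=
  hO.contMDiff_coe.hasDiffAt f

variable [LieGroup 𝓘(𝕜, E) ∞ G] [CompleteSpace E] [CompleteSpace E']

theorem IsOrbitManifold.coeL_fundVecL (hO : S.IsOrbitManifold F (d := d)) (f : S.Orbit F) (X : E) :
    S.coeL F (d := d) f (S.fundVecL F f X) = coadr G r f.1 X := by
  have h := ((hO.hasDiffAt_coe f).comp (hO.hasDiffAt_smul f) (one_smul _ f)).unique
    (S.hasDiffAt_coAdr f.1)
  simpa using DFunLike.congr_fun h (S.lie X)

end

variable [LieGroup 𝓘(𝕜, E) ∞ G] [FiniteDimensional 𝕜 E] [FiniteDimensional 𝕜 E']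

variable (S F) in
/-- The coadjoint orbit is an immersed submanifold. -/
theorem exists_isOrbitManifold :
    ∃ (d : ℕ) (_ : ChartedSpace (EuclideanSpace 𝕜 (Fin d)) (S.Orbit F)),
      S.IsOrbitManifold F (d := d) ∧
        ∀ f, Function.Injective (S.coeL F (d := d) f) := by
  have : CompleteSpace E := FiniteDimensional.complete 𝕜 E
  have : CompleteSpace E' := FiniteDimensional.complete 𝕜 E'
  obtain ⟨d, i, P, hP, hi⟩ := exists_range_coordinates (coadr G r F)
  obtain ⟨U, hU, hU1, hsub, hinj⟩ := S.exists_slice_nhd F hP hi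
  obtain ⟨cs, hman, hπ, hc⟩ := S.exists_chartedSpace_orbit F hU hU1 hsub hinj
  have hq : ContMDiff 𝓘(𝕜, E') 𝓘(𝕜, EuclideanSpace 𝕜 (Fin d)) ∞ fun k => P (S.coAdr k F) :=
    P.contDiff.contMDiff.comp (S.contMDiff_coAdr_left F)
  -- Left translation carries the coordinate of the orbit map at `k` to the one at `1`, which is a
  -- submersion. The differential `C` is then onto between spaces of the same dimension `d`, hence
  -- bijective.
  have key : ∀ k, Function.Injective (diffAt 𝓘(𝕜, EuclideanSpace 𝕜 (Fin d))
        𝓘(𝕜, EuclideanSpace 𝕜 (Fin d)) (fun f : S.Orbit F => P (S.coAdr k⁻¹ f.1))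
        (S.orbitMap F k)) ∧
      Function.Surjective (diffAt 𝓘(𝕜, E') 𝓘(𝕜, EuclideanSpace 𝕜 (Fin d)) (S.orbitMap F) k) := by
    intro k
    set C := diffAt 𝓘(𝕜, EuclideanSpace 𝕜 (Fin d))
        𝓘(𝕜, EuclideanSpace 𝕜 (Fin d)) (fun f : S.Orbit F => P (S.coAdr k⁻¹ f.1))
        (S.orbitMap F k) with hC
    have h1 := (hc k).hasDiffAt.comp (hπ.hasDiffAt k) rfl
    have h2 : HasDiffAt 𝓘(𝕜, E') 𝓘(𝕜, EuclideanSpace 𝕜 (Fin d))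
        (fun k' => P (S.coAdr k⁻¹ (S.orbitMap F k').1)) k _ :=
      ((hq.hasDiffAt 1).comp (hasDiffAt_leftTriv k) (inv_mul_cancel k)).congr
        (Eventually.of_forall fun k' => congrArg P (S.coAdr_mul k⁻¹ k' F).symm)
    have h3 := DFunLike.congr_fun (h1.unique h2)
    have hCs : Function.Surjective C := by
      intro y
      obtain ⟨w, hw⟩ := hsub 1 hU1 y
      obtain ⟨w', rfl⟩ := leftTriv_surjective (𝕜 := 𝕜) k w
      exact ⟨_, (h3 w').trans hw⟩
    have hCi : Function.Injective C :=
      (LinearMap.injective_iff_surjective (f := C.toLinearMap)).2 hCs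
    refine ⟨hCi, fun v => ?_⟩
    obtain ⟨w, hw⟩ := hsub 1 hU1 (C v)
    obtain ⟨w', rfl⟩ := leftTriv_surjective (𝕜 := 𝕜) k w
    exact ⟨w', hCi ((h3 w').trans hw)⟩
  have hO : S.IsOrbitManifold F (d := d) := ⟨hman, S.t2Space_orbit F, hπ, fun k => (key k).2⟩
  refine ⟨d, cs, hO, fun f => ?_⟩
  obtain ⟨k, rfl⟩ := S.orbitMap_surjective F f
  -- The coordinate at this point factors through the inclusion in `𝔤_r*`, so injectivity of its
  -- differential passes to that of the inclusion.
  have h1 := (hc k).hasDiffAt.unique ((P.hasDiffAt _).comp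
    (((S.coAdrL k⁻¹).hasDiffAt _).comp (hO.hasDiffAt_coe (S.orbitMap F k)) rfl) rfl)
  have h2 := (key k).1
  rw [h1] at h2
  intro v w hvw
  exact h2 (congrArg (fun y => P (S.coAdrL k⁻¹ y)) hvw)

end OrbitManifold

end RSubgroup

section Calculus

variable {𝕜 : Type*} [RCLike 𝕜]
  {E₁ : Type*} [NormedAddCommGroup E₁] [NormedSpace 𝕜 E₁] {H₁ : Type*} [TopologicalSpace H₁]
  {I₁ : ModelWithCorners 𝕜 E₁ H₁} {M₁ : Type*} [TopologicalSpace M₁] [ChartedSpace H₁ M₁]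
  {V W : Type*} [NormedAddCommGroup V] [NormedSpace 𝕜 V] [NormedAddCommGroup W] [NormedSpace 𝕜 W]

theorem HasDiffAt.sub {f g : M₁ → V} {x : M₁} {A B : E₁ →L[𝕜] V}
    (hf : HasDiffAt I₁ 𝓘(𝕜, V) f x A) (hg : HasDiffAt I₁ 𝓘(𝕜, V) g x B) :
    HasDiffAt I₁ 𝓘(𝕜, V) (fun z => f z - g z) x (A - B) :=
  HasMFDerivAt.sub hf hg

theorem HasDiffAt.clm_apply {f : M₁ → V →L[𝕜] W} {g : M₁ → V} {x : M₁} {A : E₁ →L[𝕜] V →L[𝕜] W}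
    {B : E₁ →L[𝕜] V} (hf : HasDiffAt I₁ 𝓘(𝕜, V →L[𝕜] W) f x A)
    (hg : HasDiffAt I₁ 𝓘(𝕜, V) g x B) :
    HasDiffAt I₁ 𝓘(𝕜, W) (fun z => f z (g z)) x ((f x).comp B + A.flip (g x)) := by
  have h := HasFDerivWithinAt.clm_apply hf.2 hg.2
  simp only [writtenInExtChartAt, Function.comp_apply, extChartAt_to_inv] at h
  exact ⟨ContinuousAt.clm_apply hf.1 hg.1, h⟩

end Calculus

/-! ### The cotangent bundle in the left trivialisation. -/

section Cotangent

variable {𝕜 : Type*} [RCLike 𝕜] {E : Type*} [NormedAddCommGroup E] [NormedSpace 𝕜 E]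
  {G : Type*} [TopologicalSpace G] [ChartedSpace E G] [Group G] [LieGroup 𝓘(𝕜, E) ∞ G]

/-- The form of the cotangent bundle is invariant under the lifted two-sided translations. -/
theorem cotForm_cotAct [CompleteSpace E] (h h' : G) (p : G × (E →L[𝕜] 𝕜)) {A : E →L[𝕜] E}
    (hA : HasDiffAt 𝓘(𝕜, E) 𝓘(𝕜, E) (fun x : G => h * x * h'⁻¹) p.1 A)
    (v w : E × (E →L[𝕜] 𝕜)) :
    cotForm (cotAct h h' p) (A v.1, coAdL h' v.2) (A w.1, coAdL h' w.2) = cotForm p v w := by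
  simp only [cotForm, cotAct, leftTriv_diffAt_mul_mul_inv h h' p.1 hA, coAdL_apply, coAd,
    ContinuousLinearMap.comp_apply, Ad_inv_Ad, ← Ad_lieBr]

theorem cotForm_skew [CompleteSpace E] (p : G × (E →L[𝕜] 𝕜)) (v w : E × (E →L[𝕜] 𝕜)) :
    cotForm p v w = -cotForm p w v := by
  simp only [cotForm, lieBr_skew (G := G) (leftTriv 𝕜 E p.1 w.1), map_neg]
  ring

theorem hasDiffAt_two_sided (h h' g : G) : HasDiffAt 𝓘(𝕜, E) 𝓘(𝕜, E) (fun x : G => h * x * h'⁻¹) g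
    (diffAt 𝓘(𝕜, E) 𝓘(𝕜, E) (fun x : G => h * x * h'⁻¹) g) :=
  ContMDiff.hasDiffAt (((contMDiff_const (I' := 𝓘(𝕜, E))).mul contMDiff_id).mul
    contMDiff_const) g

/-- The differential of `g ↦ Ad g⁻¹ Z`. -/
theorem hasDiffAt_Ad_inv_apply (g : G) (Z : E) :
    HasDiffAt 𝓘(𝕜, E) 𝓘(𝕜, E) (fun x : G => Ad 𝕜 E x⁻¹ Z) g
      ((-(lieBrL 𝕜 G).flip (Ad 𝕜 E g⁻¹ Z)).comp (leftTriv 𝕜 E g)) := by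
  have h := ((ContinuousLinearMap.apply 𝕜 E (Ad 𝕜 E g⁻¹ Z)).hasDiffAt _).comp
    (hasDiffAt_Ad_inv.comp (hasDiffAt_leftTriv (𝕜 := 𝕜) (E := E) g) (inv_mul_cancel g)) rfl
  refine (h.congr (Eventually.of_forall fun x => ?_)).congr_deriv fun v => ?_
  · change Ad 𝕜 E x⁻¹ Z = Ad 𝕜 E (g⁻¹ * x)⁻¹ (Ad 𝕜 E g⁻¹ Z)
    rw [mul_inv_rev, inv_inv, Ad_mul]
    simp [Ad_Ad_inv]
  · simp

end Cotangent

/-! ### Moment maps, the Kirillov form, and the Hamiltonian action on the phase space. -/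

namespace RSubgroup

variable {𝕜 : Type*} [RCLike 𝕜] {E : Type*} [NormedAddCommGroup E] [NormedSpace 𝕜 E]
  {G : Type*} [TopologicalSpace G] [ChartedSpace E G] [Group G] {r : E →L[𝕜] E}
  {E' : Type*} [NormedAddCommGroup E'] [NormedSpace 𝕜 E']
  {Gr : Type*} [TopologicalSpace Gr] [ChartedSpace E' Gr] [Group Gr]
  {S : RSubgroup G r E' Gr} {F : E →L[𝕜] 𝕜} [LieGroup 𝓘(𝕜, E') ∞ Gr] [LieGroup 𝓘(𝕜, E) ∞ G]

theorem restr_cotMoment_apply (p : G × (E →L[𝕜] 𝕜)) (X : E) :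
    S.restr (cotMoment p) X = p.2 (Ad 𝕜 E p.1⁻¹ (rPlus r X) - rMinus r X) := by
  simp [restr, cotMoment, coAd, sub_eq_add_neg]

theorem moment_apply (m : (G × (E →L[𝕜] 𝕜)) × S.Orbit F) (X : E) :
    S.moment F m X = m.2.1 X - m.1.2 (Ad 𝕜 E m.1.1⁻¹ (rPlus r X) - rMinus r X) := by
  rw [moment, sub_apply, restr_cotMoment_apply]

/-- Restriction along `(r₊, r₋)` is equivariant because `r₊` and `r₋` intertwine `Adr h` with `Ad
h₊` and `Ad h₋`. -/
theorem restr_cotMoment_cotAct (h : Gr) (p : G × (E →L[𝕜] 𝕜)) :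
    S.restr (cotMoment (cotAct (S.plus h) (S.minus h) p)) = S.coAdr h (S.restr (cotMoment p)) := by
  ext X
  rw [coAdr_eq, ContinuousLinearMap.comp_apply, restr_cotMoment_apply, restr_cotMoment_apply,
    rPlus_Adr, rMinus_Adr]
  simp [cotAct, coAd, Ad_mul, Ad_inv_Ad]

theorem moment_smul (h : Gr) (m : (G × (E →L[𝕜] 𝕜)) × S.Orbit F) :
    S.moment F (h • m) = S.coAdr h (S.moment F m) := by
  change S.coAdr h m.2.1 - S.restr (cotMoment (cotAct (S.plus h) (S.minus h) m.1)) = _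
  rw [restr_cotMoment_cotAct, moment, ← coAdrL_apply, ← coAdrL_apply, ← coAdrL_apply, map_sub]

section

variable [CompleteSpace E] [CompleteSpace E']

variable (S) in
theorem Adr_rBr (k : Gr) (X Y : E) :
    S.Adr k (rBr 𝕜 G r X Y) = rBr 𝕜 G r (S.Adr k X) (S.Adr k Y) := by
  apply S.lie.injective
  rw [lie_Adr, ← lieBr_lie, ← lieBr_lie, Ad_lieBr, lie_Adr, lie_Adr]

variable {d : ℕ} [ChartedSpace (EuclideanSpace 𝕜 (Fin d)) (S.Orbit F)]

/-- This is `k • j • f = (k j k⁻¹) • k • f`, differentiated in `j` at `1`. -/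
theorem IsOrbitManifold.diffAt_smul_fundVecL (hO : S.IsOrbitManifold F (d := d)) (k : Gr)
    (f : S.Orbit F) (X : E) :
    diffAt 𝓘(𝕜, EuclideanSpace 𝕜 (Fin d)) 𝓘(𝕜, EuclideanSpace 𝕜 (Fin d))
      (fun f : S.Orbit F => k • f) f (S.fundVecL F f X) = S.fundVecL F (k • f) (S.Adr k X) := by
  have h1 := ((hO.contMDiff_smul_right k).hasDiffAt f).comp (hO.hasDiffAt_smul f) (one_smul _ f)
  have h2 := (hO.hasDiffAt_smul (k • f)).comp (hasDiffAt_conj k) (by simp)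
  have h3 := h1.unique (h2.congr (Eventually.of_forall fun j => by
    simp [← mul_smul]))
  simpa [Adr] using DFunLike.congr_fun h3 (S.lie X)

/-- The second vector is lifted to `𝔤_r` by a linear right inverse of the infinitesimal action and
paired with the image of the first in `𝔤_r*`. Nondegeneracy is the injectivity of the differential
of the inclusion. -/
theorem exists_kirillovForm (hO : S.IsOrbitManifold F (d := d))
    (hi : ∀ f, Function.Injective (S.coeL F (d := d) f)) :
    ∃ σ : ∀ f : S.Orbit F, LinearMap.BilinForm 𝕜
      (TangentSpace 𝓘(𝕜, EuclideanSpace 𝕜 (Fin d)) f), S.IsKirillovForm F σ := by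
  have hs : ∀ f, ∃ s : EuclideanSpace 𝕜 (Fin d) →ₗ[𝕜] E, ∀ v, S.fundVecL F f (s v) = v := by
    intro f
    obtain ⟨s, hs⟩ := LinearMap.exists_rightInverse_of_surjective
      (S.fundVecL F (d := d) f : E →ₗ[𝕜] EuclideanSpace 𝕜 (Fin d))
      (LinearMap.range_eq_top.2 (hO.fundVecL_surjective f))
    exact ⟨s, fun v => LinearMap.congr_fun hs v⟩
  choose s hs using hs
  -- The result does not depend on the lift: by skew symmetry the lift can be moved into the slot
  -- where only the generated tangent vector matters.
  have key : ∀ (f : S.Orbit F) (X Y : E), S.coeL F f (S.fundVecL F (d := d) f X)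
      (s f (S.fundVecL F f Y)) = -f.1 (rBr 𝕜 G r X Y) := by
    intro f X Y
    rw [hO.coeL_fundVecL, coadr_apply, rBr_skew, map_neg, neg_neg, rBr_skew X, map_neg, neg_neg]
    have h := congrArg (S.coeL F f) (hs f (S.fundVecL F f Y))
    rw [hO.coeL_fundVecL, hO.coeL_fundVecL] at h
    have h' := DFunLike.congr_fun h X
    rw [coadr_apply, coadr_apply] at h'
    exact neg_injective h'
  let σ : ∀ f : S.Orbit F, LinearMap.BilinForm 𝕜 (EuclideanSpace 𝕜 (Fin d)) := fun f =>
    LinearMap.mk₂ 𝕜 (fun v w => -S.coeL F f v (s f w))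
      (fun _ _ _ => by simp [add_comm]) (fun _ _ _ => by simp)
      (fun _ _ _ => by simp [add_comm]) (fun _ _ _ => by simp)
  have hσ : ∀ (f : S.Orbit F) (X Y : E),
      σ f (S.fundVecL F f X) (S.fundVecL F f Y) = f.1 (rBr 𝕜 G r X Y) := fun f X Y => by
    simp only [σ, LinearMap.mk₂_apply, key, neg_neg]
  refine ⟨σ, hσ, fun f v hv => ?_⟩
  obtain ⟨X, rfl⟩ := hO.fundVecL_surjective f v
  refine hi f ((hO.coeL_fundVecL f X).trans (Eq.trans ?_ (S.coeL F f).map_zero.symm))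
  ext Y
  rw [coadr_apply, ← hσ]
  exact neg_eq_zero.2 (hv _)

variable {σ : ∀ f : S.Orbit F, LinearMap.BilinForm 𝕜
    (TangentSpace 𝓘(𝕜, EuclideanSpace 𝕜 (Fin d)) f)}

/-- The Kirillov form as a form on the model space. -/
abbrev formAt (σ : ∀ f : S.Orbit F, LinearMap.BilinForm 𝕜
    (TangentSpace 𝓘(𝕜, EuclideanSpace 𝕜 (Fin d)) f)) (f : S.Orbit F) :
    LinearMap.BilinForm 𝕜 (EuclideanSpace 𝕜 (Fin d)) := σ f

theorem IsKirillovForm.formAt_fundVecL (hσ : S.IsKirillovForm F σ) (f : S.Orbit F) (X Y : E) :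
    formAt σ f (S.fundVecL F f X) (S.fundVecL F f Y) = f.1 (rBr 𝕜 G r X Y) := hσ.apply f X Y

/-- This is the moment map identity on the orbit, the moment map being the inclusion. -/
theorem IsKirillovForm.formAt_fundVecL_left (hO : S.IsOrbitManifold F (d := d))
    (hσ : S.IsKirillovForm F σ) (f : S.Orbit F) (X : E) (v : EuclideanSpace 𝕜 (Fin d)) :
    formAt σ f (S.fundVecL F f X) v = S.coeL F f v X := by
  obtain ⟨Y, rfl⟩ := hO.fundVecL_surjective f v
  rw [hσ.formAt_fundVecL, hO.coeL_fundVecL, coadr_apply, rBr_skew, map_neg]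

theorem IsKirillovForm.skew (hO : S.IsOrbitManifold F (d := d))
    (hσ : S.IsKirillovForm F σ) (f : S.Orbit F) (v w : EuclideanSpace 𝕜 (Fin d)) :
    formAt σ f v w = -formAt σ f w v := by
  obtain ⟨X, rfl⟩ := hO.fundVecL_surjective f v
  obtain ⟨Y, rfl⟩ := hO.fundVecL_surjective f w
  rw [hσ.formAt_fundVecL, hσ.formAt_fundVecL, rBr_skew, map_neg]

theorem IsKirillovForm.invariant (hO : S.IsOrbitManifold F (d := d))
    (hσ : S.IsKirillovForm F σ) (k : Gr) (f : S.Orbit F) {A : EuclideanSpace 𝕜 (Fin d) →L[𝕜] _}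
    (hA : HasDiffAt 𝓘(𝕜, EuclideanSpace 𝕜 (Fin d)) 𝓘(𝕜, EuclideanSpace 𝕜 (Fin d))
      (fun f : S.Orbit F => k • f) f A) (v w : EuclideanSpace 𝕜 (Fin d)) :
    formAt σ (k • f) (A v) (A w) = formAt σ f v w := by
  obtain ⟨X, rfl⟩ := hO.fundVecL_surjective f v
  obtain ⟨Y, rfl⟩ := hO.fundVecL_surjective f w
  rw [← hA.diffAt_eq, hO.diffAt_smul_fundVecL, hO.diffAt_smul_fundVecL, hσ.formAt_fundVecL,
    hσ.formAt_fundVecL, ← Adr_rBr]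
  change f.1 (S.Adr k⁻¹ _) = _
  rw [Adr_inv_Adr]

/-- The form of the phase space on the model space. -/
abbrev phaseFormAt (σ : ∀ f : S.Orbit F, LinearMap.BilinForm 𝕜
      (TangentSpace 𝓘(𝕜, EuclideanSpace 𝕜 (Fin d)) f))
    (m : (G × (E →L[𝕜] 𝕜)) × S.Orbit F)
    (v w : (E × (E →L[𝕜] 𝕜)) × EuclideanSpace 𝕜 (Fin d)) : 𝕜 :=
  formAt σ m.2 v.2 w.2 - cotForm m.1 v.1 w.1

/-- The differential of the action on the phase space by an element of the group. -/
theorem hasDiffAt_smul_phase {k : Gr} {m : (G × (E →L[𝕜] 𝕜)) × S.Orbit F} {A : E →L[𝕜] E}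
    {B : EuclideanSpace 𝕜 (Fin d) →L[𝕜] EuclideanSpace 𝕜 (Fin d)}
    (hA : HasDiffAt 𝓘(𝕜, E) 𝓘(𝕜, E) (fun x : G => S.plus k * x * (S.minus k)⁻¹) m.1.1 A)
    (hB : HasDiffAt 𝓘(𝕜, EuclideanSpace 𝕜 (Fin d)) 𝓘(𝕜, EuclideanSpace 𝕜 (Fin d))
      (fun f : S.Orbit F => k • f) m.2 B) :
    HasDiffAt (phaseModel 𝕜 E d) (phaseModel 𝕜 E d)
      (fun x : (G × (E →L[𝕜] 𝕜)) × S.Orbit F => k • x) m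
      ((A.prodMap (coAdL (S.minus k))).prodMap B) :=
  (((hA.comp (hasDiffAt_fst _) rfl).comp (hasDiffAt_fst m) rfl).prodMk
    ((((coAdL (S.minus k)).hasDiffAt _).comp (hasDiffAt_snd _) rfl).comp
      (hasDiffAt_fst m) rfl)).prodMk (hB.comp (hasDiffAt_snd m) rfl)

theorem phaseFormAt_smul (hO : S.IsOrbitManifold F (d := d))
    (hσ : S.IsKirillovForm F σ) {k : Gr} {m : (G × (E →L[𝕜] 𝕜)) × S.Orbit F}
    {A : ((E × (E →L[𝕜] 𝕜)) × EuclideanSpace 𝕜 (Fin d)) →L[𝕜] _}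
    (hA : HasDiffAt (phaseModel 𝕜 E d) (phaseModel 𝕜 E d)
      (fun x : (G × (E →L[𝕜] 𝕜)) × S.Orbit F => k • x) m A)
    (v w : (E × (E →L[𝕜] 𝕜)) × EuclideanSpace 𝕜 (Fin d)) :
    phaseFormAt σ (k • m) (A v) (A w) = phaseFormAt σ m v w := by
  have h1 := hasDiffAt_two_sided (𝕜 := 𝕜) (E := E) (S.plus k) (S.minus k) m.1.1
  have h2 := (hO.contMDiff_smul_right k).hasDiffAt m.2
  rw [hA.unique (hasDiffAt_smul_phase h1 h2)]
  exact congrArg₂ _ (hσ.invariant hO k m.2 h2 v.2 w.2)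
    (cotForm_cotAct (S.plus k) (S.minus k) m.1 h1 v.1 w.1)

theorem phaseFormAt_skew (hO : S.IsOrbitManifold F (d := d))
    (hσ : S.IsKirillovForm F σ) (m : (G × (E →L[𝕜] 𝕜)) × S.Orbit F)
    (v w : (E × (E →L[𝕜] 𝕜)) × EuclideanSpace 𝕜 (Fin d)) :
    phaseFormAt σ m v w = -phaseFormAt σ m w v := by
  simp only [phaseFormAt]
  rw [hσ.skew hO, cotForm_skew]
  ring

/-- The vector fields generating the action on the phase space. -/
def phaseVec (S : RSubgroup G r E' Gr) {F : E →L[𝕜] 𝕜}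
    [ChartedSpace (EuclideanSpace 𝕜 (Fin d)) (S.Orbit F)]
    (m : (G × (E →L[𝕜] 𝕜)) × S.Orbit F) (X : E) :
    (E × (E →L[𝕜] 𝕜)) × EuclideanSpace 𝕜 (Fin d) :=
  ((leftTrans 𝕜 E m.1.1 (Ad 𝕜 E m.1.1⁻¹ (rPlus r X) - rMinus r X),
    -m.1.2.comp (lieBrL 𝕜 G (rMinus r X))), S.fundVecL F m.2 X)

theorem diffAt_smul_phase_left (hO : S.IsOrbitManifold F (d := d))
    (m : (G × (E →L[𝕜] 𝕜)) × S.Orbit F) :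
    ∃ A, HasDiffAt 𝓘(𝕜, E') (phaseModel 𝕜 E d) (fun k : Gr => k • m) 1 A ∧
      ∀ X, A (S.lie X) = S.phaseVec m X := by
  have h1 := S.hasDiffAt_plus.mul_const_mul_inv S.hasDiffAt_minus S.plus.map_one S.minus.map_one
    m.1.1
  have h2 := (((ContinuousLinearMap.compL 𝕜 E E 𝕜) m.1.2).hasDiffAt _).comp
    (hasDiffAt_Ad_inv.comp S.hasDiffAt_minus S.minus.map_one) rfl
  refine ⟨_, (h1.prodMk h2).prodMk (hO.hasDiffAt_smul m.2), fun X => ?_⟩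
  refine Prod.ext (Prod.ext ?_ ?_) ?_
  · simp [phaseVec]
  · ext Y; simp [phaseVec]
  · simp [phaseVec]

theorem contMDiff_moment (hO : S.IsOrbitManifold F (d := d)) :
    ContMDiff (phaseModel 𝕜 E d) 𝓘(𝕜, E →L[𝕜] 𝕜) ∞ (S.moment F) := by
  have h1 : ContMDiff (phaseModel 𝕜 E d) 𝓘(𝕜, E →L[𝕜] 𝕜) ∞
      (fun m : (G × (E →L[𝕜] 𝕜)) × S.Orbit F => m.2.1) := hO.contMDiff_coe.comp contMDiff_snd
  have h2 : ContMDiff (phaseModel 𝕜 E d) 𝓘(𝕜, E →L[𝕜] 𝕜) ∞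
      (fun m : (G × (E →L[𝕜] 𝕜)) × S.Orbit F => (coAd m.1.1 m.1.2).comp (rPlus r)) :=
    ContMDiff.clm_comp (contMDiff_coAd.comp contMDiff_fst) contMDiff_const
  have h3 : ContMDiff (phaseModel 𝕜 E d) 𝓘(𝕜, E →L[𝕜] 𝕜) ∞
      (fun m : (G × (E →L[𝕜] 𝕜)) × S.Orbit F => m.1.2.comp (rMinus r)) :=
    ContMDiff.clm_comp (contMDiff_snd.comp contMDiff_fst) contMDiff_const
  have h4 : S.moment F = fun m => m.2.1 - ((coAd m.1.1 m.1.2).comp (rPlus r)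
      - m.1.2.comp (rMinus r)) := by
    ext m X
    simp [moment, restr, cotMoment, sub_eq_add_neg]
  rw [h4]
  exact h1.sub (h2.sub h3)

/-- For fixed `X` this is the product rule in `(g, ξ, f)`; the bracket comes from the differential
of `g ↦ Ad g⁻¹`. -/
theorem diffAt_moment_apply (hO : S.IsOrbitManifold F (d := d))
    (m : (G × (E →L[𝕜] 𝕜)) × S.Orbit F) (w : (E × (E →L[𝕜] 𝕜)) × EuclideanSpace 𝕜 (Fin d))
    (X : E) :
    diffAt (phaseModel 𝕜 E d) 𝓘(𝕜, E →L[𝕜] 𝕜) (S.moment F) m w X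
      = S.coeL F m.2 w.2 X - w.1.2 (Ad 𝕜 E m.1.1⁻¹ (rPlus r X) - rMinus r X)
        + m.1.2 (lieBr 𝕜 G (leftTriv 𝕜 E m.1.1 w.1.1) (Ad 𝕜 E m.1.1⁻¹ (rPlus r X))) := by
  have h1 := ((ContinuousLinearMap.apply 𝕜 𝕜 X).hasDiffAt _).comp
    ((contMDiff_moment hO).hasDiffAt m) rfl
  have h2 := ((ContinuousLinearMap.apply 𝕜 𝕜 X).hasDiffAt _).comp
    ((hO.hasDiffAt_coe m.2).comp
      (hasDiffAt_snd (I₁ := 𝓘(𝕜, E).prod 𝓘(𝕜, E →L[𝕜] 𝕜)) m) rfl) rfl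
  have hm := hasDiffAt_fst (I₁ := 𝓘(𝕜, E).prod 𝓘(𝕜, E →L[𝕜] 𝕜))
    (I₂ := 𝓘(𝕜, EuclideanSpace 𝕜 (Fin d))) m
  have h3 := (hasDiffAt_Ad_inv_apply m.1.1 (rPlus r X)).comp
    (((hasDiffAt_fst (I₂ := 𝓘(𝕜, E →L[𝕜] 𝕜)) m.1)).comp hm rfl) rfl
  have h4 := (hasDiffAt_snd (I₁ := 𝓘(𝕜, E)) (I₂ := 𝓘(𝕜, E →L[𝕜] 𝕜)) m.1).comp hm rfl
  have h5 := h4.clm_apply (h3.sub (hasDiffAt_const m (rMinus r X)))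
  have h7 := h1.unique ((h2.sub h5).congr (Eventually.of_forall fun m => moment_apply m X))
  have h8 := DFunLike.congr_fun h7 w
  simp at h8
  rw [h8, lieBrL_apply, map_sub]
  ring

/-- The moment map identity. -/
theorem phaseFormAt_phaseVec (hO : S.IsOrbitManifold F (d := d)) (hσ : S.IsKirillovForm F σ)
    (m : (G × (E →L[𝕜] 𝕜)) × S.Orbit F) (X : E)
    (w : (E × (E →L[𝕜] 𝕜)) × EuclideanSpace 𝕜 (Fin d)) :
    phaseFormAt σ m (S.phaseVec m X) w
      = diffAt (phaseModel 𝕜 E d) 𝓘(𝕜, E →L[𝕜] 𝕜) (S.moment F) m w X := by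
  rw [diffAt_moment_apply hO]
  simp only [phaseFormAt, phaseVec, hσ.formAt_fundVecL_left hO, cotForm, leftTriv_leftTrans]
  simp only [lieBr_sub_left, neg_apply, ContinuousLinearMap.comp_apply, lieBrL_apply, map_sub]
  rw [lieBr_skew (G := G) (leftTriv 𝕜 E m.1.1 w.1.1), map_neg]
  ring

theorem phaseFormAt_add_left (m : (G × (E →L[𝕜] 𝕜)) × S.Orbit F)
    (v v' w : (E × (E →L[𝕜] 𝕜)) × EuclideanSpace 𝕜 (Fin d)) :
    phaseFormAt σ m (v + v') w = phaseFormAt σ m v w + phaseFormAt σ m v' w := by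
  simp only [phaseFormAt, cotForm, Prod.fst_add, Prod.snd_add, map_add, LinearMap.add_apply,
    add_apply, lieBr_add_left]
  ring

theorem isHamiltonianAction (hO : S.IsOrbitManifold F (d := d)) (hσ : S.IsKirillovForm F σ) :
    IsHamiltonianAction (K := Gr) (phaseModel 𝕜 E d) (S.phaseForm σ) S.lie S.coAdr
        (S.moment F) where
  contMDiff_smul := by
    have hfst : ContMDiff (𝓘(𝕜, E').prod (phaseModel 𝕜 E d)) 𝓘(𝕜, E') ∞
      (Prod.fst : Gr × ((G × (E →L[𝕜] 𝕜)) × S.Orbit F) → Gr) := contMDiff_fst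
    have hsnd : ContMDiff (𝓘(𝕜, E').prod (phaseModel 𝕜 E d)) (phaseModel 𝕜 E d) ∞
      (Prod.snd : Gr × ((G × (E →L[𝕜] 𝕜)) × S.Orbit F) → _) := contMDiff_snd
    have h1 := (((S.contMDiff_plus.comp hfst).mul (contMDiff_fst.comp (contMDiff_fst.comp hsnd))).mul
      (S.contMDiff_minus.comp hfst).inv)
    have h2 := contMDiff_coAd.comp ((S.contMDiff_minus.comp hfst).prodMk
      (contMDiff_snd.comp (contMDiff_fst.comp hsnd)))
    exact (h1.prodMk h2).prodMk (hO.contMDiff_smul.comp (hfst.prodMk (contMDiff_snd.comp hsnd)))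
  preserves k m v w := phaseFormAt_smul hO hσ (hasDiffAt_smul_phase
    (hasDiffAt_two_sided (𝕜 := 𝕜) (E := E) (S.plus k) (S.minus k) m.1.1)
    ((hO.contMDiff_smul_right k).hasDiffAt m.2)).mdifferentiableAt.hasMFDerivAt v w
  contMDiff_moment := contMDiff_moment hO
  equivariant k m := moment_smul k m
  moment m X w := by
    obtain ⟨A, hA, hAX⟩ := diffAt_smul_phase_left hO m
    have h1 := ((ContinuousLinearMap.apply 𝕜 𝕜 X).hasDiffAt _).comp
      ((contMDiff_moment hO).hasDiffAt m) rfl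
    refine (h1.mfderiv_apply w).trans ?_
    exact (phaseFormAt_phaseVec hO hσ m X w).symm.trans (congrArg (fun z => phaseFormAt σ m z w)
      ((hA.mfderiv_apply (S.lie X)).trans (hAX X))).symm

end

end RSubgroup

/-! ### Factorizable elements and the operator `Ad g⁻¹ r₊ - r₋`. -/

namespace RSubgroup

variable {𝕜 : Type*} [RCLike 𝕜] {E : Type*} [NormedAddCommGroup E] [NormedSpace 𝕜 E]
  {G : Type*} [TopologicalSpace G] [ChartedSpace E G] [Group G] {r : E →L[𝕜] E}
  {E' : Type*} [NormedAddCommGroup E'] [NormedSpace 𝕜 E']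
  {Gr : Type*} [TopologicalSpace Gr] [ChartedSpace E' Gr] [Group Gr]
  {S : RSubgroup G r E' Gr} {F : E →L[𝕜] 𝕜} [LieGroup 𝓘(𝕜, E') ∞ Gr] [LieGroup 𝓘(𝕜, E) ∞ G]

section Cell

variable (S) in
/-- The map `h ↦ h₊ h₋⁻¹`. -/
def cellMap (h : Gr) : G := S.plus h * (S.minus h)⁻¹

theorem cellMap_one : S.cellMap 1 = 1 := by simp [cellMap]

theorem cellMap_mul (h k : Gr) : S.cellMap (h * k) = S.plus h * S.cellMap k * (S.minus h)⁻¹ := by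
  simp [cellMap, mul_assoc]

theorem contMDiff_cellMap : ContMDiff 𝓘(𝕜, E') 𝓘(𝕜, E) ∞ S.cellMap :=
  S.contMDiff_plus.mul S.contMDiff_minus.inv

variable (S) in
-- The differential of `h₊ h₋⁻¹` at `1` is `r₊ - r₋`, which is the identity up to `lie`.
theorem hasDiffAt_cellMap_one :
    HasDiffAt 𝓘(𝕜, E') 𝓘(𝕜, E) S.cellMap 1 (S.lie.symm : E' →L[𝕜] E) := by
  refine (S.hasDiffAt_plus.mul_of_eq_one (S.hasDiffAt_minus.inv_of_eq_one S.minus.map_one)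
    S.plus.map_one (by simp)).congr_deriv fun v => ?_
  have := rPlus_sub_rMinus r (S.lie.symm v)
  simpa [sub_eq_add_neg] using this

/-- Equivariance of the map under the two-sided translation by `(h₊, h₋)` carries surjectivity from
`1` to `h`. -/
theorem diffAt_cellMap_surjective (h : Gr) :
    Function.Surjective (diffAt 𝓘(𝕜, E') 𝓘(𝕜, E) S.cellMap h) := by
  have h1 := ((contMDiff_cellMap (S := S)).hasDiffAt h).comp (hasDiffAt_leftTrans (𝕜 := 𝕜) h) (mul_one h)
  have h2 := hasDiffAt_two_sided (𝕜 := 𝕜) (E := E) (S.plus h) (S.minus h) (1 : G)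
  have h3 := h1.unique ((h2.comp S.hasDiffAt_cellMap_one cellMap_one).congr
    (Eventually.of_forall fun k => cellMap_mul h k))
  intro v
  obtain ⟨w, hw⟩ := leftTriv_surjective (𝕜 := 𝕜) (1 : G)
    (Ad 𝕜 E (S.minus h)⁻¹ (leftTriv 𝕜 E (S.plus h * 1 * (S.minus h)⁻¹) v))
  refine ⟨leftTrans 𝕜 E' h (S.lie w), (DFunLike.congr_fun h3 (S.lie w)).trans ?_⟩
  refine leftTriv_injective (𝕜 := 𝕜) (S.plus h * 1 * (S.minus h)⁻¹) ?_
  have h4 := leftTriv_diffAt_mul_mul_inv (S.plus h) (S.minus h) 1 h2 w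
  simp only [ContinuousLinearMap.comp_apply, ContinuousLinearEquiv.coe_coe,
    ContinuousLinearEquiv.symm_apply_apply]
  rw [h4, hw, Ad_Ad_inv]

theorem mem_cell_smul (k : Gr) {g : G} (hg : g ∈ S.cell) :
    S.plus k * g * (S.minus k)⁻¹ ∈ S.cell := by
  obtain ⟨h, rfl⟩ := hg
  exact ⟨k * h, cellMap_mul k h⟩

theorem isOpen_cell [FiniteDimensional 𝕜 E] : IsOpen S.cell :=
  (contMDiff_cellMap.isOpenMap_of_submersion fun h => diffAt_cellMap_surjective h).isOpen_range

variable (r) in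
/-- The operator `Ad g⁻¹ r₊ - r₋`. -/
def cellOp (g : G) : E →L[𝕜] E := (Ad 𝕜 E g⁻¹).comp (rPlus r) - rMinus r

theorem cellOp_apply (g : G) (X : E) :
    cellOp r g X = Ad 𝕜 E g⁻¹ (rPlus r X) - rMinus r X := rfl

/-- With `g = h₊ h₋⁻¹`, both `Ad h₊⁻¹ r₊` and `Ad h₋⁻¹ r₋` can be rewritten through `Adr h⁻¹`.
Factoring out `Ad h₋` leaves `(r₊ - r₋) ∘ Adr h⁻¹`. The product is invertible, which makes reduction
work over all factorizable `g`. -/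
theorem cellOp_cellMap (h : Gr) (X : E) :
    cellOp r (S.cellMap h) X = Ad 𝕜 E (S.minus h) (S.Adr h⁻¹ X) := by
  rw [cellOp_apply, cellMap, mul_inv_rev, inv_inv, Ad_mul]
  have h1 := S.rPlus_Adr h⁻¹ X
  have h2 := S.rMinus_Adr h⁻¹ X
  rw [map_inv] at h1 h2
  rw [ContinuousLinearMap.comp_apply, ← h1]
  conv_lhs => rw [← Ad_Ad_inv (𝕜 := 𝕜) (S.minus h) (rMinus r X), ← h2, ← map_sub, rPlus_sub_rMinus]

variable (S) in
theorem exists_cellOp_equiv {g : G} (hg : g ∈ S.cell) :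
    ∃ T : E ≃L[𝕜] E, cellOp r g = (T : E →L[𝕜] E) := by
  obtain ⟨h, rfl⟩ := hg
  refine ⟨ContinuousLinearEquiv.equivOfInverse (cellOp r (S.cellMap h))
    ((S.Adr h).comp (Ad 𝕜 E (S.minus h)⁻¹)) (fun X => ?_) (fun X => ?_), rfl⟩
  · rw [cellOp_cellMap]
    simp [Ad_inv_Ad, Adr_Adr_inv]
  · rw [cellOp_cellMap]
    simp [Ad_Ad_inv, Adr_inv_Adr]

theorem contMDiff_cellOp : ContMDiff 𝓘(𝕜, E) 𝓘(𝕜, E →L[𝕜] E) ∞ (cellOp r : G → E →L[𝕜] E) :=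
  (ContMDiff.clm_comp (contMDiff_Ad.comp contMDiff_id.inv) contMDiff_const).sub contMDiff_const

end Cell

/-! ### The zero level as a graph over pairs `(g, f)`, and its `G_r`-orbits. -/

section Level

variable (S F) in
/-- The zero level of the moment map. -/
abbrev Level : Type _ := ZeroLevel (S.bigCell F) (S.moment F)

theorem level_eq (z : S.Level F) : z.1.2.1 = z.1.1.2.comp (cellOp r z.1.1.1) := by
  ext X
  have := DFunLike.congr_fun z.2.2 X
  rw [moment_apply] at this
  exact sub_eq_zero.1 this

/-- The coordinates `(g, f)` on the zero level. -/
def levelBase (z : S.Level F) : G × S.Orbit F := (z.1.1.1, z.1.2)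

variable (S F) in
/-- The parametrisation of the zero level by `(g, f)`. -/
def levelLift (p : G × S.Orbit F) : (G × (E →L[𝕜] 𝕜)) × S.Orbit F :=
  ((p.1, p.2.1.comp (cellOp r p.1).inverse), p.2)

/-- On the level `f = ξ ∘ T_g` with `T_g` invertible, so `ξ` can be recovered from `g` and `f`. -/
theorem levelLift_levelBase (z : S.Level F) : S.levelLift F (levelBase z) = z.1 := by
  obtain ⟨T, hT⟩ := S.exists_cellOp_equiv z.2.1
  refine Prod.ext (Prod.ext rfl ?_) rfl
  change z.1.2.1.comp (cellOp r z.1.1.1).inverse = z.1.1.2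
  rw [level_eq, hT, ContinuousLinearMap.inverse_equiv]
  ext X; simp

theorem levelLift_mem {p : G × S.Orbit F} (hp : p.1 ∈ S.cell) :
    S.levelLift F p ∈ S.bigCell F ∧ S.moment F (S.levelLift F p) = 0 := by
  refine ⟨hp, ?_⟩
  obtain ⟨T, hT⟩ := S.exists_cellOp_equiv hp
  ext X
  rw [moment_apply, ← cellOp_apply]
  simp [levelLift, hT]

theorem levelBase_injective : Function.Injective (levelBase : S.Level F → G × S.Orbit F) :=
  fun z z' h => Subtype.ext (by rw [← levelLift_levelBase, h, levelLift_levelBase])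

theorem range_levelBase :
    range (levelBase : S.Level F → G × S.Orbit F) = {p | p.1 ∈ S.cell} := by
  ext p
  constructor
  · rintro ⟨z, rfl⟩
    exact z.2.1
  · intro hp
    exact ⟨⟨S.levelLift F p, levelLift_mem hp⟩, rfl⟩

section

variable {d : ℕ} [ChartedSpace (EuclideanSpace 𝕜 (Fin d)) (S.Orbit F)]

theorem contMDiffAt_levelLift [CompleteSpace E] (hO : S.IsOrbitManifold F (d := d))
    {p : G × S.Orbit F} (hp : p.1 ∈ S.cell) :
    ContMDiffAt (𝓘(𝕜, E).prod 𝓘(𝕜, EuclideanSpace 𝕜 (Fin d))) (phaseModel 𝕜 E d) ∞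
      (S.levelLift F) p := by
  obtain ⟨T, hT⟩ := S.exists_cellOp_equiv hp
  have h1 : ContMDiffAt (𝓘(𝕜, E).prod 𝓘(𝕜, EuclideanSpace 𝕜 (Fin d))) 𝓘(𝕜, E →L[𝕜] E) ∞
      (fun p : G × S.Orbit F => cellOp r p.1) p :=
    (contMDiff_cellOp.comp contMDiff_fst).contMDiffAt
  have h2 : ContDiffAt 𝕜 ∞ (ContinuousLinearMap.inverse : (E →L[𝕜] E) → _) (cellOp r p.1) := by
    rw [hT]; exact contDiffAt_map_inverse T
  have h3 : ContMDiffAt (𝓘(𝕜, E).prod 𝓘(𝕜, EuclideanSpace 𝕜 (Fin d))) 𝓘(𝕜, E →L[𝕜] 𝕜) ∞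
      (fun p : G × S.Orbit F => p.2.1) p :=
    (hO.contMDiff_coe.comp contMDiff_snd).contMDiffAt
  exact (contMDiffAt_fst.prodMk (h3.clm_comp (h2.contMDiffAt.comp p h1))).prodMk contMDiffAt_snd

theorem isOpenEmbedding_levelBase [FiniteDimensional 𝕜 E] (hO : S.IsOrbitManifold F (d := d)) :
    IsOpenEmbedding (levelBase : S.Level F → G × S.Orbit F) := by
  have : CompleteSpace E := FiniteDimensional.complete 𝕜 E
  have hopen : IsOpen {p : G × S.Orbit F | p.1 ∈ S.cell} := isOpen_cell.preimage continuous_fst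
  have hcont : ContinuousOn (S.levelLift F) {p : G × S.Orbit F | p.1 ∈ S.cell} := fun p hp =>
    (contMDiffAt_levelLift hO hp).continuousAt.continuousWithinAt
  let e : S.Level F ≃ₜ {p : G × S.Orbit F | p.1 ∈ S.cell} :=
    { toFun := fun z => ⟨levelBase z, z.2.1⟩
      invFun := fun p => ⟨S.levelLift F p.1, levelLift_mem p.2⟩
      left_inv := fun z => Subtype.ext (levelLift_levelBase z)
      right_inv := fun p => rfl
      continuous_toFun := by
        unfold levelBase
        fun_prop
      continuous_invFun := hcont.domRestrict.subtype_mk _ }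
  exact hopen.isOpenEmbedding_subtypeVal.comp e.isOpenEmbedding

end

instance : MulAction Gr (S.Level F) where
  smul k z := ⟨k • z.1, mem_cell_smul k z.2.1, by
    rw [moment_smul, z.2.2, ← coAdrL_apply, map_zero]⟩
  one_smul z := Subtype.ext (one_smul Gr z.1)
  mul_smul h k z := Subtype.ext (mul_smul h k z.1)

theorem levelBase_smul (k : Gr) (z : S.Level F) :
    levelBase (k • z) = (S.plus k * (levelBase z).1 * (S.minus k)⁻¹, k • (levelBase z).2) := rfl

theorem levelBase_slice (f : S.Orbit F) : levelBase (S.slice F f) = (1, f) := rfl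

theorem toReduced_eq_iff (z z' : S.Level F) :
    toReduced Gr (S.bigCell F) (S.moment F) z = toReduced Gr (S.bigCell F) (S.moment F) z'
      ↔ ∃ k : Gr, k • z' = z := by
  refine Quotient.eq.trans ⟨fun ⟨k, hk⟩ => ⟨k, Subtype.ext hk⟩, fun ⟨k, hk⟩ => ⟨k, ?_⟩⟩
  exact congrArg Subtype.val hk

/-- A factorization of the group component moves any point of the level to `g = 1`, where the level
equation forces `ξ = f`. -/
theorem exists_smul_slice (z : S.Level F) :
    ∃ (h : Gr) (f : S.Orbit F), h • S.slice F f = z ∧ S.cellMap h = z.1.1.1 := by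
  obtain ⟨h, hh⟩ := z.2.1
  refine ⟨h, h⁻¹ • z.1.2, levelBase_injective ?_, hh⟩
  rw [levelBase_smul, levelBase_slice, smul_inv_smul, mul_one]
  exact Prod.ext hh rfl

variable (S) in
open Classical in
/-- A factorization of the factorizable elements. -/
def factor (g : G) : Gr := if hg : ∃ h, S.cellMap h = g then hg.choose else 1

theorem cellMap_factor {g : G} (hg : g ∈ S.cell) : S.cellMap (S.factor g) = g := by
  have hg' : ∃ h, S.cellMap h = g := hg
  rw [factor, dif_pos hg']
  exact hg'.choose_spec

/-- If `h` and `h'` factor the same element, then `h'⁻¹ h` has equal components and hence acts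
trivially on the orbit. This makes `baseProj` independent of the chosen factorization. -/
theorem smul_eq_of_cellMap_eq (hS : ∀ k : Gr, S.plus k = S.minus k → ∀ f : S.Orbit F, k • f = f)
    {h h' : Gr} (hh : S.cellMap h = S.cellMap h') (f : S.Orbit F) : h⁻¹ • f = h'⁻¹ • f := by
  have h1 : S.plus (h'⁻¹ * h) = S.minus (h'⁻¹ * h) := by
    simp only [cellMap] at hh
    rw [map_mul, map_mul, map_inv, map_inv, inv_mul_eq_iff_eq_mul, ← mul_assoc, ← hh]
    simp
  have h2 := hS _ h1 (h⁻¹ • f)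
  rw [← h2, ← mul_smul, mul_assoc, mul_inv_cancel, mul_one]

variable (S F) in
/-- The map `(g, f) ↦ h⁻¹ • f`, where `g = h₊ h₋⁻¹`. -/
def baseProj (p : G × S.Orbit F) : S.Orbit F := (S.factor p.1)⁻¹ • p.2

theorem baseProj_cellMap (hS : ∀ k : Gr, S.plus k = S.minus k → ∀ f : S.Orbit F, k • f = f)
    (h : Gr) (f : S.Orbit F) : S.baseProj F (S.cellMap h, f) = h⁻¹ • f :=
  smul_eq_of_cellMap_eq hS (cellMap_factor ⟨h, rfl⟩) f

theorem baseProj_smul_slice (hS : ∀ k : Gr, S.plus k = S.minus k → ∀ f : S.Orbit F, k • f = f)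
    (h : Gr) (f : S.Orbit F) : S.baseProj F (levelBase (h • S.slice F f)) = f := by
  rw [levelBase_smul, levelBase_slice, mul_one]
  exact (baseProj_cellMap hS h _).trans (inv_smul_smul h f)

/-- The chosen factorization need not be continuous. Locally it may be replaced by a smooth section
of `cellMap` without changing the value. -/
theorem contMDiffAt_baseProj [FiniteDimensional 𝕜 E]
    (hS : ∀ k : Gr, S.plus k = S.minus k → ∀ f : S.Orbit F, k • f = f)
    {d : ℕ} [ChartedSpace (EuclideanSpace 𝕜 (Fin d)) (S.Orbit F)]
    (hO : S.IsOrbitManifold F (d := d)) {p : G × S.Orbit F} (hp : p.1 ∈ S.cell) :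
    ContMDiffAt (𝓘(𝕜, E).prod 𝓘(𝕜, EuclideanSpace 𝕜 (Fin d))) 𝓘(𝕜, EuclideanSpace 𝕜 (Fin d)) ∞
      (S.baseProj F) p := by
  obtain ⟨g, f⟩ := p
  obtain ⟨h, rfl⟩ := hp
  obtain ⟨s, h1, h2, h3⟩ :=
    contMDiff_cellMap.contMDiffAt.exists_local_section (diffAt_cellMap_surjective (S := S) h)
  have h4 : ContMDiffAt (𝓘(𝕜, E).prod 𝓘(𝕜, EuclideanSpace 𝕜 (Fin d)))
      𝓘(𝕜, EuclideanSpace 𝕜 (Fin d)) ∞ (fun p : G × S.Orbit F => (s p.1)⁻¹ • p.2)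
      (S.cellMap h, f) := by
    refine (hO.contMDiff_smul _).comp (S.cellMap h, f) (f := fun p : G × S.Orbit F =>
      ((s p.1)⁻¹, p.2)) ?_
    exact (ContMDiffAt.comp (S.cellMap h, f) (g := s) (f := Prod.fst) h2 contMDiffAt_fst).inv.prodMk
      contMDiffAt_snd
  refine h4.congr_of_eventuallyEq ?_
  filter_upwards [continuousAt_fst.eventually h3] with p hp
  have := baseProj_cellMap hS (s p.1) p.2
  rwa [hp] at this

end Level

end RSubgroup

/-! ### The reduced space. -/

namespace RSubgroup

variable {𝕜 : Type*} [RCLike 𝕜] {E : Type*} [NormedAddCommGroup E] [NormedSpace 𝕜 E]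
  {G : Type*} [TopologicalSpace G] [ChartedSpace E G] [Group G] {r : E →L[𝕜] E}
  {E' : Type*} [NormedAddCommGroup E'] [NormedSpace 𝕜 E']
  {Gr : Type*} [TopologicalSpace Gr] [ChartedSpace E' Gr] [Group Gr]
  {S : RSubgroup G r E' Gr} {F : E →L[𝕜] 𝕜} [LieGroup 𝓘(𝕜, E') ∞ Gr] [LieGroup 𝓘(𝕜, E) ∞ G]
  {d : ℕ} [ChartedSpace (EuclideanSpace 𝕜 (Fin d)) (S.Orbit F)]

variable (S F) in
/-- The reduced space. -/
abbrev Reduced : Type _ := ReducedSpace Gr (S.bigCell F) (S.moment F)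

variable (S F) in
/-- The projection of the zero level on the reduced space. -/
abbrev proj (z : S.Level F) : S.Reduced F := toReduced Gr (S.bigCell F) (S.moment F) z

theorem contMDiff_slice_coe (hO : S.IsOrbitManifold F (d := d)) :
    ContMDiff 𝓘(𝕜, EuclideanSpace 𝕜 (Fin d)) (phaseModel 𝕜 E d) ∞
      (fun f : S.Orbit F => (S.slice F f).1) :=
  (contMDiff_const.prodMk hO.contMDiff_coe).prodMk contMDiff_id

section Reduced

variable [FiniteDimensional 𝕜 E]

/-- The inverse is induced on the quotient by `baseProj`, which is continuous and constant on
`G_r`-orbits. -/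
theorem exists_reduced_homeomorph
    (hS : ∀ k : Gr, S.plus k = S.minus k → ∀ f : S.Orbit F, k • f = f)
    (hO : S.IsOrbitManifold F (d := d)) :
    ∃ κ : S.Orbit F ≃ₜ S.Reduced F, ∀ f, κ f = S.proj F (S.slice F f) := by
  have : CompleteSpace E := FiniteDimensional.complete 𝕜 E
  have hc : Continuous fun z : S.Level F => S.baseProj F (levelBase z) :=
    continuous_iff_continuousAt.2 fun z =>
      (contMDiffAt_baseProj (p := levelBase z) hS hO z.2.1).continuousAt.comp
        (isOpenEmbedding_levelBase hO).continuous.continuousAt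
  have hinv : ∀ z z' : S.Level F, (levelSetoid Gr (S.bigCell F) (S.moment F)) z z' →
      S.baseProj F (levelBase z) = S.baseProj F (levelBase z') := by
    intro z z' h
    obtain ⟨k, rfl⟩ := (toReduced_eq_iff z z').1 (Quotient.sound h)
    obtain ⟨h, f, rfl, -⟩ := exists_smul_slice z'
    rw [← mul_smul, baseProj_smul_slice hS, baseProj_smul_slice hS]
  refine ⟨{ toFun := fun f => S.proj F (S.slice F f)
            invFun := Quotient.lift (fun z => S.baseProj F (levelBase z)) hinv
            left_inv := fun f => ?_
            right_inv := fun q => ?_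
            continuous_toFun := ?_
            continuous_invFun := hc.quotient_lift hinv }, fun f => rfl⟩
  · change S.baseProj F (levelBase (S.slice F f)) = f
    rw [← one_smul Gr (S.slice F f), baseProj_smul_slice hS]
  · obtain ⟨z, rfl⟩ := Quotient.exists_rep q
    obtain ⟨h, f, rfl, -⟩ := exists_smul_slice z
    change S.proj F (S.slice F (S.baseProj F (levelBase (h • S.slice F f)))) = _
    rw [baseProj_smul_slice hS]
    refine (toReduced_eq_iff _ _).2 ⟨h⁻¹, inv_smul_smul h _⟩
  · exact continuous_quotient_mk'.comp ((contMDiff_slice_coe hO).continuous.subtype_mk _)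

/-- The homeomorphism carries the charts of the orbit to the reduced space, so it is a
diffeomorphism by construction. -/
theorem exists_reduced_diffeomorph
    (hS : ∀ k : Gr, S.plus k = S.minus k → ∀ f : S.Orbit F, k • f = f)
    (hO : S.IsOrbitManifold F (d := d)) :
    T2Space (S.Reduced F) ∧ ∃ _ : ChartedSpace (EuclideanSpace 𝕜 (Fin d)) (S.Reduced F),
      IsManifold 𝓘(𝕜, EuclideanSpace 𝕜 (Fin d)) ∞ (S.Reduced F) ∧
      ∃ κ : S.Orbit F ≃ₘ^∞⟮𝓘(𝕜, EuclideanSpace 𝕜 (Fin d)), 𝓘(𝕜, EuclideanSpace 𝕜 (Fin d))⟯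
        S.Reduced F, ∀ f, κ f = S.proj F (S.slice F f) := by
  obtain ⟨κ, hκ⟩ := exists_reduced_homeomorph hS hO
  have := hO.isManifold
  have := hO.t2
  have : Nonempty (S.Reduced F) := ⟨κ (S.orbitMap F 1)⟩
  obtain ⟨cs, h1, h2, s, h3, h4⟩ := κ.symm.isOpenEmbedding.exists_chartedSpace
    𝓘(𝕜, EuclideanSpace 𝕜 (Fin d)) (ContinuousLinearEquiv.refl 𝕜 _)
  have hs : s = κ := by
    ext1 f
    have := h3 (κ f)
    rwa [κ.symm_apply_apply] at this
  rw [κ.symm.surjective.range_eq, contMDiffOn_univ, hs] at h4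
  exact ⟨κ.t2Space, cs, h1, ⟨κ.toEquiv, h4, h2⟩, hκ⟩

end Reduced

variable {a : ℕ} [ChartedSpace (EuclideanSpace 𝕜 (Fin a)) (S.Level F)]

variable (S F) in
/-- The manifold structure of the zero level is such that `(g, f)` is an open embedding. -/
structure IsLevelManifold : Prop where
  isManifold : IsManifold 𝓘(𝕜, EuclideanSpace 𝕜 (Fin a)) ∞ (S.Level F)
  contMDiff_levelBase : ContMDiff 𝓘(𝕜, EuclideanSpace 𝕜 (Fin a))
    (𝓘(𝕜, E).prod 𝓘(𝕜, EuclideanSpace 𝕜 (Fin d))) ∞ (levelBase : S.Level F → G × S.Orbit F)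
  exists_inverse : ∃ s : G × S.Orbit F → S.Level F, (∀ z, s (levelBase z) = z) ∧
    ContMDiffOn (𝓘(𝕜, E).prod 𝓘(𝕜, EuclideanSpace 𝕜 (Fin d))) 𝓘(𝕜, EuclideanSpace 𝕜 (Fin a)) ∞
      s {p | p.1 ∈ S.cell}

end RSubgroup

/-! ### The manifold structure and tangent spaces of the zero level. -/

namespace RSubgroup

variable {𝕜 : Type*} [RCLike 𝕜] {E : Type*} [NormedAddCommGroup E] [NormedSpace 𝕜 E]
  {G : Type*} [TopologicalSpace G] [ChartedSpace E G] [Group G] {r : E →L[𝕜] E}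
  {E' : Type*} [NormedAddCommGroup E'] [NormedSpace 𝕜 E']
  {Gr : Type*} [TopologicalSpace Gr] [ChartedSpace E' Gr] [Group Gr]
  {S : RSubgroup G r E' Gr} {F : E →L[𝕜] 𝕜} [LieGroup 𝓘(𝕜, E') ∞ Gr] [LieGroup 𝓘(𝕜, E) ∞ G]
  {d : ℕ} [ChartedSpace (EuclideanSpace 𝕜 (Fin d)) (S.Orbit F)] [FiniteDimensional 𝕜 E]

theorem exists_isLevelManifold (hO : S.IsOrbitManifold F (d := d)) :
    ∃ (a : ℕ) (_ : ChartedSpace (EuclideanSpace 𝕜 (Fin a)) (S.Level F)),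
      S.IsLevelManifold F (d := d) (a := a) := by
  have := hO.isManifold
  have : Nonempty (S.Level F) := ⟨S.slice F (S.orbitMap F 1)⟩
  let L : (E × EuclideanSpace 𝕜 (Fin d)) ≃L[𝕜]
      EuclideanSpace 𝕜 (Fin (Module.finrank 𝕜 (E × EuclideanSpace 𝕜 (Fin d)))) :=
    ContinuousLinearEquiv.ofFinrankEq (by simp)
  obtain ⟨cs, h1, h2, s, h3, h4⟩ := (isOpenEmbedding_levelBase hO).exists_chartedSpace
    (𝓘(𝕜, E).prod 𝓘(𝕜, EuclideanSpace 𝕜 (Fin d))) L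
  rw [range_levelBase] at h4
  exact ⟨_, cs, h1, h2, s, h3, h4⟩

variable {a : ℕ} [ChartedSpace (EuclideanSpace 𝕜 (Fin a)) (S.Level F)]

namespace IsLevelManifold

theorem contMDiff_coe (hL : S.IsLevelManifold F (d := d) (a := a))
    (hO : S.IsOrbitManifold F (d := d)) :
    ContMDiff 𝓘(𝕜, EuclideanSpace 𝕜 (Fin a)) (phaseModel 𝕜 E d) ∞
      (Subtype.val : S.Level F → (G × (E →L[𝕜] 𝕜)) × S.Orbit F) := by
  have : CompleteSpace E := FiniteDimensional.complete 𝕜 E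
  have h : (Subtype.val : S.Level F → _) = fun z => S.levelLift F (levelBase z) := by
    ext1 z
    exact (levelLift_levelBase z).symm
  rw [h]
  exact fun z => (contMDiffAt_levelLift (p := levelBase z) hO z.2.1).comp z (hL.contMDiff_levelBase z)

/-- A map to the zero level is smooth if its coordinates are. -/
theorem contMDiff_of_levelBase (hL : S.IsLevelManifold F (d := d) (a := a))
    {V : Type*} [NormedAddCommGroup V] [NormedSpace 𝕜 V] {M : Type*} [TopologicalSpace M]
    [ChartedSpace V M] {c : M → S.Level F}
    (hc : ContMDiff 𝓘(𝕜, V) (𝓘(𝕜, E).prod 𝓘(𝕜, EuclideanSpace 𝕜 (Fin d))) ∞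
      fun x => levelBase (c x)) : ContMDiff 𝓘(𝕜, V) 𝓘(𝕜, EuclideanSpace 𝕜 (Fin a)) ∞ c := by
  obtain ⟨s, h1, h2⟩ := hL.exists_inverse
  have h : c = fun x => s (levelBase (c x)) := by
    ext1 x
    rw [h1]
  have hopen : IsOpen {p : G × S.Orbit F | p.1 ∈ S.cell} := isOpen_cell.preimage continuous_fst
  rw [h]
  exact fun x => (h2.contMDiffAt (hopen.mem_nhds (c x).2.1)).comp x (hc x)

theorem diffAt_levelBase_injective (hL : S.IsLevelManifold F (d := d) (a := a)) (z : S.Level F) :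
    Function.Injective (diffAt 𝓘(𝕜, EuclideanSpace 𝕜 (Fin a))
      (𝓘(𝕜, E).prod 𝓘(𝕜, EuclideanSpace 𝕜 (Fin d))) levelBase z) := by
  obtain ⟨s, h1, h2⟩ := hL.exists_inverse
  have hopen : IsOpen {p : G × S.Orbit F | p.1 ∈ S.cell} := isOpen_cell.preimage continuous_fst
  have h3 := ((h2.contMDiffAt (hopen.mem_nhds z.2.1)).hasDiffAt.comp
    (hL.contMDiff_levelBase.hasDiffAt z) rfl).unique
    ((hasDiffAt_id z).congr (Eventually.of_forall h1))
  exact Function.LeftInverse.injective (fun v => DFunLike.congr_fun h3 v)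

theorem _root_.RSubgroup.diffAt_levelBase_eq {z : S.Level F} {A} (hA : HasDiffAt 𝓘(𝕜, EuclideanSpace 𝕜 (Fin a)) (phaseModel 𝕜 E d)
      (Subtype.val : S.Level F → _) z A) (v : EuclideanSpace 𝕜 (Fin a)) :
    diffAt 𝓘(𝕜, EuclideanSpace 𝕜 (Fin a)) (𝓘(𝕜, E).prod 𝓘(𝕜, EuclideanSpace 𝕜 (Fin d)))
      levelBase z v = ((A v).1.1, (A v).2) := by
  have hm := hasDiffAt_fst (I₁ := 𝓘(𝕜, E).prod 𝓘(𝕜, E →L[𝕜] 𝕜))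
    (I₂ := 𝓘(𝕜, EuclideanSpace 𝕜 (Fin d))) z.1
  have h1 := ((hasDiffAt_fst (I₁ := 𝓘(𝕜, E)) (I₂ := 𝓘(𝕜, E →L[𝕜] 𝕜)) z.1.1).comp hm rfl).comp
    hA rfl
  have h2 := (hasDiffAt_snd (I₁ := 𝓘(𝕜, E).prod 𝓘(𝕜, E →L[𝕜] 𝕜))
    (I₂ := 𝓘(𝕜, EuclideanSpace 𝕜 (Fin d))) z.1).comp hA rfl
  exact DFunLike.congr_fun (h1.prodMk h2).diffAt_eq v

theorem diffAt_coe_injective (hL : S.IsLevelManifold F (d := d) (a := a))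
    {z : S.Level F} {A} (hA : HasDiffAt 𝓘(𝕜, EuclideanSpace 𝕜 (Fin a)) (phaseModel 𝕜 E d)
      (Subtype.val : S.Level F → _) z A) : Function.Injective A := by
  intro v w hvw
  refine hL.diffAt_levelBase_injective z ?_
  rw [diffAt_levelBase_eq hA, diffAt_levelBase_eq hA, hvw]

theorem contMDiff_smul_slice (hL : S.IsLevelManifold F (d := d) (a := a))
    (hO : S.IsOrbitManifold F (d := d)) (h : Gr) :
    ContMDiff 𝓘(𝕜, EuclideanSpace 𝕜 (Fin d)) 𝓘(𝕜, EuclideanSpace 𝕜 (Fin a)) ∞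
      fun f : S.Orbit F => h • S.slice F f :=
  hL.contMDiff_of_levelBase ((contMDiff_const (c := S.plus h * 1 * (S.minus h)⁻¹)).prodMk
    (hO.contMDiff_smul_right h))

theorem contMDiff_smul_left (hL : S.IsLevelManifold F (d := d) (a := a))
    (hO : S.IsOrbitManifold F (d := d)) (z : S.Level F) :
    ContMDiff 𝓘(𝕜, E') 𝓘(𝕜, EuclideanSpace 𝕜 (Fin a)) ∞ fun k : Gr => k • z :=
  hL.contMDiff_of_levelBase
    (((S.contMDiff_plus.mul contMDiff_const).mul S.contMDiff_minus.inv).prodMk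
      (hO.contMDiff_smul_left _))

theorem contMDiff_baseProj (hL : S.IsLevelManifold F (d := d) (a := a))
    (hO : S.IsOrbitManifold F (d := d))
    (hS : ∀ k : Gr, S.plus k = S.minus k → ∀ f : S.Orbit F, k • f = f) :
    ContMDiff 𝓘(𝕜, EuclideanSpace 𝕜 (Fin a)) 𝓘(𝕜, EuclideanSpace 𝕜 (Fin d)) ∞
      fun z : S.Level F => S.baseProj F (levelBase z) :=
  fun z => (contMDiffAt_baseProj (p := levelBase z) hS hO z.2.1).comp z (hL.contMDiff_levelBase z)

/-- The tangent space of the zero level is spanned by those of the orbits of `G_r` and of the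
translated slices. -/
theorem exists_decomposition [CompleteSpace E'] (hL : S.IsLevelManifold F (d := d) (a := a))
    (hO : S.IsOrbitManifold F (d := d)) (h : Gr) (f : S.Orbit F) {A B}
    (hA : HasDiffAt 𝓘(𝕜, E') 𝓘(𝕜, EuclideanSpace 𝕜 (Fin a))
      (fun k : Gr => k • (h • S.slice F f)) 1 A)
    (hB : HasDiffAt 𝓘(𝕜, EuclideanSpace 𝕜 (Fin d)) 𝓘(𝕜, EuclideanSpace 𝕜 (Fin a))
      (fun f : S.Orbit F => h • S.slice F f) f B) (v : EuclideanSpace 𝕜 (Fin a)) :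
    ∃ (X : E) (u : EuclideanSpace 𝕜 (Fin d)), v = A (S.lie X) + B u := by
  have : CompleteSpace E := FiniteDimensional.complete 𝕜 E
  set z := h • S.slice F f with hz
  set D := diffAt 𝓘(𝕜, EuclideanSpace 𝕜 (Fin a)) (𝓘(𝕜, E).prod 𝓘(𝕜, EuclideanSpace 𝕜 (Fin d)))
    levelBase z with hD
  have hDz := hL.contMDiff_levelBase.hasDiffAt z
  obtain ⟨C, hC, hCX⟩ := diffAt_smul_phase_left hO z.1
  have h1 : ∀ X, (D (A (S.lie X))).1
      = leftTrans 𝕜 E z.1.1.1 (cellOp r z.1.1.1 X) := by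
    intro X
    have h2 := (((hL.contMDiff_coe hO).hasDiffAt z).comp hA (one_smul _ _)).unique hC
    have h3 := diffAt_levelBase_eq ((hL.contMDiff_coe hO).hasDiffAt z) (A (S.lie X))
    rw [hD, h3]
    have h4 := (DFunLike.congr_fun h2 (S.lie X)).trans (hCX X)
    exact congrArg (fun q : (E × (E →L[𝕜] 𝕜)) × EuclideanSpace 𝕜 (Fin d) => q.1.1) h4
  obtain ⟨T, hT⟩ := S.exists_cellOp_equiv z.2.1
  -- Invertibility of the cell operator yields a direction of the `G_r`-orbit with the same
  -- `G`-component as `v`. What remains moves only `f`, so it is tangent to a translate of the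
  -- slice.
  obtain ⟨X, hX⟩ : ∃ X, leftTrans 𝕜 E z.1.1.1 (cellOp r z.1.1.1 X) = (D v).1 :=
    ⟨T.symm (leftTriv 𝕜 E z.1.1.1 (D v).1), by rw [hT]; simp [leftTrans_leftTriv]⟩
  have hk := hO.contMDiff_smul_right (F := F) h
  have hk' := hO.contMDiff_smul_right (F := F) h⁻¹
  have h5 := (hDz.comp hB rfl).unique ((hasDiffAt_const f _).prodMk (hk.hasDiffAt f))
  have h6 := ((hk.hasDiffAt (h⁻¹ • (h • f))).comp (hk'.hasDiffAt (h • f)) rfl).unique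
    ((hasDiffAt_id (h • f)).congr (Eventually.of_forall fun y => smul_inv_smul h y))
  rw [inv_smul_smul] at h6
  refine ⟨X, diffAt 𝓘(𝕜, EuclideanSpace 𝕜 (Fin d)) 𝓘(𝕜, EuclideanSpace 𝕜 (Fin d))
    (fun y : S.Orbit F => h⁻¹ • y) (h • f) (D (v - A (S.lie X))).2, ?_⟩
  rw [← sub_eq_iff_eq_add']
  refine hL.diffAt_levelBase_injective z ?_
  refine Eq.trans ?_ (DFunLike.congr_fun h5 _).symm
  refine Prod.ext ?_ ?_
  · change (D (v - A (S.lie X))).1 = 0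
    rw [map_sub, Prod.fst_sub, h1, hX, sub_self]
  · exact (DFunLike.congr_fun h6 _).symm

end IsLevelManifold

end RSubgroup

/-! ### The reduced symplectic form. -/

namespace RSubgroup

variable {𝕜 : Type*} [RCLike 𝕜] {E : Type*} [NormedAddCommGroup E] [NormedSpace 𝕜 E]
  {G : Type*} [TopologicalSpace G] [ChartedSpace E G] [Group G] {r : E →L[𝕜] E}
  {E' : Type*} [NormedAddCommGroup E'] [NormedSpace 𝕜 E']
  {Gr : Type*} [TopologicalSpace Gr] [ChartedSpace E' Gr] [Group Gr]
  {S : RSubgroup G r E' Gr} {F : E →L[𝕜] 𝕜} [LieGroup 𝓘(𝕜, E') ∞ Gr] [LieGroup 𝓘(𝕜, E) ∞ G]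
  {d : ℕ} [ChartedSpace (EuclideanSpace 𝕜 (Fin d)) (S.Orbit F)] [FiniteDimensional 𝕜 E]
  [CompleteSpace E']
  {a : ℕ} [ChartedSpace (EuclideanSpace 𝕜 (Fin a)) (S.Level F)]
  {σ : ∀ f : S.Orbit F, LinearMap.BilinForm 𝕜
    (TangentSpace 𝓘(𝕜, EuclideanSpace 𝕜 (Fin d)) f)}

/-- The restriction of the form of the phase space to the zero level is the pull-back of the
Kirillov form. -/
theorem IsLevelManifold.phaseFormAt_eq (hL : S.IsLevelManifold F (d := d) (a := a))
    (hO : S.IsOrbitManifold F (d := d)) (hσ : S.IsKirillovForm F σ)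
    (hS : ∀ k : Gr, S.plus k = S.minus k → ∀ f : S.Orbit F, k • f = f) (z : S.Level F) {ι p}
    (hι : HasDiffAt 𝓘(𝕜, EuclideanSpace 𝕜 (Fin a)) (phaseModel 𝕜 E d)
      (Subtype.val : S.Level F → _) z ι)
    (hp : HasDiffAt 𝓘(𝕜, EuclideanSpace 𝕜 (Fin a)) 𝓘(𝕜, EuclideanSpace 𝕜 (Fin d))
      (fun z : S.Level F => S.baseProj F (levelBase z)) z p) (v w : EuclideanSpace 𝕜 (Fin a)) :
    phaseFormAt σ z.1 (ι v) (ι w) = formAt σ (S.baseProj F (levelBase z)) (p v) (p w) := by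
  have : CompleteSpace E := FiniteDimensional.complete 𝕜 E
  obtain ⟨h, f, rfl, -⟩ := exists_smul_slice z
  rw [baseProj_smul_slice hS]
  set z := h • S.slice F f with hz
  have hA := (hL.contMDiff_smul_left hO z).hasDiffAt 1
  have hB := (hL.contMDiff_smul_slice hO h).hasDiffAt f
  set A := diffAt 𝓘(𝕜, E') 𝓘(𝕜, EuclideanSpace 𝕜 (Fin a)) (fun k : Gr => k • z) 1
  set B := diffAt 𝓘(𝕜, EuclideanSpace 𝕜 (Fin d)) 𝓘(𝕜, EuclideanSpace 𝕜 (Fin a))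
    (fun f : S.Orbit F => h • S.slice F f) f
  obtain ⟨C, hC, hCX⟩ := diffAt_smul_phase_left hO z.1
  have hιA : ∀ X, ι (A (S.lie X)) = S.phaseVec z.1 X := fun X =>
    (DFunLike.congr_fun ((hι.comp hA (one_smul _ _)).unique hC) (S.lie X)).trans (hCX X)
  have hpA : ∀ X, p (A (S.lie X)) = 0 := by
    intro X
    refine DFunLike.congr_fun ((hp.comp hA (one_smul _ _)).unique
      ((hasDiffAt_const 1 f).congr (Eventually.of_forall fun k => ?_))) (S.lie X)
    change S.baseProj F (levelBase (k • (h • S.slice F f))) = f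
    rw [← mul_smul, baseProj_smul_slice hS]
  have hpB : ∀ u, p (B u) = u := fun u =>
    DFunLike.congr_fun ((hp.comp hB rfl).unique
      ((hasDiffAt_id f).congr (Eventually.of_forall fun y => baseProj_smul_slice hS h y))) u
  have hJ : ∀ u, diffAt (phaseModel 𝕜 E d) 𝓘(𝕜, E →L[𝕜] 𝕜) (S.moment F) z.1 (ι u) = 0 := fun u =>
    DFunLike.congr_fun ((((contMDiff_moment hO).hasDiffAt z.1).comp hι rfl).unique
      ((hasDiffAt_const z (0 : E →L[𝕜] 𝕜)).congr (Eventually.of_forall fun y => y.2.2))) u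
  -- Pairing with an orbit direction is the differential of `J`, which vanishes along the level.
  have h0 : ∀ X u, phaseFormAt σ z.1 (ι (A (S.lie X))) (ι u) = 0 := by
    intro X u
    rw [hιA, phaseFormAt_phaseVec hO hσ, hJ, zero_apply]
  have hs : HasDiffAt 𝓘(𝕜, EuclideanSpace 𝕜 (Fin d)) (phaseModel 𝕜 E d)
      (fun f : S.Orbit F => (S.slice F f).1) f _ :=
    ((hasDiffAt_const f (1 : G)).prodMk (hO.hasDiffAt_coe f)).prodMk (hasDiffAt_id f)
  have hk := hasDiffAt_smul_phase (S := S) (k := h) (m := (S.slice F f).1)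
    (hasDiffAt_two_sided (𝕜 := 𝕜) (E := E) (S.plus h) (S.minus h) _)
    ((hO.contMDiff_smul_right h).hasDiffAt _)
  have h1 := (hι.comp hB rfl).unique (hk.comp hs rfl)
  -- Invariance moves the computation to `g = 1`. Tangent vectors of the slice have zero
  -- `G`-component, so every term of the cotangent form is zero.
  have h2 : ∀ u u', phaseFormAt σ z.1 (ι (B u)) (ι (B u')) = formAt σ f u u' := by
    intro u u'
    have h3 := phaseFormAt_smul hO hσ hk ((0, S.coeL F f u), u) ((0, S.coeL F f u'), u')
    refine (congrArg₂ (phaseFormAt σ z.1) (DFunLike.congr_fun h1 u)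
      (DFunLike.congr_fun h1 u')).trans (h3.trans ?_)
    have h4 : ∀ X : E, lieBr 𝕜 G 0 X = 0 := fun X => by
      rw [← lieBrL_apply, map_zero, zero_apply]
    simp [phaseFormAt, cotForm, h4, RSubgroup.slice]
  obtain ⟨X, u, rfl⟩ := hL.exists_decomposition hO h f hA hB v
  obtain ⟨Y, u', rfl⟩ := hL.exists_decomposition hO h f hA hB w
  have h5 : ∀ X u, p (A (S.lie X) + B u) = u := fun X u => by rw [map_add, hpA, hpB, zero_add]
  have h6 : ∀ X u w, phaseFormAt σ z.1 (ι (A (S.lie X) + B u)) (ι w)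
      = phaseFormAt σ z.1 (ι (B u)) (ι w) := fun X u w => by
    rw [map_add, phaseFormAt_add_left, h0, zero_add]
  rw [h5, h5, h6, phaseFormAt_skew hO hσ, h6, ← phaseFormAt_skew hO hσ, h2]

/-- The fibre directions `ξ` suffice: there the differential of `J` is minus composition with the
invertible cell operator. -/
theorem diffAt_moment_surjective (hO : S.IsOrbitManifold F (d := d)) (z : S.Level F) :
    Function.Surjective
      (diffAt (phaseModel 𝕜 E d) 𝓘(𝕜, E →L[𝕜] 𝕜) (S.moment F) z.1) := by
  have : CompleteSpace E := FiniteDimensional.complete 𝕜 E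
  intro η
  obtain ⟨T, hT⟩ := S.exists_cellOp_equiv z.2.1
  refine ⟨((0, -η.comp (T.symm : E →L[𝕜] E)), 0), ?_⟩
  ext X
  rw [diffAt_moment_apply hO, ← cellOp_apply, hT]
  have h4 : ∀ X : E, lieBr 𝕜 G 0 X = 0 := fun X => by
    rw [← lieBrL_apply, map_zero, zero_apply]
  simp [h4]

variable [ChartedSpace (EuclideanSpace 𝕜 (Fin d)) (S.Reduced F)]
  {κ : S.Orbit F ≃ₘ^∞⟮𝓘(𝕜, EuclideanSpace 𝕜 (Fin d)), 𝓘(𝕜, EuclideanSpace 𝕜 (Fin d))⟯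
    S.Reduced F}

/-- The reduced form. -/
def reducedForm (σ : ∀ f : S.Orbit F, LinearMap.BilinForm 𝕜
    (TangentSpace 𝓘(𝕜, EuclideanSpace 𝕜 (Fin d)) f))
    (κ : S.Orbit F ≃ₘ^∞⟮𝓘(𝕜, EuclideanSpace 𝕜 (Fin d)), 𝓘(𝕜, EuclideanSpace 𝕜 (Fin d))⟯
      S.Reduced F) (q : S.Reduced F) : LinearMap.BilinForm 𝕜 (EuclideanSpace 𝕜 (Fin d)) :=
  (formAt σ (κ.symm q)).compl₁₂
    (diffAt 𝓘(𝕜, EuclideanSpace 𝕜 (Fin d)) 𝓘(𝕜, EuclideanSpace 𝕜 (Fin d)) κ.symm q).toLinearMap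
    (diffAt 𝓘(𝕜, EuclideanSpace 𝕜 (Fin d)) 𝓘(𝕜, EuclideanSpace 𝕜 (Fin d)) κ.symm q).toLinearMap

theorem reducedForm_apply (q : S.Reduced F) (v w : EuclideanSpace 𝕜 (Fin d)) :
    reducedForm σ κ q v w = formAt σ (κ.symm q)
      (diffAt 𝓘(𝕜, EuclideanSpace 𝕜 (Fin d)) 𝓘(𝕜, EuclideanSpace 𝕜 (Fin d)) κ.symm q v)
      (diffAt 𝓘(𝕜, EuclideanSpace 𝕜 (Fin d)) 𝓘(𝕜, EuclideanSpace 𝕜 (Fin d)) κ.symm q w) := rfl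

theorem diffAt_symm_diffAt {f : S.Orbit F} {K}
    (hK : HasDiffAt 𝓘(𝕜, EuclideanSpace 𝕜 (Fin d)) 𝓘(𝕜, EuclideanSpace 𝕜 (Fin d)) κ f K)
    (v : EuclideanSpace 𝕜 (Fin d)) :
    diffAt 𝓘(𝕜, EuclideanSpace 𝕜 (Fin d)) 𝓘(𝕜, EuclideanSpace 𝕜 (Fin d)) κ.symm (κ f) (K v)
      = v :=
  DFunLike.congr_fun (((κ.symm.contMDiff.hasDiffAt (κ f)).comp hK rfl).unique
    ((hasDiffAt_id f).congr (Eventually.of_forall κ.symm_apply_apply))) v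

theorem diffAt_diffAt_symm {f : S.Orbit F} {K}
    (hK : HasDiffAt 𝓘(𝕜, EuclideanSpace 𝕜 (Fin d)) 𝓘(𝕜, EuclideanSpace 𝕜 (Fin d)) κ f K)
    (v : EuclideanSpace 𝕜 (Fin d)) :
    K (diffAt 𝓘(𝕜, EuclideanSpace 𝕜 (Fin d)) 𝓘(𝕜, EuclideanSpace 𝕜 (Fin d)) κ.symm (κ f) v)
      = v :=
  DFunLike.congr_fun ((hK.comp (κ.symm.contMDiff.hasDiffAt (κ f)) (κ.symm_apply_apply f)).unique
    ((hasDiffAt_id (κ f)).congr (Eventually.of_forall κ.apply_symm_apply))) v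

theorem reducedForm_diffAt {f : S.Orbit F} {K}
    (hK : HasDiffAt 𝓘(𝕜, EuclideanSpace 𝕜 (Fin d)) 𝓘(𝕜, EuclideanSpace 𝕜 (Fin d)) κ f K)
    (v w : EuclideanSpace 𝕜 (Fin d)) :
    reducedForm σ κ (κ f) (K v) (K w) = formAt σ f v w := by
  rw [reducedForm_apply, diffAt_symm_diffAt hK, diffAt_symm_diffAt hK]
  congr 2
  exact congrArg (formAt σ) (κ.symm_apply_apply f)

theorem reducedForm_nondegenerate (hσ : S.IsKirillovForm F σ) (q : S.Reduced F)
    (v : EuclideanSpace 𝕜 (Fin d)) (hv : ∀ w, reducedForm σ κ q v w = 0) : v = 0 := by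
  obtain ⟨f, rfl⟩ := κ.surjective q
  have hK := κ.contMDiff.hasDiffAt f
  rw [← diffAt_diffAt_symm hK v]
  refine (congrArg _ (hσ.nondegenerate f _ fun w => ?_)).trans (ContinuousLinearMap.map_zero _)
  refine Eq.trans (reducedForm_diffAt hK _ w).symm ?_
  rw [diffAt_diffAt_symm hK]
  exact hv _

theorem proj_smul_slice (hκ : ∀ f, κ f = S.proj F (S.slice F f)) (h : Gr) (f : S.Orbit F) :
    S.proj F (h • S.slice F f) = κ f :=
  ((toReduced_eq_iff _ _).2 ⟨h, rfl⟩).trans (hκ f).symm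

/-- In the coordinates `(g, f)` the quotient map is `baseProj`, so its smoothness and the pull-back
of the reduced form are checked on the orbit. -/
theorem proj_eq (hκ : ∀ f, κ f = S.proj F (S.slice F f))
    (hS : ∀ k : Gr, S.plus k = S.minus k → ∀ f : S.Orbit F, k • f = f) (z : S.Level F) :
    S.proj F z = κ (S.baseProj F (levelBase z)) := by
  obtain ⟨h, f, rfl, -⟩ := exists_smul_slice z
  rw [proj_smul_slice hκ, baseProj_smul_slice hS]

theorem IsLevelManifold.contMDiff_proj (hL : S.IsLevelManifold F (d := d) (a := a))
    (hO : S.IsOrbitManifold F (d := d)) (hκ : ∀ f, κ f = S.proj F (S.slice F f))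
    (hS : ∀ k : Gr, S.plus k = S.minus k → ∀ f : S.Orbit F, k • f = f) :
    ContMDiff 𝓘(𝕜, EuclideanSpace 𝕜 (Fin a)) 𝓘(𝕜, EuclideanSpace 𝕜 (Fin d)) ∞ (S.proj F) := by
  rw [funext (proj_eq hκ hS)]
  exact κ.contMDiff.comp (hL.contMDiff_baseProj hO hS)

theorem IsLevelManifold.isSymplecticReduction (hL : S.IsLevelManifold F (d := d) (a := a))
    (hO : S.IsOrbitManifold F (d := d)) (hσ : S.IsKirillovForm F σ)
    (hS : ∀ k : Gr, S.plus k = S.minus k → ∀ f : S.Orbit F, k • f = f)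
    (hκ : ∀ f, κ f = S.proj F (S.slice F f)) (ht2 : T2Space (S.Reduced F))
    (hR : IsManifold 𝓘(𝕜, EuclideanSpace 𝕜 (Fin d)) ∞ (S.Reduced F)) :
    IsSymplecticReduction (K := Gr) (phaseModel 𝕜 E d) (S.phaseForm σ) (S.bigCell F)
          (S.moment F) (a := a) (b := d) (reducedForm σ κ) where
  isOpen := isOpen_cell.preimage (continuous_fst.comp continuous_fst)
  invariant k m hm := mem_cell_smul k hm
  regular z := diffAt_moment_surjective hO z
  isManifold_level := hL.isManifold
  contMDiff_incl := hL.contMDiff_coe hO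
  immersion z := hL.diffAt_coe_injective ((hL.contMDiff_coe hO).hasDiffAt z)
  isManifold_reduced := hR
  t2_reduced := ht2
  contMDiff_proj := hL.contMDiff_proj hO hκ hS
  submersion z := by
    intro v
    have hp := (hL.contMDiff_proj hO hκ hS).hasDiffAt z
    obtain ⟨h, f, rfl, -⟩ := exists_smul_slice z
    have hK := κ.contMDiff.hasDiffAt f
    -- On the translate of the slice through `z` the projection is the diffeomorphism `κ`, so its
    -- differential at `z` is onto.
    have h1 := (hp.comp ((hL.contMDiff_smul_slice hO h).hasDiffAt f) rfl).unique
      (hK.congr (Eventually.of_forall fun y => proj_smul_slice hκ h y))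
    exact ⟨_, (DFunLike.congr_fun h1 _).trans (diffAt_diffAt_symm hK v)⟩
  pullback z v w := by
    have hp := (hL.contMDiff_baseProj hO hS).hasDiffAt z
    have hπ := ((κ.contMDiff.hasDiffAt _).comp hp rfl).congr
      (Eventually.of_forall (proj_eq hκ hS))
    have h1 := hL.phaseFormAt_eq hO hσ hS z ((hL.contMDiff_coe hO).hasDiffAt z) hp v w
    refine Eq.trans ?_ h1.symm
    refine Eq.trans ?_ (reducedForm_diffAt (κ.contMDiff.hasDiffAt _) _ _)
    refine (congrArg₂ (fun x y => reducedForm σ κ (S.proj F z) x y) (hπ.mfderiv_apply v)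
      (hπ.mfderiv_apply w)).trans ?_
    simp only [proj_eq hκ hS]
    rfl
  nondegenerate := reducedForm_nondegenerate hσ

end RSubgroup

/-! ### Polynomial functions and Casimir elements. -/

section Casimir

variable {𝕜 : Type*} [RCLike 𝕜] {E : Type*} [NormedAddCommGroup E] [NormedSpace 𝕜 E]

theorem polyFun_mul (x y : SymmetricAlgebra 𝕜 E) (ξ : E →L[𝕜] 𝕜) :
    polyFun (x * y) ξ = polyFun x ξ * polyFun y ξ := map_mul _ x y

theorem polyFun_add (x y : SymmetricAlgebra 𝕜 E) (ξ : E →L[𝕜] 𝕜) :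
    polyFun (x + y) ξ = polyFun x ξ + polyFun y ξ := map_add _ x y

theorem polyFun_ι (X : E) (ξ : E →L[𝕜] 𝕜) : polyFun (SymmetricAlgebra.ι 𝕜 E X) ξ = ξ X := by
  simp [polyFun]

theorem polyFun_algebraMap (c : 𝕜) (ξ : E →L[𝕜] 𝕜) :
    polyFun (algebraMap 𝕜 (SymmetricAlgebra 𝕜 E) c) ξ = c := by
  simp [polyFun]

theorem contDiff_polyFun (H : SymmetricAlgebra 𝕜 E) : ContDiff 𝕜 ∞ (polyFun H) := by
  induction H using SymmetricAlgebra.induction with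
  | algebraMap c => simpa only [funext (polyFun_algebraMap c)] using contDiff_const
  | ι X =>
    rw [funext (polyFun_ι X)]
    exact (ContinuousLinearMap.apply 𝕜 𝕜 X).contDiff
  | mul x y hx hy => simpa only [funext (polyFun_mul x y)] using hx.mul hy
  | add x y hx hy => simpa only [funext (polyFun_add x y)] using hx.add hy

variable {G : Type*} [TopologicalSpace G] [ChartedSpace E G] [Group G]
  [LieGroup 𝓘(𝕜, E) ∞ G] [CompleteSpace E]

variable (G) in
/-- The differential of a polynomial function on `𝔤*`, and the effect on it of the derivation of
`S(𝔤)` that extends `ad X`. -/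
theorem exists_diff_polyFun (H : SymmetricAlgebra 𝕜 E) : ∃ dH : (E →L[𝕜] 𝕜) → E, ∀ ξ,
    HasFDerivAt (polyFun H) (ContinuousLinearMap.apply 𝕜 𝕜 (dH ξ)) ξ ∧
    ∀ (X : E) (D : Derivation 𝕜 (SymmetricAlgebra 𝕜 E) (SymmetricAlgebra 𝕜 E)),
      (∀ Y : E, D (SymmetricAlgebra.ι 𝕜 E Y) = SymmetricAlgebra.ι 𝕜 E (lieBr 𝕜 G X Y)) →
      polyFun (D H) ξ = ξ (lieBr 𝕜 G X (dH ξ)) := by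
  simp only [← lieBrL_apply]
  induction H using SymmetricAlgebra.induction with
  | algebraMap c =>
    refine ⟨fun _ => 0, fun ξ => ⟨?_, fun X D hD => ?_⟩⟩
    · rw [map_zero, funext (polyFun_algebraMap c)]
      exact hasFDerivAt_const c ξ
    · rw [Derivation.map_algebraMap, map_zero, map_zero]
      exact map_zero _
  | ι X =>
    refine ⟨fun _ => X, fun ξ => ⟨?_, fun Z D hD => ?_⟩⟩
    · rw [funext (polyFun_ι X)]
      exact (ContinuousLinearMap.apply 𝕜 𝕜 X).hasFDerivAt
    · rw [hD, polyFun_ι]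
  | mul x y hx hy =>
    obtain ⟨dx, hx⟩ := hx
    obtain ⟨dy, hy⟩ := hy
    refine ⟨fun ξ => polyFun x ξ • dy ξ + polyFun y ξ • dx ξ, fun ξ => ⟨?_, fun X D hD => ?_⟩⟩
    · rw [map_add, map_smul, map_smul, funext (polyFun_mul x y)]
      exact (hx ξ).1.mul (hy ξ).1
    · rw [Derivation.leibniz, smul_eq_mul, smul_eq_mul, polyFun_add, polyFun_mul, polyFun_mul,
        (hx ξ).2 X D hD, (hy ξ).2 X D hD]
      simp
  | add x y hx hy =>
    obtain ⟨dx, hx⟩ := hx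
    obtain ⟨dy, hy⟩ := hy
    refine ⟨fun ξ => dx ξ + dy ξ, fun ξ => ⟨?_, fun X D hD => ?_⟩⟩
    · rw [map_add, funext (polyFun_add x y)]
      exact (hx ξ).1.add (hy ξ).1
    · rw [map_add, polyFun_add, (hx ξ).2 X D hD, (hy ξ).2 X D hD, map_add, map_add]

/-- Evaluating `D H = 0` at `ξ`, where `D` extends `ad X`, gives `ξ [X, dH ξ] = 0`. Only this
infinitesimal form of invariance is used afterwards. -/
theorem IsCasimir.exists_diff {H : SymmetricAlgebra 𝕜 E} (hH : IsCasimir 𝕜 G H) :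
    ∃ dH : (E →L[𝕜] 𝕜) → E,
      (∀ ξ, HasFDerivAt (polyFun H) (ContinuousLinearMap.apply 𝕜 𝕜 (dH ξ)) ξ) ∧
      ∀ (ξ : E →L[𝕜] 𝕜) (X : E), ξ (lieBr 𝕜 G (dH ξ) X) = 0 := by
  obtain ⟨dH, h⟩ := exists_diff_polyFun G H
  refine ⟨dH, fun ξ => (h ξ).1, fun ξ X => ?_⟩
  obtain ⟨D, hD, hDH⟩ := hH X
  rw [lieBr_skew, map_neg, ← (h ξ).2 X D hD, hDH, neg_eq_zero]
  exact map_zero _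

/-- A Casimir element is invariant under the coadjoint action. -/
theorem IsCasimir.polyFun_coAd [PreconnectedSpace G] {H : SymmetricAlgebra 𝕜 E}
    (hH : IsCasimir 𝕜 G H) (g : G) (ξ : E →L[𝕜] 𝕜) : polyFun H (coAd g ξ) = polyFun H ξ := by
  obtain ⟨dH, h1, h2⟩ := hH.exists_diff
  have h3 : coAd (1 : G) ξ = ξ := by
    ext X
    simp [coAd, Ad_one]
  conv_rhs => rw [← h3]
  refine eq_of_hasDiffAt_zero (𝕜 := 𝕜) (E := E) (f := fun g : G => polyFun H (coAd g ξ))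
    (fun g => ?_) g 1
  have hc : ContMDiff 𝓘(𝕜, E) 𝓘(𝕜, E →L[𝕜] 𝕜) ∞ fun g : G => coAd g ξ :=
    contMDiff_coAd.comp (contMDiff_id.prodMk contMDiff_const)
  refine ((h1 (coAd g ξ)).hasDiffAt.comp (hc.hasDiffAt g) rfl).congr_deriv fun v => ?_
  have h4 := DFunLike.congr_fun ((((ContinuousLinearMap.apply 𝕜 𝕜 (dH (coAd g ξ))).hasDiffAt
    _).comp (hc.hasDiffAt g) rfl).unique
      ((ξ.hasDiffAt _).comp (hasDiffAt_Ad_inv_apply g (dH (coAd g ξ))) rfl)) v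
  refine h4.trans ?_
  -- With this choice of vector, `Ad g⁻¹` cancels `Ad g` and the identity becomes the vanishing of
  -- the derivative along `v`.
  have h5 := h2 (coAd g ξ) (Ad 𝕜 E g (leftTriv 𝕜 E g v))
  rw [lieBr_skew, map_neg, neg_eq_zero] at h5
  change ξ (Ad 𝕜 E g⁻¹ _) = 0 at h5
  rw [Ad_lieBr, Ad_inv_Ad] at h5
  simp [lieBrL_apply, h5]

/-- Since `r₊ - r₋ = id`, the action on the unit gives back `x`. Thus `i_r` changes only the Lie
algebra whose Poisson bracket is meant, not the polynomial. -/
theorem iR_eq (r : E →L[𝕜] E) (H : SymmetricAlgebra 𝕜 E) : iR r H = H := by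
  refine (LinearEquiv.symm_apply_eq _).2 ?_
  rw [LinearEquiv.ofBijective_apply, symAct_one, LinearMap.id_apply]

end Casimir

/-! ### Hamiltonian fields of Casimir elements, their projection, and the Lax equation. -/

namespace RSubgroup

variable {𝕜 : Type*} [RCLike 𝕜] {E : Type*} [NormedAddCommGroup E] [NormedSpace 𝕜 E]
  {G : Type*} [TopologicalSpace G] [ChartedSpace E G] [Group G] {r : E →L[𝕜] E}
  {E' : Type*} [NormedAddCommGroup E'] [NormedSpace 𝕜 E']
  {Gr : Type*} [TopologicalSpace Gr] [ChartedSpace E' Gr] [Group Gr]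
  {S : RSubgroup G r E' Gr} {F : E →L[𝕜] 𝕜} [LieGroup 𝓘(𝕜, E') ∞ Gr] [LieGroup 𝓘(𝕜, E) ∞ G]
  {d : ℕ} [ChartedSpace (EuclideanSpace 𝕜 (Fin d)) (S.Orbit F)] [FiniteDimensional 𝕜 E]
  [CompleteSpace E']
  {a : ℕ} [ChartedSpace (EuclideanSpace 𝕜 (Fin a)) (S.Level F)]
  {σ : ∀ f : S.Orbit F, LinearMap.BilinForm 𝕜
    (TangentSpace 𝓘(𝕜, EuclideanSpace 𝕜 (Fin d)) f)}
  {H : SymmetricAlgebra 𝕜 E} {dH : (E →L[𝕜] 𝕜) → E}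

/-- The Hamiltonian vector field on the phase space of a Casimir element with differential `dH`. -/
def casimirVec (d : ℕ) (dH : (E →L[𝕜] 𝕜) → E) (m : (G × (E →L[𝕜] 𝕜)) × S.Orbit F) :
    (E × (E →L[𝕜] 𝕜)) × EuclideanSpace 𝕜 (Fin d) :=
  ((leftTrans 𝕜 E m.1.1 (dH m.1.2), 0), 0)

variable (F) in
/-- The Hamiltonian vector field on the orbit of a function with differential `dH`. -/
def orbitVec (S : RSubgroup G r E' Gr) [ChartedSpace (EuclideanSpace 𝕜 (Fin d)) (S.Orbit F)]
    (dH : (E →L[𝕜] 𝕜) → E) (f : S.Orbit F) : EuclideanSpace 𝕜 (Fin d) :=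
  -S.fundVecL F f (dH f.1)

theorem hasDiffAt_polyFun_phase
    (hdH : ∀ ξ, HasFDerivAt (polyFun H) (ContinuousLinearMap.apply 𝕜 𝕜 (dH ξ)) ξ)
    (m : (G × (E →L[𝕜] 𝕜)) × S.Orbit F) :
    ∃ A : (E × (E →L[𝕜] 𝕜)) × EuclideanSpace 𝕜 (Fin d) →L[𝕜] 𝕜, HasDiffAt (phaseModel 𝕜 E d) 𝓘(𝕜, 𝕜)
      (fun m : (G × (E →L[𝕜] 𝕜)) × S.Orbit F => polyFun H m.1.2) m A ∧
      ∀ w, A w = w.1.2 (dH m.1.2) := by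
  have hm := hasDiffAt_fst (I₁ := 𝓘(𝕜, E).prod 𝓘(𝕜, E →L[𝕜] 𝕜))
    (I₂ := 𝓘(𝕜, EuclideanSpace 𝕜 (Fin d))) m
  exact ⟨_, (hdH m.1.2).hasDiffAt.comp ((hasDiffAt_snd (I₁ := 𝓘(𝕜, E))
    (I₂ := 𝓘(𝕜, E →L[𝕜] 𝕜)) m.1).comp hm rfl) rfl, fun w => rfl⟩

/-- The Casimir identity kills the bracket term of the cotangent form, so only the derivative along
the fibre remains. The minus sign in front of the cotangent form makes the velocity of `g` equal to
`dH ξ` without a sign. -/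
theorem phaseFormAt_casimirVec
    (hC : ∀ (ξ : E →L[𝕜] 𝕜) (X : E), ξ (lieBr 𝕜 G (dH ξ) X) = 0)
    (m : (G × (E →L[𝕜] 𝕜)) × S.Orbit F) (w : (E × (E →L[𝕜] 𝕜)) × EuclideanSpace 𝕜 (Fin d)) :
    phaseFormAt σ m w (casimirVec d dH m) = w.1.2 (dH m.1.2) := by
  have h := hC m.1.2 (leftTriv 𝕜 E m.1.1 w.1.1)
  rw [lieBr_skew, map_neg, neg_eq_zero] at h
  simp [phaseFormAt, casimirVec, cotForm, leftTriv_leftTrans, h]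

theorem isHamiltonianField_casimirVec
    (hdH : ∀ ξ, HasFDerivAt (polyFun H) (ContinuousLinearMap.apply 𝕜 𝕜 (dH ξ)) ξ)
    (hC : ∀ (ξ : E →L[𝕜] 𝕜) (X : E), ξ (lieBr 𝕜 G (dH ξ) X) = 0) :
    IsHamiltonianField (phaseModel 𝕜 E d) (S.phaseForm σ)
      (fun m : (G × (E →L[𝕜] 𝕜)) × S.Orbit F => polyFun H m.1.2) (casimirVec d dH) := by
  intro m w
  obtain ⟨A, hA, hAw⟩ := hasDiffAt_polyFun_phase (d := d) hdH m
  exact (hA.mfderiv_apply w).trans ((hAw w).trans (phaseFormAt_casimirVec hC m w).symm)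

theorem hasDiffAt_polyFun_orbit (hO : S.IsOrbitManifold F (d := d))
    (hdH : ∀ ξ, HasFDerivAt (polyFun H) (ContinuousLinearMap.apply 𝕜 𝕜 (dH ξ)) ξ)
    (f : S.Orbit F) :
    HasDiffAt 𝓘(𝕜, EuclideanSpace 𝕜 (Fin d)) 𝓘(𝕜, 𝕜) (fun f : S.Orbit F => polyFun H f.1) f
      ((ContinuousLinearMap.apply 𝕜 𝕜 (dH f.1)).comp (S.coeL F f)) :=
  (hdH f.1).hasDiffAt.comp (hO.hasDiffAt_coe f) rfl

theorem formAt_orbitVec (hO : S.IsOrbitManifold F (d := d)) (hσ : S.IsKirillovForm F σ)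
    (f : S.Orbit F) (w : EuclideanSpace 𝕜 (Fin d)) :
    formAt σ f w (S.orbitVec F dH f) = S.coeL F f w (dH f.1) := by
  have : CompleteSpace E := FiniteDimensional.complete 𝕜 E
  rw [hσ.skew hO, orbitVec, map_neg, LinearMap.neg_apply, neg_neg, hσ.formAt_fundVecL_left hO]

theorem isHamiltonianField_orbitVec (hO : S.IsOrbitManifold F (d := d))
    (hσ : S.IsKirillovForm F σ)
    (hdH : ∀ ξ, HasFDerivAt (polyFun H) (ContinuousLinearMap.apply 𝕜 𝕜 (dH ξ)) ξ) :
    IsHamiltonianField 𝓘(𝕜, EuclideanSpace 𝕜 (Fin d)) (fun f v w => σ f v w)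
      (fun f : S.Orbit F => polyFun H f.1) (S.orbitVec F dH) := fun f w =>
  ((hasDiffAt_polyFun_orbit hO hdH f).mfderiv_apply w).trans
    (formAt_orbitVec hO hσ f w).symm

section

variable [ChartedSpace (EuclideanSpace 𝕜 (Fin d)) (S.Reduced F)]
  {κ : S.Orbit F ≃ₘ^∞⟮𝓘(𝕜, EuclideanSpace 𝕜 (Fin d)), 𝓘(𝕜, EuclideanSpace 𝕜 (Fin d))⟯
    S.Reduced F}

/-- The Hamiltonian vector field on the reduced space of a function with differential `dH`. -/
def orbitVecReduced
    (κ : S.Orbit F ≃ₘ^∞⟮𝓘(𝕜, EuclideanSpace 𝕜 (Fin d)), 𝓘(𝕜, EuclideanSpace 𝕜 (Fin d))⟯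
      S.Reduced F) (dH : (E →L[𝕜] 𝕜) → E) (q : S.Reduced F) : EuclideanSpace 𝕜 (Fin d) :=
  diffAt 𝓘(𝕜, EuclideanSpace 𝕜 (Fin d)) 𝓘(𝕜, EuclideanSpace 𝕜 (Fin d)) κ (κ.symm q)
    (S.orbitVec F dH (κ.symm q))

theorem orbitVecReduced_apply (f : S.Orbit F) :
    orbitVecReduced κ dH (κ f) = diffAt 𝓘(𝕜, EuclideanSpace 𝕜 (Fin d))
      𝓘(𝕜, EuclideanSpace 𝕜 (Fin d)) κ f (S.orbitVec F dH f) := by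
  rw [orbitVecReduced, κ.symm_apply_apply]

/-- The function, the field and the form are all carried over from the orbit by `κ`. -/
theorem isHamiltonianField_orbitVecReduced (hO : S.IsOrbitManifold F (d := d))
    (hσ : S.IsKirillovForm F σ)
    (hdH : ∀ ξ, HasFDerivAt (polyFun H) (ContinuousLinearMap.apply 𝕜 𝕜 (dH ξ)) ξ) :
    IsHamiltonianField 𝓘(𝕜, EuclideanSpace 𝕜 (Fin d)) (fun q v w => reducedForm σ κ q v w)
      (fun q : S.Reduced F => polyFun H (κ.symm q).1) (orbitVecReduced κ dH) := by
  intro q w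
  obtain ⟨f, rfl⟩ := κ.surjective q
  have hK := κ.contMDiff.hasDiffAt f
  refine (((hasDiffAt_polyFun_orbit hO hdH f).comp (κ.symm.contMDiff.hasDiffAt (κ f))
    (κ.symm_apply_apply f)).mfderiv_apply w).trans ?_
  refine (formAt_orbitVec hO hσ f _).symm.trans ((reducedForm_diffAt hK _ _).symm.trans ?_)
  rw [← orbitVecReduced_apply]
  exact congrArg (fun x => reducedForm σ κ (κ f) x _) (diffAt_diffAt_symm hK w)

end

namespace IsLevelManifold

theorem diffAt_levelBase_surjective (hL : S.IsLevelManifold F (d := d) (a := a)) (z : S.Level F) :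
    Function.Surjective (diffAt 𝓘(𝕜, EuclideanSpace 𝕜 (Fin a))
      (𝓘(𝕜, E).prod 𝓘(𝕜, EuclideanSpace 𝕜 (Fin d))) levelBase z) := by
  obtain ⟨s, h1, h2⟩ := hL.exists_inverse
  have hopen : IsOpen {p : G × S.Orbit F | p.1 ∈ S.cell} := isOpen_cell.preimage continuous_fst
  have h3 : (fun p : G × S.Orbit F => levelBase (s p)) =ᶠ[𝓝 (levelBase z)] fun p => p := by
    filter_upwards [hopen.mem_nhds (x := levelBase z) z.2.1] with p hp
    obtain ⟨z', rfl⟩ := range_levelBase.symm.subset hp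
    rw [h1]
  have h4 := ((hL.contMDiff_levelBase.hasDiffAt z).comp
    (h2.contMDiffAt (hopen.mem_nhds (x := levelBase z) z.2.1)).hasDiffAt (h1 z)).unique
    ((hasDiffAt_id _).congr h3)
  exact fun v => ⟨_, DFunLike.congr_fun h4 v⟩

/-- The Hamiltonian vector field of a Casimir element is tangent to the zero level. -/
theorem exists_tangent (hL : S.IsLevelManifold F (d := d) (a := a))
    (hO : S.IsOrbitManifold F (d := d)) (hC : ∀ (ξ : E →L[𝕜] 𝕜) (X : E), ξ (lieBr 𝕜 G (dH ξ) X) = 0) (z : S.Level F)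
    {ι} (hι : HasDiffAt 𝓘(𝕜, EuclideanSpace 𝕜 (Fin a)) (phaseModel 𝕜 E d)
      (Subtype.val : S.Level F → _) z ι) :
    ∃ u : EuclideanSpace 𝕜 (Fin a), ι u = casimirVec d dH z.1 := by
  have : CompleteSpace E := FiniteDimensional.complete 𝕜 E
  -- The vector is prescribed in the coordinates `(g, f)`. Its `ξ`-component is then forced: the
  -- differential of `J` vanishes on it, the bracket term is zero by the Casimir identity, and the
  -- cell operator is invertible.
  obtain ⟨u, hu⟩ := hL.diffAt_levelBase_surjective z
    (leftTrans 𝕜 E z.1.1.1 (dH z.1.1.2), 0)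
  rw [diffAt_levelBase_eq hι, Prod.mk.injEq] at hu
  refine ⟨u, Prod.ext (Prod.ext hu.1 ?_) hu.2⟩
  have hJ : diffAt (phaseModel 𝕜 E d) 𝓘(𝕜, E →L[𝕜] 𝕜) (S.moment F) z.1 (ι u) = 0 :=
    DFunLike.congr_fun ((((contMDiff_moment hO).hasDiffAt z.1).comp hι rfl).unique
      ((hasDiffAt_const z (0 : E →L[𝕜] 𝕜)).congr (Eventually.of_forall fun y => y.2.2))) u
  obtain ⟨T, hT⟩ := S.exists_cellOp_equiv z.2.1
  change (ι u).1.2 = 0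
  ext Y
  have h := DFunLike.congr_fun hJ (T.symm Y)
  rw [diffAt_moment_apply hO, ← cellOp_apply, hT, hu.1, hu.2, leftTriv_leftTrans, hC] at h
  simpa using h

/-- The Kirillov form pulls back to the restricted form upstairs and the function on the orbit to
the one upstairs. Both vectors therefore have the same pairing with every projected vector. These
fill the tangent space of the orbit, and nondegeneracy gives equality. -/
theorem diffAt_baseProj_tangent (hL : S.IsLevelManifold F (d := d) (a := a))
    (hO : S.IsOrbitManifold F (d := d)) (hσ : S.IsKirillovForm F σ)
    (hS : ∀ k : Gr, S.plus k = S.minus k → ∀ f : S.Orbit F, k • f = f)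
    (hdH : ∀ ξ, HasFDerivAt (polyFun H) (ContinuousLinearMap.apply 𝕜 𝕜 (dH ξ)) ξ)
    (hC : ∀ (ξ : E →L[𝕜] 𝕜) (X : E), ξ (lieBr 𝕜 G (dH ξ) X) = 0)
    (hH : ∀ z : S.Level F, polyFun H (S.baseProj F (levelBase z)).1 = polyFun H z.1.1.2)
    (z : S.Level F) {ι p}
    (hι : HasDiffAt 𝓘(𝕜, EuclideanSpace 𝕜 (Fin a)) (phaseModel 𝕜 E d)
      (Subtype.val : S.Level F → _) z ι)
    (hp : HasDiffAt 𝓘(𝕜, EuclideanSpace 𝕜 (Fin a)) 𝓘(𝕜, EuclideanSpace 𝕜 (Fin d))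
      (fun z : S.Level F => S.baseProj F (levelBase z)) z p) {u : EuclideanSpace 𝕜 (Fin a)}
    (hu : ι u = casimirVec d dH z.1) :
    p u = S.orbitVec F dH (S.baseProj F (levelBase z)) := by
  have : CompleteSpace E := FiniteDimensional.complete 𝕜 E
  rw [← sub_eq_zero]
  refine hσ.nondegenerate (S.baseProj F (levelBase z)) _ fun w => ?_
  obtain ⟨v, rfl⟩ : ∃ v, p v = w := by
    obtain ⟨h, f, rfl, -⟩ := exists_smul_slice z
    have h1 := (hp.comp ((hL.contMDiff_smul_slice hO h).hasDiffAt f) rfl).unique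
      ((hasDiffAt_id f).congr (Eventually.of_forall fun y => baseProj_smul_slice hS h y))
    exact ⟨_, DFunLike.congr_fun h1 w⟩
  change formAt σ _ (p u - S.orbitVec F dH _) (p v) = 0
  rw [hσ.skew hO, neg_eq_zero, map_sub, sub_eq_zero, ← hL.phaseFormAt_eq hO hσ hS z hι hp, hu,
    phaseFormAt_casimirVec hC, formAt_orbitVec hO hσ]
  obtain ⟨A, hA, hAw⟩ := hasDiffAt_polyFun_phase (d := d) hdH z.1
  have h2 := (hA.comp hι rfl).unique (((hasDiffAt_polyFun_orbit hO hdH _).comp hp rfl).congr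
    (Eventually.of_forall fun z => (hH z).symm))
  exact (hAw (ι v)).symm.trans (DFunLike.congr_fun h2 v)

/-- Curves in the zero level with the velocity of a Casimir element project to curves in the
orbit. -/
theorem hasVelocityAt_baseProj (hL : S.IsLevelManifold F (d := d) (a := a))
    (hO : S.IsOrbitManifold F (d := d)) (hσ : S.IsKirillovForm F σ)
    (hS : ∀ k : Gr, S.plus k = S.minus k → ∀ f : S.Orbit F, k • f = f)
    (hdH : ∀ ξ, HasFDerivAt (polyFun H) (ContinuousLinearMap.apply 𝕜 𝕜 (dH ξ)) ξ)
    (hC : ∀ (ξ : E →L[𝕜] 𝕜) (X : E), ξ (lieBr 𝕜 G (dH ξ) X) = 0)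
    (hH : ∀ z : S.Level F, polyFun H (S.baseProj F (levelBase z)).1 = polyFun H z.1.1.2)
    (c : 𝕜 → S.Level F) (t : 𝕜)
    (hc : HasDiffAt 𝓘(𝕜, 𝕜) (phaseModel 𝕜 E d) (fun s => (c s).1) t
      ((1 : 𝕜 →L[𝕜] 𝕜).smulRight (casimirVec d dH (c t).1))) :
    HasDiffAt 𝓘(𝕜, 𝕜) 𝓘(𝕜, EuclideanSpace 𝕜 (Fin d))
      (fun s => S.baseProj F (levelBase (c s))) t
      ((1 : 𝕜 →L[𝕜] 𝕜).smulRight (S.orbitVec F dH (S.baseProj F (levelBase (c t))))) := by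
  have hm := hasDiffAt_fst (I₁ := 𝓘(𝕜, E).prod 𝓘(𝕜, E →L[𝕜] 𝕜))
    (I₂ := 𝓘(𝕜, EuclideanSpace 𝕜 (Fin d))) (c t).1
  have h1 := ((hasDiffAt_fst (I₁ := 𝓘(𝕜, E)) (I₂ := 𝓘(𝕜, E →L[𝕜] 𝕜)) (c t).1.1).comp hm
    rfl).prodMk (hasDiffAt_snd (I₁ := 𝓘(𝕜, E).prod 𝓘(𝕜, E →L[𝕜] 𝕜))
    (I₂ := 𝓘(𝕜, EuclideanSpace 𝕜 (Fin d))) (c t).1)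
  -- `baseProj` is smooth near the pair `(g, f)` regardless of `ξ`, so the curve need only be
  -- differentiable in the phase space, not as a map to the level.
  have h2 := (contMDiffAt_baseProj (p := levelBase (c t)) hS hO (c t).2.1).hasDiffAt.comp h1 rfl
  have hι := (hL.contMDiff_coe hO).hasDiffAt (c t)
  obtain ⟨u, hu⟩ := hL.exists_tangent hO hC (c t) hι
  have hp := h2.comp hι rfl
  have h3 := hL.diffAt_baseProj_tangent hO hσ hS hdH hC hH (c t) hι hp hu
  refine (h2.comp hc rfl).congr_deriv fun s => ?_
  rw [ContinuousLinearMap.comp_apply, ContinuousLinearMap.smulRight_apply,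
    ContinuousLinearMap.smulRight_apply, map_smul, ← hu, ← h3]
  rfl

end IsLevelManifold

/-- In `f [dH f, Y]_r` the term `f [dH f, rY]` vanishes, leaving `f [r (dH f), Y] / 2`. Adding or
subtracting `f [dH f, Y] / 2 = 0` replaces `r / 2` by `r₊` or `r₋`. -/
theorem IsOrbitManifold.coeL_orbitVec (hO : S.IsOrbitManifold F (d := d))
    (hC : ∀ (ξ : E →L[𝕜] 𝕜) (X : E), ξ (lieBr 𝕜 G (dH ξ) X) = 0) {A : E →L[𝕜] E} (hA : A = rPlus r ∨ A = rMinus r)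
    (f : S.Orbit F) (Y : E) :
    S.coeL F (d := d) f (S.orbitVec F dH f) Y = f.1 (lieBr 𝕜 G (A (dH f.1)) Y) := by
  have : CompleteSpace E := FiniteDimensional.complete 𝕜 E
  rw [orbitVec, map_neg, hO.coeL_fundVecL, neg_apply, coadr_apply, neg_neg, rBr]
  rcases hA with rfl | rfl
  · simp [rPlus, lieBr_smul_left, lieBr_add_left, hC]
  · simp [rMinus, lieBr_smul_left, lieBr_sub_left, hC]

/-- The velocity of the flow on the orbit, regarded as a flow in `𝔤_r*`. -/
theorem IsOrbitManifold.hasDerivAt_coe (hO : S.IsOrbitManifold F (d := d)) {γ : 𝕜 → S.Orbit F}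
    {t : 𝕜} {v : EuclideanSpace 𝕜 (Fin d)}
    (hγ : HasDiffAt 𝓘(𝕜, 𝕜) 𝓘(𝕜, EuclideanSpace 𝕜 (Fin d)) γ t
      ((1 : 𝕜 →L[𝕜] 𝕜).smulRight v)) :
    HasDerivAt (fun s => (γ s).1) (S.coeL F (γ t) v) t := by
  have h := ((hO.hasDiffAt_coe (γ t)).comp hγ rfl).hasFDerivAt.hasDerivAt
  simpa using h

/-- The Lax equation. -/
theorem IsOrbitManifold.lax (hO : S.IsOrbitManifold F (d := d))
    (hC : ∀ (ξ : E →L[𝕜] 𝕜) (X : E), ξ (lieBr 𝕜 G (dH ξ) X) = 0) {A : E →L[𝕜] E} (hA : A = rPlus r ∨ A = rMinus r)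
    {γ : 𝕜 → S.Orbit F} {t : 𝕜}
    (hγ : HasDiffAt 𝓘(𝕜, 𝕜) 𝓘(𝕜, EuclideanSpace 𝕜 (Fin d)) γ t
      ((1 : 𝕜 →L[𝕜] 𝕜).smulRight (S.orbitVec F dH (γ t)))) (Y : E) :
    HasDerivAt (fun s => (γ s).1 Y) ((γ t).1 (lieBr 𝕜 G (A (dH (γ t).1)) Y)) t := by
  rw [← hO.coeL_orbitVec hC hA (γ t) Y]
  exact ((ContinuousLinearMap.apply 𝕜 𝕜 Y).hasFDerivAt.comp_hasDerivAt t (hO.hasDerivAt_coe hγ))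

/-- The Lax equation in the Lie algebra, for an invariant bilinear form. -/
theorem IsOrbitManifold.exists_lax (hO : S.IsOrbitManifold F (d := d))
    (hC : ∀ (ξ : E →L[𝕜] 𝕜) (X : E), ξ (lieBr 𝕜 G (dH ξ) X) = 0) {A : E →L[𝕜] E} (hA : A = rPlus r ∨ A = rMinus r)
    {B : LinearMap.BilinForm 𝕜 E} (hB : B.Nondegenerate)
    (hinv : ∀ X Y Z : E, B (lieBr 𝕜 G X Y) Z = B X (lieBr 𝕜 G Y Z)) :
    ∃ L : (E →L[𝕜] 𝕜) ≃L[𝕜] E, (∀ ξ Y, B (L ξ) Y = ξ Y) ∧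
      ∀ (γ : 𝕜 → S.Orbit F) (t : 𝕜), HasDiffAt 𝓘(𝕜, 𝕜) 𝓘(𝕜, EuclideanSpace 𝕜 (Fin d)) γ t
        ((1 : 𝕜 →L[𝕜] 𝕜).smulRight (S.orbitVec F dH (γ t))) →
        HasDerivAt (fun s => L (γ s).1) (lieBr 𝕜 G (L (γ t).1) (A (dH (γ t).1))) t := by
  let L : (E →L[𝕜] 𝕜) ≃L[𝕜] E := ((LinearMap.toContinuousLinearMap (𝕜 := 𝕜) (E := E)
    (F' := 𝕜)).symm.trans (B.toDual hB).symm).toContinuousLinearEquiv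
  have hL : ∀ ξ Y, B (L ξ) Y = ξ Y := fun ξ Y =>
    LinearMap.BilinForm.apply_toDual_symm_apply (hB := hB) _ Y
  refine ⟨L, hL, fun γ t hγ => ?_⟩
  have h1 := L.toContinuousLinearMap.hasFDerivAt.comp_hasDerivAt t (hO.hasDerivAt_coe hγ)
  have h2 : L (S.coeL F (d := d) (γ t) (S.orbitVec F dH (γ t)))
      = lieBr 𝕜 G (L (γ t).1) (A (dH (γ t).1)) := by
    -- The velocity is compared after pairing with `Y`, where invariance of `B` turns `[L, M]` into
    -- `f [M, Y]`.
    refine (B.toDual hB).injective (LinearMap.ext fun Y => ?_)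
    rw [LinearMap.BilinForm.toDual_def, LinearMap.BilinForm.toDual_def, hL, hinv, hL,
      hO.coeL_orbitVec hC hA]
  rw [← h2]
  exact h1

end RSubgroup

end

end Development

/-! ### The reduction theorem. -/

theorem mainTheorem7 {𝕜 : Type*} [RCLike 𝕜]
    {E : Type*} [NormedAddCommGroup E] [NormedSpace 𝕜 E] [FiniteDimensional 𝕜 E]
    {G : Type*} [TopologicalSpace G] [ChartedSpace E G] [Group G] [LieGroup 𝓘(𝕜, E) ∞ G]
    {E' : Type*} [NormedAddCommGroup E'] [NormedSpace 𝕜 E']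
    {Gr : Type*} [TopologicalSpace Gr] [ChartedSpace E' Gr] [Group Gr]
    [LieGroup 𝓘(𝕜, E') ∞ Gr]
    (r : E →L[𝕜] E) (hr : ModifiedCYBE 𝕜 G r) (S : RSubgroup G r E' Gr) (F : E →L[𝕜] 𝕜)
    -- the factorization `h₊ h₋⁻¹` is unique, up to elements acting trivially on the orbit
    (hS : ∀ k : Gr, S.plus k = S.minus k → ∀ f : S.Orbit F, k • f = f) :
    -- the orbit as a symplectic manifold
    ∃ (d : ℕ) (_ : ChartedSpace (EuclideanSpace 𝕜 (Fin d)) (S.Orbit F))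
      (ωO : ∀ f : S.Orbit F, LinearMap.BilinForm 𝕜
        (TangentSpace 𝓘(𝕜, EuclideanSpace 𝕜 (Fin d)) f)),
      S.IsOrbitManifold F (d := d) ∧ S.IsKirillovForm F ωO ∧
      -- the Hamiltonian action on `T*G × 𝒪_F`
      IsHamiltonianAction (K := Gr) (phaseModel 𝕜 E d) (S.phaseForm ωO) S.lie S.coAdr
        (S.moment F) ∧
      -- the reduced symplectic manifold
      ∃ (a b : ℕ)
        (_ : ChartedSpace (EuclideanSpace 𝕜 (Fin a)) (ZeroLevel (S.bigCell F) (S.moment F)))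
        (_ : ChartedSpace (EuclideanSpace 𝕜 (Fin b))
          (ReducedSpace Gr (S.bigCell F) (S.moment F)))
        (ωR : ∀ q : ReducedSpace Gr (S.bigCell F) (S.moment F), LinearMap.BilinForm 𝕜
          (TangentSpace 𝓘(𝕜, EuclideanSpace 𝕜 (Fin b)) q)),
        IsSymplecticReduction (K := Gr) (phaseModel 𝕜 E d) (S.phaseForm ωO) (S.bigCell F)
          (S.moment F) (a := a) ωR ∧
        -- (i) the canonical symplectomorphism `f ↦ [(1, f, f)]`
        ∃ κ : S.Orbit F ≃ₘ^∞⟮𝓘(𝕜, EuclideanSpace 𝕜 (Fin d)), 𝓘(𝕜, EuclideanSpace 𝕜 (Fin b))⟯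
            ReducedSpace Gr (S.bigCell F) (S.moment F),
          (∀ f, κ f = toReduced Gr (S.bigCell F) (S.moment F) (S.slice F f)) ∧
          (∀ (f : S.Orbit F) (v w : TangentSpace 𝓘(𝕜, EuclideanSpace 𝕜 (Fin d)) f),
            ωR (κ f)
              (mfderiv 𝓘(𝕜, EuclideanSpace 𝕜 (Fin d)) 𝓘(𝕜, EuclideanSpace 𝕜 (Fin b)) κ f v)
              (mfderiv 𝓘(𝕜, EuclideanSpace 𝕜 (Fin d)) 𝓘(𝕜, EuclideanSpace 𝕜 (Fin b)) κ f w)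
            = ωO f v w) ∧
          -- (ii) Casimir elements
          (ConnectedSpace G → ∀ H : SymmetricAlgebra 𝕜 E, IsCasimir 𝕜 G H →
            -- the extension of `H` to `T*G` is bi-invariant
            (∀ (h h' : G) (p : G × (E →L[𝕜] 𝕜)),
              polyFun H (cotAct h h' p).2 = polyFun H p.2) ∧
            -- it admits reduction, and the reduced Hamiltonian is `i_r(H)` on the orbit
            ∃ Hred : ReducedSpace Gr (S.bigCell F) (S.moment F) → 𝕜,
              ContMDiff 𝓘(𝕜, EuclideanSpace 𝕜 (Fin b)) 𝓘(𝕜, 𝕜) ∞ Hred ∧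
              (∀ z : ZeroLevel (S.bigCell F) (S.moment F),
                Hred (toReduced Gr (S.bigCell F) (S.moment F) z) = polyFun H z.1.1.2) ∧
              (∀ f : S.Orbit F, Hred (κ f) = polyFun (iR r H) f.1) ∧
              -- the Hamiltonian vector fields upstairs, on the reduced space, on the orbit
              ∃ (XM : ∀ m : (G × (E →L[𝕜] 𝕜)) × S.Orbit F,
                  TangentSpace (phaseModel 𝕜 E d) m)
                (XR : ∀ q : ReducedSpace Gr (S.bigCell F) (S.moment F),
                  TangentSpace 𝓘(𝕜, EuclideanSpace 𝕜 (Fin b)) q)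
                (XO : ∀ f : S.Orbit F, TangentSpace 𝓘(𝕜, EuclideanSpace 𝕜 (Fin d)) f),
                IsHamiltonianField (phaseModel 𝕜 E d) (S.phaseForm ωO)
                  (fun m => polyFun H m.1.2) XM ∧
                IsHamiltonianField 𝓘(𝕜, EuclideanSpace 𝕜 (Fin b)) (fun q v w => ωR q v w)
                  Hred XR ∧
                IsHamiltonianField 𝓘(𝕜, EuclideanSpace 𝕜 (Fin d)) (fun f v w => ωO f v w)
                  (fun f => polyFun (iR r H) f.1) XO ∧
                -- the flow upstairs is tangent to the zero level and descends to the quotient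
                (∀ z : ZeroLevel (S.bigCell F) (S.moment F),
                  ∃ u : TangentSpace 𝓘(𝕜, EuclideanSpace 𝕜 (Fin a)) z,
                    mfderiv 𝓘(𝕜, EuclideanSpace 𝕜 (Fin a)) (phaseModel 𝕜 E d)
                      (Subtype.val : ZeroLevel (S.bigCell F) (S.moment F) → _) z u = XM z.1 ∧
                    mfderiv 𝓘(𝕜, EuclideanSpace 𝕜 (Fin a)) 𝓘(𝕜, EuclideanSpace 𝕜 (Fin b))
                      (toReduced Gr (S.bigCell F) (S.moment F)) z u
                      = XR (toReduced Gr (S.bigCell F) (S.moment F) z)) ∧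
                (∀ f : S.Orbit F,
                  mfderiv 𝓘(𝕜, EuclideanSpace 𝕜 (Fin d)) 𝓘(𝕜, EuclideanSpace 𝕜 (Fin b)) κ f
                    (XO f) = XR (κ f)) ∧
                (∀ (c : 𝕜 → ZeroLevel (S.bigCell F) (S.moment F)) (t : 𝕜),
                  HasVelocityAt (phaseModel 𝕜 E d) XM (fun s => (c s).1) t →
                  HasVelocityAt 𝓘(𝕜, EuclideanSpace 𝕜 (Fin d)) XO
                    (fun s => κ.symm (toReduced Gr (S.bigCell F) (S.moment F) (c s))) t) ∧
                -- the quotient flow on the orbit is given by the Lax equation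
                ∃ dH : (E →L[𝕜] 𝕜) → E,
                  (∀ ξ, HasFDerivAt (polyFun H) (ContinuousLinearMap.apply 𝕜 𝕜 (dH ξ)) ξ) ∧
                  ∀ A : E →L[𝕜] E, A = rPlus r ∨ A = rMinus r →
                    (∀ (γ : 𝕜 → S.Orbit F) (t : 𝕜),
                      HasVelocityAt 𝓘(𝕜, EuclideanSpace 𝕜 (Fin d)) XO γ t →
                      ∀ Y : E, HasDerivAt (fun s => (γ s).1 Y)
                        ((γ t).1 (lieBr 𝕜 G (A (dH (γ t).1)) Y)) t) ∧
                    -- for a nondegenerate invariant bilinear form `B` on the Lie algebra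
                    ∀ B : LinearMap.BilinForm 𝕜 E, B.Nondegenerate →
                      (∀ X Y Z : E, B (lieBr 𝕜 G X Y) Z = B X (lieBr 𝕜 G Y Z)) →
                      ∃ L : (E →L[𝕜] 𝕜) ≃L[𝕜] E, (∀ ξ Y, B (L ξ) Y = ξ Y) ∧
                        ∀ (γ : 𝕜 → S.Orbit F) (t : 𝕜),
                          HasVelocityAt 𝓘(𝕜, EuclideanSpace 𝕜 (Fin d)) XO γ t →
                          HasDerivAt (fun s => L (γ s).1)
                            (lieBr 𝕜 G (L (γ t).1) (A (dH (γ t).1))) t) := by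
  have : CompleteSpace E := FiniteDimensional.complete 𝕜 E
  have : FiniteDimensional 𝕜 E' := S.lie.toLinearEquiv.finiteDimensional
  have : CompleteSpace E' := FiniteDimensional.complete 𝕜 E'
  obtain ⟨d, cO, hO, hi⟩ := S.exists_isOrbitManifold F
  obtain ⟨σ, hσ⟩ := RSubgroup.exists_kirillovForm hO hi
  obtain ⟨a, cL, hL⟩ := RSubgroup.exists_isLevelManifold hO
  obtain ⟨ht2, cR, hR, κ, hκ⟩ := RSubgroup.exists_reduced_diffeomorph hS hO
  refine ⟨d, cO, σ, hO, hσ, RSubgroup.isHamiltonianAction hO hσ, a, d, cL, cR,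
    RSubgroup.reducedForm σ κ, hL.isSymplecticReduction hO hσ hS hκ ht2 hR, κ, hκ, ?_, ?_⟩
  · exact fun f v w => RSubgroup.reducedForm_diffAt (κ.contMDiff.hasDiffAt f) v w
  intro hG H hH
  obtain ⟨dH, hdH, hC⟩ := hH.exists_diff
  have hκp : ∀ z, κ.symm (S.proj F z) = S.baseProj F (RSubgroup.levelBase z) := fun z => by
    rw [RSubgroup.proj_eq hκ hS, κ.symm_apply_apply]
  have hHz : ∀ z : S.Level F,
      polyFun H (S.baseProj F (RSubgroup.levelBase z)).1 = polyFun H z.1.1.2 := by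
    intro z
    obtain ⟨h, f, rfl, -⟩ := RSubgroup.exists_smul_slice z
    rw [RSubgroup.baseProj_smul_slice hS]
    -- At `h • (1, f, f)` the fibre coordinate is `coAd (h₋) f`, where the Casimir element has the
    -- same value as at `f`.
    exact (hH.polyFun_coAd (S.minus h) f.1).symm
  have hpoly : ContMDiff 𝓘(𝕜, EuclideanSpace 𝕜 (Fin d)) 𝓘(𝕜, 𝕜) ∞
      (fun f : S.Orbit F => polyFun H f.1) :=
    (contDiff_polyFun H).contMDiff.comp hO.contMDiff_coe
  have hXR : ∀ f, (RSubgroup.orbitVecReduced κ dH (κ f) : EuclideanSpace 𝕜 (Fin d))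
      = diffAt 𝓘(𝕜, EuclideanSpace 𝕜 (Fin d)) 𝓘(𝕜, EuclideanSpace 𝕜 (Fin d)) κ f
        (S.orbitVec F dH f) := RSubgroup.orbitVecReduced_apply
  refine ⟨fun h h' p => hH.polyFun_coAd h' p.2, fun q => polyFun H (κ.symm q).1,
    hpoly.comp κ.symm.contMDiff, fun z => (congrArg (fun f : S.Orbit F => polyFun H f.1) (hκp z)).trans
      (hHz z),
    fun f => (congrArg (fun f : S.Orbit F => polyFun H f.1) (κ.symm_apply_apply f)).trans
      (congrArg (fun x => polyFun x f.1) (iR_eq r H).symm), RSubgroup.casimirVec d dH,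
    RSubgroup.orbitVecReduced κ dH, S.orbitVec F dH,
    RSubgroup.isHamiltonianField_casimirVec hdH hC,
    RSubgroup.isHamiltonianField_orbitVecReduced hO hσ hdH, ?_, fun z => ?_, fun f => (hXR f).symm,
    fun c t hc => ?_, dH, hdH, fun A hA => ⟨fun γ t hγ Y => hO.lax hC hA hγ Y,
      fun B hB hinv => hO.exists_lax hC hA hB hinv⟩⟩
  · rw [iR_eq]
    exact RSubgroup.isHamiltonianField_orbitVec hO hσ hdH
  · have hι := (hL.contMDiff_coe hO).hasDiffAt z
    obtain ⟨u, hu⟩ := hL.exists_tangent hO hC z hι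
    have hp := (hL.contMDiff_baseProj hO hS).hasDiffAt z
    have hpu := hL.diffAt_baseProj_tangent hO hσ hS hdH hC hHz z hι hp hu
    have hπ := ((κ.contMDiff.hasDiffAt _).comp hp rfl).congr
      (Filter.Eventually.of_forall (RSubgroup.proj_eq hκ hS))
    refine ⟨u, hu, (hπ.mfderiv_apply u).trans ?_⟩
    rw [ContinuousLinearMap.comp_apply, hpu, ← hXR, ← RSubgroup.proj_eq hκ hS]
  · have h := hL.hasVelocityAt_baseProj hO hσ hS hdH hC hHz c t hc
    simp only [← hκp] at h
    exact h
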